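/- Conventions. Manifolds are smooth, finite-dimensional, Hausdorff and second countable. A contact form $\eta$ on a connected manifold $M$ of dimension $2n+1$ is a nowhere vanishing 1-form with $d\eta$ nondegenerate on $\ker\eta$; its Reeb vector field $\mathcal R$ is defined by $i_{\mathcal R}\eta=1$, $i_{\mathcal R}d\eta=0$. We call $(M,\eta)$ a principal contactification of a symplectic manifold $(N,\omega)$, with minimal period $\rho\in(0,+\infty]$, if $\mathcal R$ is complete, its flow induces a free action of $\mathbb R/\rho\mathbb Z$ (of $\mathbb R$ if $\rho=+\infty$), and there is a surjective submersion $p:M\to N$ whose fibres are the orbits, so that $p$ is a principal bundle, with $p^*\omega=d\eta$. Its prequantum line bundle $\mathbb L\to N$ is the complex line bundle whose smooth sections are the smooth functions $F:M\to\mathbb C$ with $F(\exp(t\mathcal R)(y))=e^{-2\pi it/\rho}F(y)$ (where $e^{-2\pi it/\rho}=1$ if $\rho=+\infty$), with the Hermitian metric $\langle F,G\rangle=F\,\overline G$ and the linear connection $D_XF=X^h(F)$, where $X^h$ is the lift of the vector field $X$ to $M$ with $\eta(X^h)=0$. Theorem. For $j=1,2$ let $(M_j,\eta_j)$ be a principal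 contactification of a symplectic manifold $(N_j,\omega_j)$, with projection $p_j$ and Reeb vector field $\mathcal R_j$, both with the same minimal period $\rho\in(0,+\infty]$. Then the quotient $$M=(M_1\times M_2)/(\mathcal R_1-\mathcal R_2)$$ of $M_1\times M_2$ by the flow of $\mathcal R_1-\mathcal R_2$ is a connected manifold of dimension $\dim M_1+\dim M_2-1$ onto which the canonical projection is a submersion. The 1-form $\eta_1\oplus\eta_2$ descends to a contact form $\eta$ on $M$, and $(M,\eta)$, with the projection $[(y_1,y_2)]\mapsto(p_1(y_1),p_2(y_2))$, is a principal contactification of $(N_1\times N_2,\omega_1\oplus\omega_2)$ with minimal period $\rho$. The prequantum line bundle $\mathbb L$ of $(M,\eta)$ is a Hermitian line bundle with connection, and the products $(F_1\otimes F_2)([(y_1,y_2)])=F_1(y_1)F_2(y_2)$ of equivariant functions induce an isomorphism of line bundles over $N_1\times N_2$ between the tensor product $\mathbb L_1\otimes\mathbb L_2$, with fibre $(\mathbb L_1)_{x_1}\otimes(\mathbb L_2)_{x_2}$ over $(x_1,x_2)$, and $\mathbb L$. Under this isomorphism the metric of $\mathbb L$ is the product metric $$\langle\psi_1\otimes\psi_2,\psi_1'\otimes\psi_2'\rangle=\langle\psi_1,\psi_1'\rangle\cdot\langle\psi_2,\psi_2'\rangle,$$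 and the connection of $\mathbb L$ is the product connection $$D_{X_1\oplus X_2}(\psi_1\otimes\psi_2)=D^1_{X_1}\psi_1\otimes\psi_2+\psi_1\otimes D^2_{X_2}\psi_2.$$ -/

import Mathlib

open Bundle Set Function
open scoped Manifold ContDiff Topology TensorProduct

namespace Prequantization

/-! ### Differential forms of degree one and two, vector fields and flows -/

section Forms

variable {E : Type*} [NormedAddCommGroup E] [NormedSpace ℝ E]
  {H : Type*} [TopologicalSpace H] (I : ModelWithCorners ℝ E H)
  {M : Type*} [TopologicalSpace M] [ChartedSpace H M]
  {E' : Type*} [NormedAddCommGroup E'] [NormedSpace ℝ E']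
  {H' : Type*} [TopologicalSpace H'] (J : ModelWithCorners ℝ E' H')
  {N : Type*} [TopologicalSpace N] [ChartedSpace H' N]

/-- A vector field, not necessarily continuous. -/
abbrev VField (M : Type*) [TopologicalSpace M] [ChartedSpace H M] : Type _ :=
  Π x : M, TangentSpace I x

/-- A field of covectors, not necessarily continuous. -/
abbrev OneForm (M : Type*) [TopologicalSpace M] [ChartedSpace H M] : Type _ :=
  Π x : M, TangentSpace I x →L[ℝ] ℝ

/-- A field of bilinear forms on the tangent spaces; alternation and smoothness are imposed
separately. -/
abbrev TwoForm (M : Type*) [TopologicalSpace M] [ChartedSpace H M] : Type _ :=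
  Π x : M, TangentSpace I x →L[ℝ] TangentSpace I x →L[ℝ] ℝ

/-- The vector field `X` is smooth on `U`. -/
def SmoothVFieldOn [IsManifold I ∞ M] (X : VField I M) (U : Set M) : Prop :=
  ContMDiffOn I I.tangent ∞ (fun x ↦ (TotalSpace.mk' E x (X x) : TangentBundle I M)) U

/-- Smoothness of a 1-form, as a section of the cotangent bundle. -/
def SmoothOneForm [IsManifold I ∞ M] (η : OneForm I M) : Prop :=
  ContMDiff I (I.prod 𝓘(ℝ, E →L[ℝ] ℝ)) ∞
    (fun x ↦ TotalSpace.mk' (E →L[ℝ] ℝ)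
      (E := fun x : M ↦ TangentSpace I x →L[ℝ] Trivial M ℝ x) x (η x))

/-- Smoothness of a 2-form, as a section of the bundle of bilinear forms. -/
def SmoothTwoForm [IsManifold I ∞ M] (Ω : TwoForm I M) : Prop :=
  ContMDiff I (I.prod 𝓘(ℝ, E →L[ℝ] E →L[ℝ] ℝ)) ∞
    (fun x ↦ TotalSpace.mk' (E →L[ℝ] E →L[ℝ] ℝ)
      (E := fun x : M ↦ TangentSpace I x →L[ℝ] TangentSpace I x →L[ℝ] Trivial M ℝ x) x (Ω x))

variable {J} in
/-- Pullback of a 1-form. -/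
noncomputable def pullback₁ (f : M → N) (η : OneForm J N) : OneForm I M :=
  fun x ↦ (η (f x)).comp (mfderiv I J f x)

variable {J} in
/-- Pullback of a 2-form. -/
noncomputable def pullback₂ (f : M → N) (Ω : TwoForm J N) : TwoForm I M :=
  fun x ↦ (ContinuousLinearMap.precomp ℝ (mfderiv I J f x)).comp
    ((Ω (f x)).comp (mfderiv I J f x))

variable {I J} in
theorem pullback₂_apply (f : M → N) (Ω : TwoForm J N) (x : M) (u v : TangentSpace I x) :
    pullback₂ I f Ω x u v = Ω (f x) (mfderiv I J f x u) (mfderiv I J f x v) := rfl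

/-- The 1-form `η` read in the preferred chart at `x₀`, as a map on the model space. -/
noncomputable def oneFormInChart (η : OneForm I M) (x₀ : M) : E → E →L[ℝ] ℝ := fun e ↦
  (η ((extChartAt I x₀).symm e)).comp
    (mfderivWithin 𝓘(ℝ, E) I (extChartAt I x₀).symm (range I) e)

/-- The 2-form `Ω` read in the preferred chart at `x₀`, as a map on the model space. -/
noncomputable def twoFormInChart (Ω : TwoForm I M) (x₀ : M) : E → E →L[ℝ] E →L[ℝ] ℝ := fun e ↦
  (ContinuousLinearMap.precomp ℝ
      (mfderivWithin 𝓘(ℝ, E) I (extChartAt I x₀).symm (range I) e)).comp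
    ((Ω ((extChartAt I x₀).symm e)).comp
      (mfderivWithin 𝓘(ℝ, E) I (extChartAt I x₀).symm (range I) e))

/-- The exterior derivative of a 1-form, `dη(u, v) = D_u η(v) - D_v η(u)` in a chart. -/
noncomputable def extDeriv₁ (η : OneForm I M) (x : M) (u v : TangentSpace I x) : ℝ :=
  fderivWithin ℝ (oneFormInChart I η x) (range I) (extChartAt I x x)
      (mfderiv I 𝓘(ℝ, E) (extChartAt I x) x u) (mfderiv I 𝓘(ℝ, E) (extChartAt I x) x v)
    - fderivWithin ℝ (oneFormInChart I η x) (range I) (extChartAt I x x)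
      (mfderiv I 𝓘(ℝ, E) (extChartAt I x) x v) (mfderiv I 𝓘(ℝ, E) (extChartAt I x) x u)

/-- The exterior derivative of a 2-form,
`dΩ(u, v, w) = D_u Ω(v, w) + D_v Ω(w, u) + D_w Ω(u, v)` in a chart. -/
noncomputable def extDeriv₂ (Ω : TwoForm I M) (x : M) (u v w : TangentSpace I x) : ℝ :=
  let D := fderivWithin ℝ (twoFormInChart I Ω x) (range I) (extChartAt I x x)
  let A := mfderiv I 𝓘(ℝ, E) (extChartAt I x) x
  D (A u) (A v) (A w) + D (A v) (A w) (A u) + D (A w) (A u) (A v)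

/-- A symplectic form: a smooth closed nondegenerate 2-form. -/
structure IsSymplecticForm [IsManifold I ∞ M] (Ω : TwoForm I M) : Prop where
  smooth : SmoothTwoForm I Ω
  alternating : ∀ x (v : TangentSpace I x), Ω x v v = 0
  nondegenerate : ∀ x (v : TangentSpace I x), (∀ w, Ω x v w = 0) → v = 0
  closed : ∀ x (u v w : TangentSpace I x), extDeriv₂ I Ω x u v w = 0

/-- A contact form: a smooth nowhere vanishing 1-form `η` such that `dη` is nondegenerate on
the field of hyperplanes `ker η`. -/
structure IsContactForm [IsManifold I ∞ M] (η : OneForm I M) : Prop where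
  smooth : SmoothOneForm I η
  ne_zero : ∀ x, η x ≠ 0
  nondegenerate : ∀ x (v : TangentSpace I x), η x v = 0 →
    (∀ w : TangentSpace I x, η x w = 0 → extDeriv₁ I η x v w = 0) → v = 0

/-- `R` is the Reeb vector field of `η`. -/
structure IsReebField (η : OneForm I M) (R : VField I M) : Prop where
  apply_one : ∀ x, η x (R x) = 1
  extDeriv_zero : ∀ x (v : TangentSpace I x), extDeriv₁ I η x (R x) v = 0

/-- The one-parameter group `φ` is smooth and is the (complete) flow of the vector field `X`. -/
structure IsFlowOf (X : VField I M) (φ : Flow ℝ M) : Prop where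
  smooth : ContMDiff (𝓘(ℝ, ℝ).prod I) I ∞ (fun q : ℝ × M ↦ φ q.1 q.2)
  integralCurve : ∀ y, IsMIntegralCurve (I := I) (fun t ↦ φ t y) X

/-- A smooth map with surjective differentials. -/
structure IsSmoothSubmersion (f : M → N) : Prop where
  smooth : ContMDiff I J ∞ f
  surjective_mfderiv : ∀ x, Surjective (mfderiv I J f x)

variable {I J} in
/-- The vector field `X₁ ⊕ X₂` on a product of manifolds. -/
def prodVField (X₁ : VField I M) (X₂ : VField J N) : VField (I.prod J) (M × N) :=
  fun x ↦ (X₁ x.1, X₂ x.2)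

variable {I J} in
/-- The 1-form `η₁ ⊕ η₂` on a product of manifolds. -/
noncomputable def prodOneForm (η₁ : OneForm I M) (η₂ : OneForm J N) : OneForm (I.prod J) (M × N) :=
  pullback₁ (I.prod J) Prod.fst η₁ + pullback₁ (I.prod J) Prod.snd η₂

variable {I J} in
/-- The 2-form `Ω₁ ⊕ Ω₂` on a product of manifolds. -/
noncomputable def prodTwoForm (Ω₁ : TwoForm I M) (Ω₂ : TwoForm J N) : TwoForm (I.prod J) (M × N) :=
  pullback₂ (I.prod J) Prod.fst Ω₁ + pullback₂ (I.prod J) Prod.snd Ω₂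

end Forms

/-! ### The quotient by the flow of the difference of two vector fields -/

section Quotients

/-- The orbit equivalence relation of a flow. -/
def orbitSetoid {M : Type*} [TopologicalSpace M] (φ : Flow ℝ M) : Setoid M where
  r y y' := ∃ t, φ t y = y'
  iseqv :=
    { refl := fun y ↦ ⟨0, φ.map_zero_apply y⟩
      symm := by
        rintro y _ ⟨t, rfl⟩
        exact ⟨-t, by rw [← φ.map_add, neg_add_cancel, φ.map_zero_apply]⟩
      trans := by
        rintro y _ _ ⟨t, rfl⟩ ⟨s, rfl⟩
        exact ⟨s + t, φ.map_add s t y⟩ }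

variable {M₁ M₂ : Type*} [TopologicalSpace M₁] [TopologicalSpace M₂]

/-- The flow `(y₁, y₂) ↦ (φ₁ t y₁, φ₂ (-t) y₂)`: if `φ₁`, `φ₂` are the flows of `R₁`, `R₂`, this
is the flow of `R₁ - R₂` on the product (see `isFlowOf_differenceFlow`). -/
def differenceFlow (φ₁ : Flow ℝ M₁) (φ₂ : Flow ℝ M₂) : Flow ℝ (M₁ × M₂) where
  toFun t y := (φ₁ t y.1, φ₂ (-t) y.2)
  cont' := by
    have h₁ : Continuous fun q : ℝ × M₁ × M₂ ↦ φ₁ q.1 q.2.1 :=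
      φ₁.continuous continuous_fst (continuous_fst.comp continuous_snd)
    have h₂ : Continuous fun q : ℝ × M₁ × M₂ ↦ φ₂ (-q.1) q.2.2 :=
      φ₂.continuous continuous_fst.neg (continuous_snd.comp continuous_snd)
    exact h₁.prodMk h₂
  map_add' t s y := by
    ext
    · exact φ₁.map_add t s y.1
    · show φ₂ (-(t + s)) y.2 = φ₂ (-t) (φ₂ (-s) y.2)
      rw [neg_add, φ₂.map_add]
  map_zero' y := by
    ext
    · exact φ₁.map_zero_apply y.1
    · show φ₂ (-0) y.2 = y.2
      rw [neg_zero, φ₂.map_zero_apply]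

/-- The quotient `(M₁ × M₂) / (R₁ - R₂)`, with the quotient topology. -/
abbrev ReducedProduct (φ₁ : Flow ℝ M₁) (φ₂ : Flow ℝ M₂) : Type _ :=
  Quotient (orbitSetoid (differenceFlow φ₁ φ₂))

/-- The canonical projection `M₁ × M₂ → (M₁ × M₂) / (R₁ - R₂)`. -/
def ReducedProduct.mk (φ₁ : Flow ℝ M₁) (φ₂ : Flow ℝ M₂) : M₁ × M₂ → ReducedProduct φ₁ φ₂ :=
  Quotient.mk (orbitSetoid (differenceFlow φ₁ φ₂))

variable {E : Type*} [NormedAddCommGroup E] [NormedSpace ℝ E]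
  {H : Type*} [TopologicalSpace H] {I : ModelWithCorners ℝ E H} [ChartedSpace H M₁]
  {E' : Type*} [NormedAddCommGroup E'] [NormedSpace ℝ E']
  {H' : Type*} [TopologicalSpace H'] {J : ModelWithCorners ℝ E' H'} [ChartedSpace H' M₂]

theorem isFlowOf_differenceFlow {R₁ : VField I M₁} {R₂ : VField J M₂}
    {φ₁ : Flow ℝ M₁} {φ₂ : Flow ℝ M₂} (h₁ : IsFlowOf I R₁ φ₁) (h₂ : IsFlowOf J R₂ φ₂) :
    IsFlowOf (I.prod J) (prodVField R₁ (-R₂)) (differenceFlow φ₁ φ₂) where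
  smooth := by
    have a : ContMDiff (𝓘(ℝ, ℝ).prod (I.prod J)) I ∞
        (fun q : ℝ × M₁ × M₂ ↦ φ₁ q.1 q.2.1) :=
      h₁.smooth.comp (contMDiff_fst.prodMk (contMDiff_fst.comp contMDiff_snd))
    have n : ContMDiff 𝓘(ℝ, ℝ) 𝓘(ℝ, ℝ) ∞ (fun t : ℝ ↦ -t) := contDiff_neg.contMDiff
    have b : ContMDiff (𝓘(ℝ, ℝ).prod (I.prod J)) J ∞
        (fun q : ℝ × M₁ × M₂ ↦ φ₂ (-q.1) q.2.2) :=
      h₂.smooth.comp ((n.comp contMDiff_fst).prodMk (contMDiff_snd.comp contMDiff_snd))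
    exact a.prodMk b
  integralCurve := by
    intro y
    have a := h₁.integralCurve y.1
    have b : IsMIntegralCurve (I := J) (fun t ↦ φ₂ (-t) y.2) (-R₂) := by
      have b' := (h₂.integralCurve y.2).comp_mul (-1)
      have e₁ : (fun t ↦ φ₂ t y.2) ∘ (fun t : ℝ ↦ t * -1) = fun t ↦ φ₂ (-t) y.2 := by
        funext t
        show φ₂ (t * -1) y.2 = φ₂ (-t) y.2
        rw [mul_neg_one]
      have e₂ : (-1 : ℝ) • R₂ = -R₂ := by
        funext x
        exact neg_one_smul ℝ (R₂ x)
      rwa [e₁, e₂] at b'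
    intro t
    refine ((a t).prodMk (b t)).congr_mfderiv ?_
    ext <;> rfl

end Quotients

/-! ### Principal contactifications -/

section Contactification

variable {E : Type*} [NormedAddCommGroup E] [NormedSpace ℝ E]
  {H : Type*} [TopologicalSpace H] (I : ModelWithCorners ℝ E H)
  {M : Type*} [TopologicalSpace M] [ChartedSpace H M]
  {E' : Type*} [NormedAddCommGroup E'] [NormedSpace ℝ E']
  {H' : Type*} [TopologicalSpace H'] (J : ModelWithCorners ℝ E' H')
  {N : Type*} [TopologicalSpace N] [ChartedSpace H' N]

/-- The group of periods of a flow with minimal period `ρ ∈ (0, ∞]`: it is `ρ ℤ` if `ρ` is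
finite, and trivial if `ρ = ∞` (note that `(⊤ : ENNReal).toReal = 0`). -/
def periodGroup (ρ : ENNReal) : AddSubgroup ℝ := AddSubgroup.zmultiples ρ.toReal

/-- `(M, η)`, with Reeb vector field `R` and Reeb flow `φ`, is a principal contactification of the
symplectic manifold `(N, Ω)`, with projection `p : M → N = M / R` and minimal period
`ρ ∈ (0, ∞]` of the Reeb vector field.

The flow of `R` is an action of `ℝ / ρℤ` (which is `U(1)` for finite `ρ` and `ℝ` for `ρ = ∞`).
It is free (`period`), its orbits are the fibres of the surjective submersion `p` (`orbits`), and
there are local trivializations `(x, t) ↦ φ t (σ x)` coming from smooth local sections `σ`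
(`localSection`); so it makes `p` a principal bundle. -/
structure IsPrincipalContactification [IsManifold I ∞ M] [IsManifold J ∞ N]
    (η : OneForm I M) (R : VField I M) (φ : Flow ℝ M) (p : M → N) (Ω : TwoForm J N)
    (ρ : ENNReal) : Prop where
  symplectic : IsSymplecticForm J Ω
  contact : IsContactForm I η
  reeb : IsReebField I η R
  flow : IsFlowOf I R φ
  period_pos : 0 < ρ
  period : ∀ y t, φ t y = y ↔ t ∈ periodGroup ρ
  surjective : Surjective p
  submersion : IsSmoothSubmersion I J p
  orbits : ∀ y y', p y = p y' ↔ ∃ t, φ t y = y'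
  localSection : ∀ x : N, ∃ (U : Set N) (σ : N → M), IsOpen U ∧ x ∈ U ∧
    ContMDiffOn J I ∞ σ U ∧ ∀ x' ∈ U, p (σ x') = x'
  extDeriv_eq : ∀ y (u v : TangentSpace I y), extDeriv₁ I η y u v = pullback₂ I p Ω y u v

end Contactification

/-! ### Hermitian line bundles with connection -/

section LineBundle

universe v v₁ v₂

variable {E : Type*} [NormedAddCommGroup E] [NormedSpace ℝ E]
  {H : Type*} [TopologicalSpace H] (J : ModelWithCorners ℝ E H)
  (N : Type*) [TopologicalSpace N] [ChartedSpace H N]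

/-- The data of a smooth complex line bundle with Hermitian metric and linear connection: the
fibres, the smooth sections over open sets, the metric (linear in the first variable) and the
covariant derivative `D X ψ`. A section over `U` is given by an arbitrary extension to all of `N`.
The axioms are `IsHermitianLineBundle` and `IsLinearConnection` below. -/
structure LineBundleData where
  Fiber : N → Type v
  [addCommGroup : ∀ x, AddCommGroup (Fiber x)]
  [module : ∀ x, Module ℂ (Fiber x)]
  SmoothOn : (Π x, Fiber x) → Set N → Prop
  herm : ∀ x, Fiber x → Fiber x → ℂ
  D : VField J N → (Π x, Fiber x) → Π x, Fiber x

attribute [instance] LineBundleData.addCommGroup LineBundleData.module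

variable {J N}

/-- The data define a smooth complex line bundle (smooth sections form a sheaf, which near every
point is freely generated over the smooth functions by one section that is a basis of each fibre)
with a smooth Hermitian metric. -/
structure LineBundleData.IsHermitianLineBundle (L : LineBundleData.{v} J N) : Prop where
  smoothOn_congr : ∀ (ψ ψ' : Π x, L.Fiber x) (U : Set N), IsOpen U → (∀ x ∈ U, ψ x = ψ' x) →
    L.SmoothOn ψ U → L.SmoothOn ψ' U
  smoothOn_iff_locally : ∀ (ψ : Π x, L.Fiber x) (U : Set N), IsOpen U →
    (L.SmoothOn ψ U ↔ ∀ x ∈ U, ∃ V ⊆ U, IsOpen V ∧ x ∈ V ∧ L.SmoothOn ψ V)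
  localFrame : ∀ x : N, ∃ (U : Set N) (e : Π x, L.Fiber x), IsOpen U ∧ x ∈ U ∧
    (∀ x' ∈ U, ∀ ξ : L.Fiber x', ∃! c : ℂ, ξ = c • e x') ∧
    ∀ V ⊆ U, IsOpen V → ∀ f : N → ℂ,
      L.SmoothOn (fun x' ↦ f x' • e x') V ↔ ContMDiffOn J 𝓘(ℝ, ℂ) ∞ f V
  herm_add_left : ∀ x (ξ ξ' ζ : L.Fiber x), L.herm x (ξ + ξ') ζ = L.herm x ξ ζ + L.herm x ξ' ζ
  herm_smul_left : ∀ x (c : ℂ) (ξ ζ : L.Fiber x), L.herm x (c • ξ) ζ = c * L.herm x ξ ζ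
  herm_symm : ∀ x (ξ ζ : L.Fiber x), L.herm x ζ ξ = (starRingEnd ℂ) (L.herm x ξ ζ)
  herm_pos : ∀ x (ξ : L.Fiber x), ξ ≠ 0 → 0 < (L.herm x ξ ξ).re
  herm_smooth : ∀ (ψ ψ' : Π x, L.Fiber x) (U : Set N), IsOpen U → L.SmoothOn ψ U →
    L.SmoothOn ψ' U → ContMDiffOn J 𝓘(ℝ, ℂ) ∞ (fun x ↦ L.herm x (ψ x) (ψ' x)) U

/-- `D` is a smooth linear connection. -/
structure LineBundleData.IsLinearConnection [IsManifold J ∞ N] (L : LineBundleData.{v} J N) :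
    Prop where
  local_ : ∀ (X X' : VField J N) (ψ ψ' : Π x, L.Fiber x) (U : Set N), IsOpen U →
    (∀ x ∈ U, X x = X' x) → (∀ x ∈ U, ψ x = ψ' x) → ∀ x ∈ U, L.D X ψ x = L.D X' ψ' x
  add_section : ∀ (X : VField J N) (ψ ψ' : Π x, L.Fiber x) (U : Set N), IsOpen U →
    L.SmoothOn ψ U → L.SmoothOn ψ' U → ∀ x ∈ U, L.D X (ψ + ψ') x = L.D X ψ x + L.D X ψ' x
  leibniz : ∀ (X : VField J N) (f : N → ℂ) (ψ : Π x, L.Fiber x) (U : Set N), IsOpen U →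
    ContMDiffOn J 𝓘(ℝ, ℂ) ∞ f U → L.SmoothOn ψ U → ∀ x ∈ U,
      L.D X (fun x ↦ f x • ψ x) x
        = f x • L.D X ψ x + mvfderiv J f x (X x) • ψ x
  add_vField : ∀ (X X' : VField J N) (ψ : Π x, L.Fiber x) (U : Set N), IsOpen U →
    L.SmoothOn ψ U → ∀ x ∈ U, L.D (X + X') ψ x = L.D X ψ x + L.D X' ψ x
  smul_vField : ∀ (g : N → ℝ) (X : VField J N) (ψ : Π x, L.Fiber x) (U : Set N), IsOpen U →
    L.SmoothOn ψ U → ∀ x ∈ U, L.D (fun x ↦ g x • X x) ψ x = (g x : ℂ) • L.D X ψ x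
  smooth : ∀ (X : VField J N) (ψ : Π x, L.Fiber x) (U : Set N), IsOpen U →
    SmoothVFieldOn J X U → L.SmoothOn ψ U → L.SmoothOn (L.D X ψ) U

variable {E' : Type*} [NormedAddCommGroup E'] [NormedSpace ℝ E']
  {H' : Type*} [TopologicalSpace H'] {J' : ModelWithCorners ℝ E' H'}
  {N' : Type*} [TopologicalSpace N'] [ChartedSpace H' N']

/-- Smooth sections over `W` of the (external) tensor product bundle, whose fibre over `(x₁, x₂)`
is the tensor product of the fibres over `x₁` and `x₂`: locally they are finite sums of tensor
products of smooth sections of the factors, with smooth coefficients. -/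
def tensorSmoothOn (L₁ : LineBundleData.{v₁} J N) (L₂ : LineBundleData.{v₂} J' N')
    (ψ : Π x : N × N', L₁.Fiber x.1 ⊗[ℂ] L₂.Fiber x.2) (W : Set (N × N')) : Prop :=
  ∀ x ∈ W, ∃ (U₁ : Set N) (U₂ : Set N'), IsOpen U₁ ∧ IsOpen U₂ ∧ x ∈ U₁ ×ˢ U₂ ∧ U₁ ×ˢ U₂ ⊆ W ∧
    ∃ (k : ℕ) (f : Fin k → N × N' → ℂ) (s₁ : Fin k → Π x, L₁.Fiber x)
      (s₂ : Fin k → Π x, L₂.Fiber x),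
      (∀ i, ContMDiffOn (J.prod J') 𝓘(ℝ, ℂ) ∞ (f i) (U₁ ×ˢ U₂)) ∧
      (∀ i, L₁.SmoothOn (s₁ i) U₁) ∧ (∀ i, L₂.SmoothOn (s₂ i) U₂) ∧
      ∀ z ∈ U₁ ×ˢ U₂, ψ z = ∑ i, f i z • (s₁ i z.1 ⊗ₜ[ℂ] s₂ i z.2)

/-- The fibrewise linear isomorphisms `Φ` identify `L` with the tensor product bundle of `L₁` and
`L₂`, the metric of `L` with the product metric, and the connection of `L` with the product
connection. -/
structure IsTensorProductIso (L₁ : LineBundleData.{v₁} J N) (L₂ : LineBundleData.{v₂} J' N')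
    (L : LineBundleData.{v} (J.prod J') (N × N'))
    (Φ : ∀ x : N × N', (L₁.Fiber x.1 ⊗[ℂ] L₂.Fiber x.2) ≃ₗ[ℂ] L.Fiber x) : Prop where
  smoothOn_iff : ∀ (ψ : Π x : N × N', L₁.Fiber x.1 ⊗[ℂ] L₂.Fiber x.2) (W : Set (N × N')),
    IsOpen W → (L.SmoothOn (fun x ↦ Φ x (ψ x)) W ↔ tensorSmoothOn L₁ L₂ ψ W)
  herm_tmul : ∀ (x : N × N') (ξ₁ ξ₁' : L₁.Fiber x.1) (ξ₂ ξ₂' : L₂.Fiber x.2),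
    L.herm x (Φ x (ξ₁ ⊗ₜ[ℂ] ξ₂)) (Φ x (ξ₁' ⊗ₜ[ℂ] ξ₂'))
      = L₁.herm x.1 ξ₁ ξ₁' * L₂.herm x.2 ξ₂ ξ₂'
  D_tmul : ∀ (X₁ : VField J N) (X₂ : VField J' N') (ψ₁ : Π x, L₁.Fiber x)
    (ψ₂ : Π x, L₂.Fiber x) (U₁ : Set N) (U₂ : Set N'), IsOpen U₁ → IsOpen U₂ →
    L₁.SmoothOn ψ₁ U₁ → L₂.SmoothOn ψ₂ U₂ → ∀ x ∈ U₁ ×ˢ U₂,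
      L.D (prodVField X₁ X₂) (fun x ↦ Φ x (ψ₁ x.1 ⊗ₜ[ℂ] ψ₂ x.2)) x
        = Φ x (L₁.D X₁ ψ₁ x.1 ⊗ₜ[ℂ] ψ₂ x.2 + ψ₁ x.1 ⊗ₜ[ℂ] L₂.D X₂ ψ₂ x.2)

end LineBundle

/-! ### The prequantum line bundle of a principal contactification -/

section Prequantum

variable {E : Type*} [NormedAddCommGroup E] [NormedSpace ℝ E]
  {H : Type*} [TopologicalSpace H] {I : ModelWithCorners ℝ E H}
  {M : Type*} [TopologicalSpace M] [ChartedSpace H M]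
  {E' : Type*} [NormedAddCommGroup E'] [NormedSpace ℝ E']
  {H' : Type*} [TopologicalSpace H'] {J : ModelWithCorners ℝ E' H'}
  {N : Type*} [TopologicalSpace N] [ChartedSpace H' N]

/-- `exp(-2πit/ρ)`; for `ρ = ∞` this is `1`, as `(⊤ : ENNReal).toReal = 0` and `t / 0 = 0`. -/
noncomputable def phase (ρ : ENNReal) (t : ℝ) : ℂ :=
  Complex.exp (-(2 * Real.pi * (t / ρ.toReal) : ℝ) * Complex.I)

/-- The fibre over `x` of the line bundle associated with `p : M → N`: the functions on the fibre
`p ⁻¹' {x}` with `f (φ t y) = exp(-2πit/ρ) f y`. -/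
def equivariantFunctions (φ : Flow ℝ M) (p : M → N) (ρ : ENNReal) (x : N) :
    Submodule ℂ ({y : M // p y = x} → ℂ) where
  carrier := {f | ∀ (y y' : {y : M // p y = x}) (t : ℝ), φ t y = y' → f y' = phase ρ t * f y}
  add_mem' := by
    intro f g hf hg y y' t h
    simp only [Pi.add_apply, hf y y' t h, hg y y' t h]
    ring
  zero_mem' := by
    intro y y' t _
    simp
  smul_mem' := by
    intro c f hf y y' t h
    simp only [Pi.smul_apply, smul_eq_mul, hf y y' t h]
    ring

/-- The equivariant function on `M` that corresponds to a section. -/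
def sectionFun {φ : Flow ℝ M} {p : M → N} {ρ : ENNReal}
    (ψ : Π x, equivariantFunctions φ p ρ x) : M → ℂ :=
  fun y ↦ (ψ (p y)).1 ⟨y, rfl⟩

/-- The horizontal lift to `T_y M` of a tangent vector `v` at `p y`: the vector `w` with `η w = 0`
and `dp w = v`, that is, the preimage of `(0, v)` under the isomorphism `(η, dp)`. -/
noncomputable def horizontalLift (η : OneForm I M) (p : M → N) (y : M)
    (v : TangentSpace J (p y)) : TangentSpace I y :=
  ((η y).prod (mfderiv I J p y)).inverse (0, v)

/-- The derivative of a function on `M` along the horizontal lift of a vector field on `N`. -/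
noncomputable def horizontalDeriv (η : OneForm I M) (p : M → N) (X : VField J N) (F : M → ℂ)
    (y : M) : ℂ :=
  mvfderiv I F y (horizontalLift η p y (X (p y)))

open Classical in
/-- The prequantum line bundle of a principal contactification. Its sections are the equivariant
functions `F` on `M`; the metric is given by the product of `F` and the conjugate of `G`, which is
constant on the fibres of `p`; the covariant derivative `D X F` is the derivative of `F` along the
horizontal lift of `X`. The default value `0` is never taken where `F` is smooth, because the
derivative is again equivariant; in particular the Leibniz rule excludes it. -/
noncomputable def prequantumBundle [IsManifold I ∞ M] [IsManifold J ∞ N]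
    {η : OneForm I M} {R : VField I M} {φ : Flow ℝ M} {p : M → N} {Ω : TwoForm J N} {ρ : ENNReal}
    (h : IsPrincipalContactification I J η R φ p Ω ρ) : LineBundleData J N where
  Fiber x := equivariantFunctions φ p ρ x
  SmoothOn ψ U := ContMDiffOn I 𝓘(ℝ, ℂ) ∞ (sectionFun ψ) (p ⁻¹' U)
  herm x f g :=
    let y : {y : M // p y = x} := ⟨surjInv h.surjective x, surjInv_eq h.surjective x⟩
    f.1 y * (starRingEnd ℂ) (g.1 y)
  D X ψ x :=
    if hD : (fun y : {y : M // p y = x} ↦ horizontalDeriv η p X (sectionFun ψ) y.1)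
        ∈ equivariantFunctions φ p ρ x
    then ⟨_, hD⟩ else 0

end Prequantum

end Prequantization

open Prequantization

namespace Prequantization

/-! Dividing by R₁ − R₂ identifies the two actions of ℝ/ρℤ (or of ℝ), so the quotient is the
contracted product of the two principal bundles over N₁ × N₂. Functions with the same equivariance
multiply to functions on it, which is why it carries the tensor product of the line bundles.

Manifold structure. Over a local section σ of p₂, write y₂ = φ₂ t (σ (p₂ y₂)); then [(y₁, y₂)] =
[(φ₁ t y₁, σ (p₂ y₂))]. The time t is unique up to periods of φ₂, and these are also the periods of
φ₁, so φ₁ t y₁ is well defined and the quotient looks locally like M₁ × N₂ (`exists_lift`,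
`exists_chart_prod`). By the inverse function theorem t can be chosen smoothly (`exists_time`). The
projection onto the quotient has smooth local sections through every point, so smoothness on the
quotient can be tested upstairs (`HasSmoothLocalSections`).

Contact structure. Since i_R η = 1 and i_R dη = 0, a Reeb flow preserves its form
(`IsFlowOf.pullback₁_eq`). Hence η₁ ⊕ η₂ is invariant under the flow of R₁ − R₂, and it vanishes on
R₁ − R₂ because 1 − 1 = 0; so it descends to a form η. The exterior derivative commutes with
pullback (`extDeriv₁_pullback₁`), which gives dη = p^*(Ω₁ ⊕ Ω₂). The flow [(y₁, y₂)] ↦ [(φ₁ t y₁,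
y₂)] has a generator with η = 1 and dp = 0. By a dimension count (η, dp) is an isomorphism on
tangent spaces, and nondegeneracy of dη on ker η becomes that of the symplectic form.

Line bundles. Equivariant functions are determined by their values along a local section of p, which
turns sections of the bundle into functions on the base and D into the usual derivative plus the
connection term (2πi/ρ) σ^*η (`horizontalDeriv_eq`). The horizontal lift of X₁ ⊕ X₂ is the image of
the pair of horizontal lifts, so the product connection is the Leibniz rule for F₁ F₂
(`horizontalDeriv_mk`); the product metric is the multiplicativity of F and of complex conjugation.
-/

theorem two_le_infty : (2 : WithTop ℕ∞) ≤ ∞ := by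
  exact WithTop.coe_le_coe.2 (le_top : (2 : ℕ∞) ≤ ⊤)

/-! ### Forms in charts and along maps from normed spaces -/

section FlatPullback

variable {E : Type*} [NormedAddCommGroup E] [NormedSpace ℝ E]
  {H : Type*} [TopologicalSpace H] {I : ModelWithCorners ℝ E H}
  {M : Type*} [TopologicalSpace M] [ChartedSpace H M]
  {V : Type*} [NormedAddCommGroup V] [NormedSpace ℝ V]

/-- The pullback of a 1-form by a map defined on a normed space, as a map into the dual space. -/
noncomputable def flatPullback (f : V → M) (η : OneForm I M) : V → V →L[ℝ] ℝ :=
  fun e ↦ (η (f e)).comp (mfderiv 𝓘(ℝ, V) I f e)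

theorem oneFormInChart_mfderiv [IsManifold I 1 M] (η : OneForm I M) {x₀ y : M}
    (hy : y ∈ (extChartAt I x₀).source) (w : TangentSpace I y) :
    oneFormInChart I η x₀ (extChartAt I x₀ y) (mfderiv I 𝓘(ℝ, E) (extChartAt I x₀) y w)
      = η y w := by
  have h := congrArg (fun A ↦ A w)
    (mfderivWithin_extChartAt_symm_comp_mfderiv_extChartAt' (I := I) hy)
  -- Every tangent space unfolds to the model space, so base points are changed by substitution
  -- under `show`. The same device recurs below.
  have key : ∀ z, z = y → ∀ a b : E, a = b →
      (show E →L[ℝ] ℝ from η z) a = (show E →L[ℝ] ℝ from η y) b := by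
    rintro z rfl a b rfl
    rfl
  exact key _ ((extChartAt I x₀).left_inv hy) _ _ h

theorem fderiv_extChartAt_comp [IsManifold I 1 M] {f : V → M} {x₀ : M} {e : V}
    (hf : MDifferentiableAt 𝓘(ℝ, V) I f e) (hx : f e ∈ (extChartAt I x₀).source) (v : V) :
    fderiv ℝ (extChartAt I x₀ ∘ f) e v
      = mfderiv I 𝓘(ℝ, E) (extChartAt I x₀) (f e) (mfderiv 𝓘(ℝ, V) I f e v) := by
  have h₁ : MDifferentiableAt I 𝓘(ℝ, E) (extChartAt I x₀) (f e) :=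
    mdifferentiableAt_extChartAt (by simpa using hx)
  have h := mfderiv_comp e h₁ hf
  rw [mfderiv_eq_fderiv] at h
  exact congrArg (fun A ↦ A v) h

theorem flatPullback_eq [IsManifold I 1 M] (η : OneForm I M) {f : V → M} {x₀ : M} {e : V}
    (hf : MDifferentiableAt 𝓘(ℝ, V) I f e) (hx : f e ∈ (extChartAt I x₀).source) :
    flatPullback f η e = (oneFormInChart I η x₀ (extChartAt I x₀ (f e))).comp
      (fderiv ℝ (extChartAt I x₀ ∘ f) e) := by
  refine ContinuousLinearMap.ext fun v ↦ ?_
  rw [ContinuousLinearMap.comp_apply, fderiv_extChartAt_comp hf hx]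
  exact (oneFormInChart_mfderiv η hx _).symm

theorem oneFormInChart_eq_flatPullback [I.Boundaryless] (η : OneForm I M) (x₀ : M) :
    oneFormInChart I η x₀ = flatPullback (extChartAt I x₀).symm η := by
  funext e
  unfold oneFormInChart flatPullback
  rw [I.range_eq_univ, mfderivWithin_univ]

theorem contMDiffAt_comp_extChartAt_iff [IsManifold I ∞ M] [I.Boundaryless] {g : E → V} {x₀ : M} :
    ContMDiffAt I 𝓘(ℝ, V) ∞ (fun x ↦ g (extChartAt I x₀ x)) x₀
      ↔ ContDiffAt ℝ ∞ g (extChartAt I x₀ x₀) := by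
  rw [contMDiffAt_iff_source, I.range_eq_univ, contMDiffWithinAt_univ, contMDiffAt_iff_contDiffAt]
  have h : (fun x ↦ g (extChartAt I x₀ x)) ∘ (extChartAt I x₀).symm
      =ᶠ[𝓝 (extChartAt I x₀ x₀)] g := by
    filter_upwards [extChartAt_target_mem_nhds (I := I) x₀] with e he
    exact congrArg g ((extChartAt I x₀).right_inv he)
  exact ⟨fun h' ↦ h'.congr_of_eventuallyEq h.symm, fun h' ↦ h'.congr_of_eventuallyEq h⟩

theorem symmL_trivializationAt_apply [IsManifold I ∞ M] {x₀ x : M}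
    (hx : x ∈ (extChartAt I x₀).source) (w : E) :
    (show E from (trivializationAt E (TangentSpace I) x₀).symmL ℝ x w)
      = mfderivWithin 𝓘(ℝ, E) I (extChartAt I x₀).symm (range I) (extChartAt I x₀ x) w := by
  have : IsManifold I 1 M := IsManifold.of_le (n := ∞) (by norm_num)
  rw [TangentBundle.symmL_trivializationAt (by simpa using hx)]
  rfl

/-- The inverse of the tangent trivialization at `x₀` is the derivative of the inverse chart, so the
coordinate expression of the section is `oneFormInChart`. This reduces smoothness to calculus on the
model space. -/
theorem smoothOneForm_iff [IsManifold I ∞ M] [I.Boundaryless] (η : OneForm I M) :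
    SmoothOneForm I η ↔ ∀ x₀, ContDiffAt ℝ ∞ (oneFormInChart I η x₀) (extChartAt I x₀ x₀) := by
  refine forall_congr' fun x₀ ↦ ?_
  rw [contMDiffAt_hom_bundle, ← contMDiffAt_comp_extChartAt_iff]
  refine (and_iff_right contMDiffAt_id).trans (Filter.EventuallyEq.contMDiffAt_iff ?_)
  filter_upwards [(isOpen_extChartAt_source (I := I) x₀).mem_nhds (mem_extChartAt_source x₀)]
    with x hx
  refine ContinuousLinearMap.ext fun w ↦ ?_
  have key : ∀ z, x = z → ∀ a b : E, a = b →
      (show E →L[ℝ] ℝ from η x) a = (show E →L[ℝ] ℝ from η z) b := by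
    rintro z rfl a b rfl
    rfl
  have h := key _ ((extChartAt I x₀).left_inv hx).symm _ _ (symmL_trivializationAt_apply hx w)
  refine Eq.trans ?_ h
  simp [ContinuousLinearMap.inCoordinates]
  rfl

theorem smoothTwoForm_iff [IsManifold I ∞ M] [I.Boundaryless] (Ω : TwoForm I M) :
    SmoothTwoForm I Ω ↔ ∀ x₀, ContDiffAt ℝ ∞ (twoFormInChart I Ω x₀) (extChartAt I x₀ x₀) := by
  refine forall_congr' fun x₀ ↦ ?_
  rw [contMDiffAt_hom_bundle, ← contMDiffAt_comp_extChartAt_iff]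
  refine (and_iff_right contMDiffAt_id).trans (Filter.EventuallyEq.contMDiffAt_iff ?_)
  filter_upwards [(isOpen_extChartAt_source (I := I) x₀).mem_nhds (mem_extChartAt_source x₀)]
    with x hx
  refine ContinuousLinearMap.ext fun v ↦ ContinuousLinearMap.ext fun w ↦ ?_
  have key : ∀ z, x = z → ∀ a b c d : E, a = b → c = d →
      (show E →L[ℝ] E →L[ℝ] ℝ from Ω x) a c = (show E →L[ℝ] E →L[ℝ] ℝ from Ω z) b d := by
    rintro z rfl a b c d rfl rfl
    rfl
  have h := key _ ((extChartAt I x₀).left_inv hx).symm _ _ _ _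
    (symmL_trivializationAt_apply hx v) (symmL_trivializationAt_apply hx w)
  refine Eq.trans ?_ h
  have hb : x ∈ (trivializationAt E (TangentSpace I) x₀).baseSet := by simpa using hx
  refine (_root_.inCoordinates_apply_eq₂ hb hb (Set.mem_univ _)).trans ?_
  rw [← Trivialization.symmL_apply (R := ℝ) _ hb, ← Trivialization.symmL_apply (R := ℝ) _ hb]
  simp
  rfl

/-- The exterior derivative of a 1-form on a normed space. -/
noncomputable def flatExtDeriv (β : V → V →L[ℝ] ℝ) (e u v : V) : ℝ :=
  fderiv ℝ β e u v - fderiv ℝ β e v u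

section

theorem contDiffAt_extChartAt_comp {f : V → M} {e : V} (hf : ContMDiffAt 𝓘(ℝ, V) I ∞ f e) :
    ContDiffAt ℝ ∞ (extChartAt I (f e) ∘ f) e :=
  contMDiffAt_iff_contDiffAt.1 ((contMDiffAt_extChartAt (I := I)).comp e hf)

variable [IsManifold I ∞ M]

theorem flatPullback_eventuallyEq (η : OneForm I M) {f : V → M} {e : V}
    (hf : ContMDiffAt 𝓘(ℝ, V) I ∞ f e) :
    flatPullback f η =ᶠ[𝓝 e] fun e' ↦
      (oneFormInChart I η (f e) ((extChartAt I (f e) ∘ f) e')).comp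
        (fderiv ℝ (extChartAt I (f e) ∘ f) e') := by
  have : IsManifold I 1 M := IsManifold.of_le (n := ∞) (by norm_num)
  have h₁ : ∀ᶠ e' in 𝓝 e, MDifferentiableAt 𝓘(ℝ, V) I f e' := by
    filter_upwards [contMDiffAt_iff_contMDiffAt_nhds (n := 1) (by simp) |>.1
      (hf.of_le (by norm_num))] with e' he'
    exact he'.mdifferentiableAt (by simp)
  have h₂ : ∀ᶠ e' in 𝓝 e, f e' ∈ (extChartAt I (f e)).source :=
    hf.continuousAt.eventually
      ((isOpen_extChartAt_source (I := I) (f e)).mem_nhds (mem_extChartAt_source _))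
  filter_upwards [h₁, h₂] with e' h₁ h₂
  exact flatPullback_eq η h₁ h₂

variable [I.Boundaryless]

theorem contDiffAt_flatPullback {η : OneForm I M}
    (hη : SmoothOneForm I η) {f : V → M} {e : V} (hf : ContMDiffAt 𝓘(ℝ, V) I ∞ f e) :
    ContDiffAt ℝ ∞ (flatPullback f η) e := by
  refine ContDiffAt.congr_of_eventuallyEq ?_ (flatPullback_eventuallyEq η hf)
  have hg := contDiffAt_extChartAt_comp hf
  have hc := ((smoothOneForm_iff η).1 hη (f e)).comp e hg
  exact hc.clm_comp (hg.fderiv_right (by simp))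

/-- With g the map f read in the chart and c the form in the chart, the pullback is c(g e) ∘ Dg(e).
Its derivative has the term Dc(Dg u)(Dg v) and the term c(D²g(u, v)); the latter is symmetric and
cancels after antisymmetrization. -/
theorem extDeriv₁_mfderiv {η : OneForm I M}
    (hη : SmoothOneForm I η) {f : V → M} {e : V} (hf : ContMDiffAt 𝓘(ℝ, V) I ∞ f e) (u v : V) :
    extDeriv₁ I η (f e) (mfderiv 𝓘(ℝ, V) I f e u) (mfderiv 𝓘(ℝ, V) I f e v)
      = flatExtDeriv (flatPullback f η) e u v := by
  have : IsManifold I 1 M := IsManifold.of_le (n := ∞) (by norm_num)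
  have hg := contDiffAt_extChartAt_comp hf
  have hc := (smoothOneForm_iff η).1 hη (f e)
  have hg₁ : DifferentiableAt ℝ (extChartAt I (f e) ∘ f) e := hg.differentiableAt (by simp)
  have hg₂ : DifferentiableAt ℝ (fderiv ℝ (extChartAt I (f e) ∘ f)) e :=
    (hg.fderiv_right (m := 1) two_le_infty).differentiableAt (by simp)
  have hc₁ := (hc.differentiableAt (by simp)).hasFDerivAt.comp e hg₁.hasFDerivAt
  have hβ := (hc₁.clm_comp hg₂.hasFDerivAt).congr_of_eventuallyEq (flatPullback_eventuallyEq η hf)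
  have hs : IsSymmSndFDerivAt ℝ (extChartAt I (f e) ∘ f) e :=
    hg.isSymmSndFDerivAt (by simpa using two_le_infty)
  have hfe : MDifferentiableAt 𝓘(ℝ, V) I f e := hf.mdifferentiableAt (by simp)
  have hx : f e ∈ (extChartAt I (f e)).source := mem_extChartAt_source _
  unfold extDeriv₁ flatExtDeriv
  rw [hβ.fderiv, I.range_eq_univ, fderivWithin_univ, ← fderiv_extChartAt_comp hfe hx,
    ← fderiv_extChartAt_comp hfe hx]
  have hs' := hs.eq u v
  simp only [_root_.add_apply, ContinuousLinearMap.comp_apply,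
    ContinuousLinearMap.compL_apply, ContinuousLinearMap.flip_apply, hs', Function.comp_apply]
  ring

end

end FlatPullback


/-! ### Pullback of one-forms between manifolds -/

section Naturality

variable {E : Type*} [NormedAddCommGroup E] [NormedSpace ℝ E]
  {H : Type*} [TopologicalSpace H] {I : ModelWithCorners ℝ E H}
  {M : Type*} [TopologicalSpace M] [ChartedSpace H M]
  {E' : Type*} [NormedAddCommGroup E'] [NormedSpace ℝ E']
  {H' : Type*} [TopologicalSpace H'] {J : ModelWithCorners ℝ E' H'}
  {N : Type*} [TopologicalSpace N] [ChartedSpace H' N]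
  {V : Type*} [NormedAddCommGroup V] [NormedSpace ℝ V]

theorem isManifold_one [IsManifold I ∞ M] : IsManifold I 1 M :=
  IsManifold.of_le (n := ∞) (by norm_num)

theorem ContMDiffAt.eventually_mdifferentiableAt [IsManifold I ∞ M] [IsManifold J ∞ N] {f : M → N}
    {x : M} (hf : ContMDiffAt I J ∞ f x) : ∀ᶠ x' in 𝓝 x, MDifferentiableAt I J f x' := by
  have : IsManifold I 1 M := isManifold_one
  have : IsManifold J 1 N := isManifold_one
  filter_upwards [contMDiffAt_iff_contMDiffAt_nhds (n := 1) (by simp) |>.1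
    (hf.of_le (by norm_num))] with e' he'
  exact he'.mdifferentiableAt (by simp)

theorem contMDiffAt_extChartAt_symm [IsManifold I ∞ M] [I.Boundaryless] (x : M) :
    ContMDiffAt 𝓘(ℝ, E) I ∞ (extChartAt I x).symm (extChartAt I x x) :=
  (contMDiffOn_extChartAt_symm x).contMDiffAt (extChartAt_target_mem_nhds x)

theorem extDeriv₁_congr_point (η : OneForm I M) {x x' : M} (hx : x = x') {u v u' v' : E}
    (hu : u = u') (hv : v = v') : extDeriv₁ I η x u v = extDeriv₁ I η x' u' v' := by
  subst hx hu hv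
  rfl

theorem extDeriv₁_eq_flatExtDeriv [I.Boundaryless] (η : OneForm I M) (x : M)
    (u v : TangentSpace I x) :
    extDeriv₁ I η x u v = flatExtDeriv (oneFormInChart I η x) (extChartAt I x x)
      (mfderiv I 𝓘(ℝ, E) (extChartAt I x) x u) (mfderiv I 𝓘(ℝ, E) (extChartAt I x) x v) := by
  unfold extDeriv₁ flatExtDeriv
  rw [I.range_eq_univ, fderivWithin_univ]

theorem flatExtDeriv_congr {β β' : V → V →L[ℝ] ℝ} {e : V} (h : β =ᶠ[𝓝 e] β') :
    flatExtDeriv β e = flatExtDeriv β' e := by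
  funext u v
  unfold flatExtDeriv
  rw [h.fderiv_eq]

theorem flatExtDeriv_add {β β' : V → V →L[ℝ] ℝ} {e : V} (h : DifferentiableAt ℝ β e)
    (h' : DifferentiableAt ℝ β' e) (u v : V) :
    flatExtDeriv (β + β') e u v = flatExtDeriv β e u v + flatExtDeriv β' e u v := by
  unfold flatExtDeriv
  rw [fderiv_add h h']
  simp only [_root_.add_apply]
  ring

section

variable [IsManifold I ∞ M] [IsManifold J ∞ N]

theorem flatPullback_pullback₁ (η : OneForm J N) {F : M → N} {f : V → M} {e : V}
    (hf : ContMDiffAt 𝓘(ℝ, V) I ∞ f e) (hF : ContMDiffAt I J ∞ F (f e)) :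
    flatPullback f (pullback₁ I F η) =ᶠ[𝓝 e] flatPullback (F ∘ f) η := by
  filter_upwards [ContMDiffAt.eventually_mdifferentiableAt hf,
    hf.continuousAt.eventually (ContMDiffAt.eventually_mdifferentiableAt hF)] with e' h₁ h₂
  unfold flatPullback pullback₁
  rw [mfderiv_comp e' h₂ h₁]
  rfl

variable [I.Boundaryless] [J.Boundaryless]

omit [IsManifold I ∞ M] in
-- The map `s` may change with the point. This is the form needed for a descended form, which is
-- only locally a pullback, along varying local sections.
theorem smoothOneForm_of_eventuallyEq_pullback₁ [IsManifold I ∞ M] {η : OneForm I M}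
    {α : OneForm J N} (hα : SmoothOneForm J α)
    (h : ∀ x, ∃ s : M → N, ContMDiffAt I J ∞ s x ∧ ∀ᶠ x' in 𝓝 x, η x' = pullback₁ I s α x') :
    SmoothOneForm I η := by
  rw [smoothOneForm_iff]
  intro x
  obtain ⟨s, hs, h⟩ := h x
  have hc := contMDiffAt_extChartAt_symm (I := I) x
  have hx : (extChartAt I x).symm (extChartAt I x x) = x := extChartAt_to_inv x
  have hs' : ContMDiffAt I J ∞ s ((extChartAt I x).symm (extChartAt I x x)) := by rwa [hx]
  have h' : oneFormInChart I η x =ᶠ[𝓝 (extChartAt I x x)]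
      flatPullback (extChartAt I x).symm (pullback₁ I s α) := by
    rw [oneFormInChart_eq_flatPullback]
    have := hc.continuousAt.eventually (by rwa [hx] : ∀ᶠ x' in 𝓝 _, η x' = pullback₁ I s α x')
    filter_upwards [this] with e he
    unfold flatPullback
    rw [he]
  refine (contDiffAt_flatPullback hα (hs'.comp _ hc)).congr_of_eventuallyEq ?_
  exact h'.trans (flatPullback_pullback₁ α hc hs')

theorem SmoothOneForm.pullback₁ {η : OneForm J N} (hη : SmoothOneForm J η) {F : M → N}
    (hF : ContMDiff I J ∞ F) : SmoothOneForm I (pullback₁ I F η) :=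
  smoothOneForm_of_eventuallyEq_pullback₁ hη fun x ↦ ⟨F, hF x, .of_forall fun _ ↦ rfl⟩

/-- The inverse chart at x is a parametrization of M by a normed space, and its composite with F is
one into N. Both sides become the flat exterior derivative of the same pulled back form. -/
theorem extDeriv₁_pullback₁ {η : OneForm J N} (hη : SmoothOneForm J η) {F : M → N} {x : M}
    (hF : ContMDiffAt I J ∞ F x) (u v : TangentSpace I x) :
    extDeriv₁ I (pullback₁ I F η) x u v
      = extDeriv₁ J η (F x) (mfderiv I J F x u) (mfderiv I J F x v) := by
  have : IsManifold I 1 M := isManifold_one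
  have hc := contMDiffAt_extChartAt_symm (I := I) x
  have hx : (extChartAt I x).symm (extChartAt I x x) = x := extChartAt_to_inv x
  have hF' : ContMDiffAt I J ∞ F ((extChartAt I x).symm (extChartAt I x x)) := by rwa [hx]
  rw [extDeriv₁_eq_flatExtDeriv, oneFormInChart_eq_flatPullback,
    flatExtDeriv_congr (flatPullback_pullback₁ η hc hF')]
  refine (extDeriv₁_mfderiv hη (hF'.comp _ hc) _ _).symm.trans ?_
  have key : ∀ w : TangentSpace I x,
      (show E' from mfderiv 𝓘(ℝ, E) J (F ∘ (extChartAt I x).symm) (extChartAt I x x)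
        (mfderiv I 𝓘(ℝ, E) (extChartAt I x) x w)) = mfderiv I J F x w := by
    intro w
    have h₁ : MDifferentiableAt I 𝓘(ℝ, E) (extChartAt I x) x :=
      mdifferentiableAt_extChartAt (mem_chart_source H x)
    have h₂ : MDifferentiableAt 𝓘(ℝ, E) J (F ∘ (extChartAt I x).symm) (extChartAt I x x) :=
      (hF'.comp _ hc).mdifferentiableAt (by simp)
    have h := mfderiv_comp x h₂ h₁
    have h' : (F ∘ (extChartAt I x).symm) ∘ extChartAt I x =ᶠ[𝓝 x] F := by
      filter_upwards [extChartAt_source_mem_nhds (I := I) x] with y hy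
      exact congrArg F ((extChartAt I x).left_inv hy)
    have h'' := h'.mfderiv_eq (I := I) (I' := J)
    have h₃ : (show E →L[ℝ] E' from mfderiv I J ((F ∘ (extChartAt I x).symm) ∘ extChartAt I x) x) w
      = (show E →L[ℝ] E' from mfderiv I J F x) w := congrArg (fun A : E →L[ℝ] E' ↦ A w) h''
    exact (congrArg (fun A : E →L[ℝ] E' ↦ A w) h).symm.trans h₃
  exact extDeriv₁_congr_point η (congrArg F hx) (key u) (key v)

end

theorem oneFormInChart_add (η η' : OneForm I M) (x : M) :
    oneFormInChart I (η + η') x = oneFormInChart I η x + oneFormInChart I η' x := by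
  funext e
  exact ContinuousLinearMap.add_comp _ _ _

section

variable [IsManifold I ∞ M] [I.Boundaryless]

theorem SmoothOneForm.add {η η' : OneForm I M} (h : SmoothOneForm I η) (h' : SmoothOneForm I η') :
    SmoothOneForm I (η + η') := by
  rw [smoothOneForm_iff] at *
  intro x
  rw [oneFormInChart_add]
  exact (h x).add (h' x)

theorem extDeriv₁_add {η η' : OneForm I M} (h : SmoothOneForm I η) (h' : SmoothOneForm I η')
    (x : M) (u v : TangentSpace I x) :
    extDeriv₁ I (η + η') x u v = extDeriv₁ I η x u v + extDeriv₁ I η' x u v := by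
  rw [smoothOneForm_iff] at h h'
  simp only [extDeriv₁_eq_flatExtDeriv, oneFormInChart_add]
  exact flatExtDeriv_add ((h x).differentiableAt (by simp)) ((h' x).differentiableAt (by simp)) _ _

end

/-! ### Products of one-forms and of symplectic forms -/

section Products

theorem add_add_add_add_comm {A : Type*} [AddCommMonoid A] (a b c d e f : A) :
    a + b + (c + d) + (e + f) = a + c + e + (b + d + f) := by
  abel

theorem prodOneForm_apply (η₁ : OneForm I M) (η₂ : OneForm J N) (x : M × N)
    (v : TangentSpace I x.1) (w : TangentSpace J x.2) :
    prodOneForm η₁ η₂ x (v, w) = η₁ x.1 v + η₂ x.2 w := by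
  unfold prodOneForm pullback₁
  rw [Pi.add_apply, mfderiv_fst, mfderiv_snd]
  rfl

theorem prodTwoForm_apply (Ω₁ : TwoForm I M) (Ω₂ : TwoForm J N) (x : M × N)
    (v v' : TangentSpace I x.1) (w w' : TangentSpace J x.2) :
    prodTwoForm Ω₁ Ω₂ x (v, w) (v', w') = Ω₁ x.1 v v' + Ω₂ x.2 w w' := by
  unfold prodTwoForm pullback₂
  rw [Pi.add_apply, mfderiv_fst, mfderiv_snd]
  rfl

variable [IsManifold I ∞ M] [IsManifold J ∞ N] [I.Boundaryless] [J.Boundaryless]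

theorem SmoothOneForm.prodOneForm {η₁ : OneForm I M} {η₂ : OneForm J N} (h₁ : SmoothOneForm I η₁)
    (h₂ : SmoothOneForm J η₂) : SmoothOneForm (I.prod J) (prodOneForm η₁ η₂) :=
  (h₁.pullback₁ contMDiff_fst).add (h₂.pullback₁ contMDiff_snd)

theorem extDeriv₁_prodOneForm {η₁ : OneForm I M} {η₂ : OneForm J N} (h₁ : SmoothOneForm I η₁)
    (h₂ : SmoothOneForm J η₂) (x : M × N) (u v : TangentSpace (I.prod J) x) :
    extDeriv₁ (I.prod J) (Prequantization.prodOneForm η₁ η₂) x u v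
      = extDeriv₁ I η₁ x.1 u.1 v.1 + extDeriv₁ J η₂ x.2 u.2 v.2 := by
  refine (extDeriv₁_add (h₁.pullback₁ contMDiff_fst) (h₂.pullback₁ contMDiff_snd) x u v).trans ?_
  rw [extDeriv₁_pullback₁ h₁ contMDiff_fst.contMDiffAt,
    extDeriv₁_pullback₁ h₂ contMDiff_snd.contMDiffAt, mfderiv_fst, mfderiv_snd]
  rfl

/-- Pullback of bilinear forms by a linear map. -/
noncomputable def bilinPullback (A : V →L[ℝ] E) :
    (E →L[ℝ] E →L[ℝ] ℝ) →L[ℝ] V →L[ℝ] V →L[ℝ] ℝ :=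
  ((ContinuousLinearMap.compL ℝ V E (V →L[ℝ] ℝ)).flip A).comp
    (ContinuousLinearMap.compL ℝ E (E →L[ℝ] ℝ) (V →L[ℝ] ℝ) (ContinuousLinearMap.precomp ℝ A))

section

variable {F F' W : Type*} [NormedAddCommGroup F] [NormedSpace ℝ F] [NormedAddCommGroup F']
  [NormedSpace ℝ F'] [NormedAddCommGroup W] [NormedSpace ℝ W] (A : F →L[ℝ] W) (A' : F' →L[ℝ] W)
  {f : E → F} {g : E' → F'} {e : E × E'}

/-- Used with W the bilinear forms on E × E' and with A, A' the pullbacks along the two projections;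
the target is abstract to keep the calculus free of nested spaces of linear maps. -/
theorem contDiffAt_clm_comp_fst_add_snd (hf : ContDiffAt ℝ ∞ f e.1) (hg : ContDiffAt ℝ ∞ g e.2) :
    ContDiffAt ℝ ∞ (fun e : E × E' ↦ A (f e.1) + A' (g e.2)) e :=
  (A.contDiff.contDiffAt.comp e (hf.comp e contDiffAt_fst)).add
    (A'.contDiff.contDiffAt.comp e (hg.comp e contDiffAt_snd))

theorem fderiv_clm_comp_fst_add_snd (hf : DifferentiableAt ℝ f e.1)
    (hg : DifferentiableAt ℝ g e.2) (r : E × E') :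
    fderiv ℝ (fun e : E × E' ↦ A (f e.1) + A' (g e.2)) e r
      = A (fderiv ℝ f e.1 r.1) + A' (fderiv ℝ g e.2 r.2) := by
  have h := ((A.hasFDerivAt.comp e (hf.hasFDerivAt.comp e hasFDerivAt_fst)).add
    (A'.hasFDerivAt.comp e (hg.hasFDerivAt.comp e hasFDerivAt_snd))).fderiv
  exact congrArg (fun A : (E × E') →L[ℝ] W ↦ A r) h

end

section

variable {f : E → E →L[ℝ] E →L[ℝ] ℝ} {g : E' → E' →L[ℝ] E' →L[ℝ] ℝ} {e : E × E'}

theorem contDiffAt_bilinPullback_fst_add_snd (hf : ContDiffAt ℝ ∞ f e.1)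
    (hg : ContDiffAt ℝ ∞ g e.2) :
    ContDiffAt ℝ ∞ (fun e : E × E' ↦ bilinPullback (ContinuousLinearMap.fst ℝ E E') (f e.1)
      + bilinPullback (ContinuousLinearMap.snd ℝ E E') (g e.2)) e :=
  have h := @contDiffAt_clm_comp_fst_add_snd E _ _ E' _ _ (E →L[ℝ] E →L[ℝ] ℝ)
    (E' →L[ℝ] E' →L[ℝ] ℝ) ((E × E') →L[ℝ] (E × E') →L[ℝ] ℝ)
  h _ _ hf hg

/-- A shortcut instance: the search for the general one is slow on bilinear forms. -/
noncomputable instance bilinNormedAddCommGroup : NormedAddCommGroup (E →L[ℝ] E →L[ℝ] ℝ) :=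
  ContinuousLinearMap.toNormedAddCommGroup

theorem fderiv_bilinPullback_fst_add_snd (hf : DifferentiableAt ℝ f e.1)
    (hg : DifferentiableAt ℝ g e.2) (r s t : E × E') :
    fderiv ℝ (fun e : E × E' ↦ bilinPullback (ContinuousLinearMap.fst ℝ E E') (f e.1)
      + bilinPullback (ContinuousLinearMap.snd ℝ E E') (g e.2)) e r s t
      = fderiv ℝ f e.1 r.1 s.1 t.1 + fderiv ℝ g e.2 r.2 s.2 t.2 := by
  have h := @fderiv_clm_comp_fst_add_snd E _ _ E' _ _ (E →L[ℝ] E →L[ℝ] ℝ)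
    (E' →L[ℝ] E' →L[ℝ] ℝ) ((E × E') →L[ℝ] (E × E') →L[ℝ] ℝ)
  exact congrArg (fun A : (E × E') →L[ℝ] (E × E') →L[ℝ] ℝ ↦ A s t) (h _ _ hf hg r)

end

/-- A chart of the product is the product of charts, so its inverse has block diagonal derivative.
The identity is asserted only near the point because the inverse charts must be differentiable,
which holds on the chart target. -/
theorem twoFormInChart_prodTwoForm (Ω₁ : TwoForm I M) (Ω₂ : TwoForm J N) (x : M × N) :
    twoFormInChart (I.prod J) (prodTwoForm Ω₁ Ω₂) x =ᶠ[𝓝 (extChartAt (I.prod J) x x)]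
      fun e ↦ bilinPullback (ContinuousLinearMap.fst ℝ E E') (twoFormInChart I Ω₁ x.1 e.1)
        + bilinPullback (ContinuousLinearMap.snd ℝ E E') (twoFormInChart J Ω₂ x.2 e.2) := by
  have : IsManifold I 1 M := isManifold_one
  have : IsManifold J 1 N := isManifold_one
  filter_upwards [extChartAt_target_mem_nhds (I := I.prod J) x] with e he
  rw [extChartAt_prod] at he
  have h₁ : MDifferentiableAt 𝓘(ℝ, E) I (extChartAt I x.1).symm e.1 :=
    ((contMDiffOn_extChartAt_symm (n := 1) x.1).mdifferentiableOn (by simp)).mdifferentiableAt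
      ((isOpen_extChartAt_target x.1).mem_nhds he.1)
  have h₂ : MDifferentiableAt 𝓘(ℝ, E') J (extChartAt J x.2).symm e.2 :=
    ((contMDiffOn_extChartAt_symm (n := 1) x.2).mdifferentiableOn (by simp)).mdifferentiableAt
      ((isOpen_extChartAt_target x.2).mem_nhds he.2)
  have hA : ∀ u : E × E', (show E × E' from mfderivWithin 𝓘(ℝ, E × E') (I.prod J)
      (extChartAt (I.prod J) x).symm (range (I.prod J)) e u)
      = (mfderivWithin 𝓘(ℝ, E) I (extChartAt I x.1).symm (range I) e.1 u.1,
        mfderivWithin 𝓘(ℝ, E') J (extChartAt J x.2).symm (range J) e.2 u.2) := by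
    intro u
    have h := (h₁.hasMFDerivAt.prodMap h₂.hasMFDerivAt).mfderiv
    -- The normed space E × E' has to be seen as a product manifold before the derivative of a
    -- product map applies.
    rw [modelWithCornersSelf_prod, ← chartedSpaceSelf_prod]
    rw [(I.prod J).range_eq_univ, I.range_eq_univ, J.range_eq_univ]
    simp only [mfderivWithin_univ]
    exact congrArg (fun A : (E × E') →L[ℝ] E × E' ↦ A u) h
  refine ContinuousLinearMap.ext fun u ↦ ContinuousLinearMap.ext fun v ↦ ?_
  exact (congrArg₂ (fun a b ↦ (show (E × E') →L[ℝ] (E × E') →L[ℝ] ℝ from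
    prodTwoForm Ω₁ Ω₂ ((extChartAt (I.prod J) x).symm e)) a b) (hA u) (hA v)).trans
      (prodTwoForm_apply Ω₁ Ω₂ _ _ _ _ _)

theorem SmoothTwoForm.prodTwoForm {Ω₁ : TwoForm I M} {Ω₂ : TwoForm J N}
    (h₁ : SmoothTwoForm I Ω₁) (h₂ : SmoothTwoForm J Ω₂) :
    SmoothTwoForm (I.prod J) (prodTwoForm Ω₁ Ω₂) := by
  rw [smoothTwoForm_iff]
  intro x
  refine ContDiffAt.congr_of_eventuallyEq ?_ (twoFormInChart_prodTwoForm Ω₁ Ω₂ x)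
  have a := (smoothTwoForm_iff Ω₁).1 h₁ x.1
  have b := (smoothTwoForm_iff Ω₂).1 h₂ x.2
  exact contDiffAt_bilinPullback_fst_add_snd (e := extChartAt (I.prod J) x x) a b

theorem fderiv_twoFormInChart_prodTwoForm {Ω₁ : TwoForm I M} {Ω₂ : TwoForm J N}
    (h₁ : SmoothTwoForm I Ω₁) (h₂ : SmoothTwoForm J Ω₂) (x : M × N) (r s t : E × E') :
    fderiv ℝ (twoFormInChart (I.prod J) (prodTwoForm Ω₁ Ω₂) x) (extChartAt (I.prod J) x x) r s t
      = fderiv ℝ (twoFormInChart I Ω₁ x.1) (extChartAt I x.1 x.1) r.1 s.1 t.1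
        + fderiv ℝ (twoFormInChart J Ω₂ x.2) (extChartAt J x.2 x.2) r.2 s.2 t.2 := by
  have a := ((smoothTwoForm_iff Ω₁).1 h₁ x.1).differentiableAt (by simp)
  have b := ((smoothTwoForm_iff Ω₂).1 h₂ x.2).differentiableAt (by simp)
  have c := (twoFormInChart_prodTwoForm Ω₁ Ω₂ x).fderiv_eq (𝕜 := ℝ)
  exact (congrArg (fun A : (E × E') →L[ℝ] (E × E') →L[ℝ] (E × E') →L[ℝ] ℝ ↦ A r s t) c).trans
    (fderiv_bilinPullback_fst_add_snd (e := extChartAt (I.prod J) x x) a b r s t)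

theorem extDeriv₂_eq (Ω : TwoForm I M) (x : M) (u v w : TangentSpace I x) :
    extDeriv₂ I Ω x u v w = fderiv ℝ (twoFormInChart I Ω x) (extChartAt I x x) u v w
      + fderiv ℝ (twoFormInChart I Ω x) (extChartAt I x x) v w u
      + fderiv ℝ (twoFormInChart I Ω x) (extChartAt I x x) w u v := by
  have : IsManifold I 1 M := isManifold_one
  unfold extDeriv₂
  rw [I.range_eq_univ, fderivWithin_univ, mfderiv_extChartAt_self]
  rfl

theorem extDeriv₂_prodTwoForm {Ω₁ : TwoForm I M} {Ω₂ : TwoForm J N}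
    (h₁ : SmoothTwoForm I Ω₁) (h₂ : SmoothTwoForm J Ω₂) (x : M × N)
    (u v w : TangentSpace (I.prod J) x) :
    extDeriv₂ (I.prod J) (prodTwoForm Ω₁ Ω₂) x u v w
      = extDeriv₂ I Ω₁ x.1 u.1 v.1 w.1 + extDeriv₂ J Ω₂ x.2 u.2 v.2 w.2 := by
  have hD := fderiv_twoFormInChart_prodTwoForm h₁ h₂ x
  rw [extDeriv₂_eq]
  refine (congrArg₂ (· + ·) (congrArg₂ (· + ·) (hD u v w) (hD v w u)) (hD w u v)).trans ?_
  refine (add_add_add_add_comm _ _ _ _ _ _).trans ?_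
  exact (congrArg₂ (· + ·) (extDeriv₂_eq Ω₁ x.1 u.1 v.1 w.1)
    (extDeriv₂_eq Ω₂ x.2 u.2 v.2 w.2)).symm

theorem IsSymplecticForm.prodTwoForm {Ω₁ : TwoForm I M} {Ω₂ : TwoForm J N}
    (h₁ : IsSymplecticForm I Ω₁) (h₂ : IsSymplecticForm J Ω₂) :
    IsSymplecticForm (I.prod J) (prodTwoForm Ω₁ Ω₂) where
  smooth := h₁.smooth.prodTwoForm h₂.smooth
  alternating x v := by
    obtain ⟨v, w⟩ := v
    refine (prodTwoForm_apply Ω₁ Ω₂ x v v w w).trans ?_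
    exact (congrArg₂ (· + ·) (h₁.alternating x.1 v) (h₂.alternating x.2 w)).trans (add_zero 0)
  nondegenerate x v h := by
    obtain ⟨v, w⟩ := v
    -- Testing against (v', 0) and (0, w') separates the two factors.
    have a : v = 0 := h₁.nondegenerate x.1 v fun v' ↦ by
      have := (prodTwoForm_apply Ω₁ Ω₂ x v v' w 0).symm.trans (h (v', 0))
      rwa [map_zero, add_zero] at this
    have b : w = 0 := h₂.nondegenerate x.2 w fun w' ↦ by
      have := (prodTwoForm_apply Ω₁ Ω₂ x v 0 w w').symm.trans (h (0, w'))
      rwa [map_zero, zero_add] at this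
    rw [a, b]
    rfl
  closed x u v w := by
    rw [extDeriv₂_prodTwoForm h₁.smooth h₂.smooth]
    exact (congrArg₂ (· + ·) (h₁.closed x.1 u.1 v.1 w.1) (h₂.closed x.2 u.2 v.2 w.2)).trans
      (add_zero 0)

end Products

end Naturality


/-! ### Invariance of the contact form under the Reeb flow -/

section Flows

variable {E : Type*} [NormedAddCommGroup E] [NormedSpace ℝ E]
  {H : Type*} [TopologicalSpace H] {I : ModelWithCorners ℝ E H}
  {M : Type*} [TopologicalSpace M] [ChartedSpace H M]
  {V : Type*} [NormedAddCommGroup V] [NormedSpace ℝ V]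
  {R : VField I M} {φ : Flow ℝ M} {η : OneForm I M}

theorem IsFlowOf.contMDiff (h : IsFlowOf I R φ) (t : ℝ) : ContMDiff I I ∞ (φ t) :=
  h.smooth.comp (contMDiff_const.prodMk contMDiff_id)

theorem IsFlowOf.contMDiffAt_comp (h : IsFlowOf I R φ) {c : V → M} {e : V}
    (hc : ContMDiffAt 𝓘(ℝ, V) I ∞ c e) (t : ℝ) :
    ContMDiffAt 𝓘(ℝ, ℝ × V) I ∞ (fun q : ℝ × V ↦ φ q.1 (c q.2)) (t, e) := by
  have h₁ : ContMDiffAt 𝓘(ℝ, ℝ × V) 𝓘(ℝ, ℝ) ∞ (fun q : ℝ × V ↦ q.1) (t, e) :=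
    contDiffAt_fst.contMDiffAt
  have h₂ : ContMDiffAt 𝓘(ℝ, ℝ × V) 𝓘(ℝ, V) ∞ (fun q : ℝ × V ↦ q.2) (t, e) :=
    contDiffAt_snd.contMDiffAt
  exact h.smooth.contMDiffAt.comp (t, e) (h₁.prodMk (hc.comp (t, e) h₂))

theorem IsFlowOf.mfderiv_comp_fst (h : IsFlowOf I R φ) {c : V → M} {e : V} {t : ℝ}
    (hf : MDifferentiableAt 𝓘(ℝ, ℝ × V) I (fun q : ℝ × V ↦ φ q.1 (c q.2)) (t, e)) (a : ℝ) :
    mfderiv 𝓘(ℝ, ℝ × V) I (fun q : ℝ × V ↦ φ q.1 (c q.2)) (t, e) (a, 0)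
      = (show E from a • R (φ t (c e))) := by
  have h₁ : HasMFDerivAt 𝓘(ℝ, ℝ) 𝓘(ℝ, ℝ × V) (fun s : ℝ ↦ (s, e)) t
      (ContinuousLinearMap.inl ℝ ℝ V) :=
    ((hasFDerivAt_id t).prodMk (hasFDerivAt_const e t)).hasMFDerivAt
  have h₂ := hf.hasMFDerivAt.comp t h₁
  have h₃ := hasMFDerivAt_unique h₂ (h.integralCurve (c e) t)
  exact congrArg (fun A : ℝ →L[ℝ] E ↦ A a) h₃

theorem IsFlowOf.mfderiv_comp_snd (h : IsFlowOf I R φ) {c : V → M} {e : V} {t : ℝ}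
    (hf : MDifferentiableAt 𝓘(ℝ, ℝ × V) I (fun q : ℝ × V ↦ φ q.1 (c q.2)) (t, e))
    (hc : MDifferentiableAt 𝓘(ℝ, V) I c e) (w : V) :
    mfderiv 𝓘(ℝ, ℝ × V) I (fun q : ℝ × V ↦ φ q.1 (c q.2)) (t, e) (0, w)
      = (show E from mfderiv I I (φ t) (c e) (mfderiv 𝓘(ℝ, V) I c e w)) := by
  have h₁ : HasMFDerivAt 𝓘(ℝ, V) 𝓘(ℝ, ℝ × V) (fun e' : V ↦ (t, e')) e
      (ContinuousLinearMap.inr ℝ ℝ V) :=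
    ((hasFDerivAt_const t e).prodMk (hasFDerivAt_id e)).hasMFDerivAt
  have h₂ := hf.hasMFDerivAt.comp e h₁
  have h₃ := ((h.contMDiff t).mdifferentiable (by simp) (c e)).hasMFDerivAt.comp e hc.hasMFDerivAt
  exact congrArg (fun A : V →L[ℝ] E ↦ A w) (hasMFDerivAt_unique h₂ h₃)

variable [IsManifold I ∞ M] [I.Boundaryless]

/-- The flow of the Reeb field preserves the contact form; here along a map from a vector space. -/
theorem IsFlowOf.reeb_invariant_flat (h : IsFlowOf I R φ) (hη : SmoothOneForm I η)
    (hR : IsReebField I η R) {c : V → M} {e : V} (hc : ContMDiffAt 𝓘(ℝ, V) I ∞ c e) (w : V)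
    (t : ℝ) :
    flatPullback (fun q : ℝ × V ↦ φ q.1 (c q.2)) η (t, e) (0, w)
      = flatPullback (fun q : ℝ × V ↦ φ q.1 (c q.2)) η (0, e) (0, w) := by
  -- The flow becomes the translation in the first variable of ℝ × V; with β = f^*η, it is enough
  -- that β(∂_t) = 1 and that ∂_t lies in the kernel of dβ.
  set f : ℝ × V → M := fun q ↦ φ q.1 (c q.2) with hf
  set β := flatPullback f η with hβ
  have hβd : ∀ t, DifferentiableAt ℝ β (t, e) := fun t ↦
    (contDiffAt_flatPullback hη (h.contMDiffAt_comp hc t)).differentiableAt (by simp)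
  have hone : ∀ t, (fun q ↦ β q (1, 0)) =ᶠ[𝓝 (t, e)] fun _ ↦ (1 : ℝ) := by
    intro t
    filter_upwards [ContMDiffAt.eventually_mdifferentiableAt (h.contMDiffAt_comp hc t)] with q hq
    have h₁ := h.mfderiv_comp_fst hq 1
    refine (congrArg (fun v : E ↦ (show E →L[ℝ] ℝ from η (f q)) v) h₁).trans ?_
    refine Eq.trans ?_ (hR.apply_one (f q))
    exact congrArg (fun v : E ↦ (show E →L[ℝ] ℝ from η (f q)) v) (one_smul ℝ (show E from R (f q)))
  have hd : ∀ t, fderiv ℝ β (t, e) (1, 0) (0, w) = 0 := by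
    intro t
    have h₁ := extDeriv₁_mfderiv hη (h.contMDiffAt_comp hc t) (1, 0) (0, w)
    have hq := (h.contMDiffAt_comp hc t).mdifferentiableAt (by simp)
    have h₂ := h.mfderiv_comp_fst hq 1
    have h₃ : extDeriv₁ I η (f (t, e)) (mfderiv 𝓘(ℝ, ℝ × V) I f (t, e) (1, 0))
        (mfderiv 𝓘(ℝ, ℝ × V) I f (t, e) (0, w)) = 0 := by
      refine (extDeriv₁_congr_point η rfl (h₂.trans (one_smul ℝ _)) rfl).trans ?_
      exact hR.extDeriv_zero (f (t, e)) _
    -- This is the derivative of the constant function β(∂_t) = 1 in the direction w. So dβ(∂_t, w)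
    -- = 0 reduces to ∂_t (β(w)) = 0.
    have h₄ : fderiv ℝ β (t, e) (0, w) (1, 0) = 0 := by
      have h₅ := ((hβd t).hasFDerivAt.clm_apply (hasFDerivAt_const ((1 : ℝ), (0 : V)) (t, e)))
      have h₆ := h₅.unique ((hasFDerivAt_const (1 : ℝ) (t, e)).congr_of_eventuallyEq (hone t))
      have h₇ := congrArg (fun A : (ℝ × V) →L[ℝ] ℝ ↦ A (0, w)) h₆
      simpa using h₇
    have h₈ : flatExtDeriv β (t, e) (1, 0) (0, w) = 0 := h₁.symm.trans h₃
    unfold flatExtDeriv at h₈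
    rwa [h₄, sub_zero] at h₈
  have hg : ∀ t, HasDerivAt (fun t ↦ β (t, e) (0, w)) 0 t := by
    intro t
    have h₁ : HasFDerivAt (fun s : ℝ ↦ (s, e)) (ContinuousLinearMap.inl ℝ ℝ V) t :=
      (hasFDerivAt_id t).prodMk (hasFDerivAt_const e t)
    have h₂ := ((hβd t).hasFDerivAt.comp t h₁).clm_apply (hasFDerivAt_const ((0 : ℝ), w) t)
    have h₃ := h₂.hasDerivAt
    simpa [hd t] using h₃
  exact is_const_of_deriv_eq_zero (fun t ↦ (hg t).differentiableAt) (fun t ↦ (hg t).deriv) t 0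

/-- The flow of the Reeb field preserves the contact form. -/
theorem IsFlowOf.pullback₁_eq (h : IsFlowOf I R φ) (hη : SmoothOneForm I η)
    (hR : IsReebField I η R) (t : ℝ) : pullback₁ I (φ t) η = η := by
  have : IsManifold I 1 M := isManifold_one
  funext y
  refine ContinuousLinearMap.ext fun v ↦ ?_
  have hy : y ∈ (extChartAt I y).source := mem_extChartAt_source y
  refine (oneFormInChart_mfderiv (pullback₁ I (φ t) η) hy v).symm.trans
    (Eq.trans ?_ (oneFormInChart_mfderiv η hy v))
  set w : E := mfderiv I 𝓘(ℝ, E) (extChartAt I y) y v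
  have hc := contMDiffAt_extChartAt_symm (I := I) y
  -- On vectors tangent to the slice at time s, β is the form φ_s^*η in the chart; invariance
  -- compares s = t with s = 0.
  have key : ∀ s : ℝ, oneFormInChart I (pullback₁ I (φ s) η) y (extChartAt I y y) w
      = flatPullback (fun q : ℝ × E ↦ φ q.1 ((extChartAt I y).symm q.2)) η
        (s, extChartAt I y y) (0, w) := by
    intro s
    rw [oneFormInChart_eq_flatPullback]
    have h₁ := h.mfderiv_comp_snd ((h.contMDiffAt_comp hc s).mdifferentiableAt (by simp))
      (hc.mdifferentiableAt (by simp)) w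
    exact (congrArg (fun v : E ↦ (show E →L[ℝ] ℝ from
      η (φ s ((extChartAt I y).symm (extChartAt I y y)))) v) h₁).symm
  have h₀ : pullback₁ I (φ 0) η = η := by
    have h₁ : (φ 0 : M → M) = id := funext φ.map_zero_apply
    rw [h₁]
    funext y
    unfold pullback₁
    rw [mfderiv_id]
    exact ContinuousLinearMap.comp_id _
  have h₂ := (key t).trans ((h.reeb_invariant_flat hη hR hc w t).trans (key 0).symm)
  rwa [h₀] at h₂

end Flows


/-! ### Local structure of contactifications, and maps with smooth local sections -/

section Contactifications

variable {E : Type*} [NormedAddCommGroup E] [NormedSpace ℝ E]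
  {H : Type*} [TopologicalSpace H] {I : ModelWithCorners ℝ E H}
  {M : Type*} [TopologicalSpace M] [ChartedSpace H M]
  {E' : Type*} [NormedAddCommGroup E'] [NormedSpace ℝ E']
  {H' : Type*} [TopologicalSpace H'] {J : ModelWithCorners ℝ E' H'}
  {N : Type*} [TopologicalSpace N] [ChartedSpace H' N]
  {η : OneForm I M} {R : VField I M} {φ : Flow ℝ M} {p : M → N} {Ω : TwoForm J N} {ρ : ENNReal}

/-- Adding a multiple of r adjusts the value of A without changing B, which gives surjectivity; the
dimensions agree, so injectivity follows. -/
theorem bijective_prod_of_finrank [FiniteDimensional ℝ E] [FiniteDimensional ℝ E']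
    {A : E →L[ℝ] ℝ} {B : E →L[ℝ] E'} {r : E} (hA : A r = 1) (hB : B r = 0) (hs : Surjective B)
    (hd : Module.finrank ℝ E = Module.finrank ℝ E' + 1) : Bijective (A.prod B) := by
  have hs : Surjective (A.prod B).toLinearMap := by
    rintro ⟨a, b⟩
    obtain ⟨v, hv⟩ := hs b
    refine ⟨v + (a - A v) • r, Prod.ext ?_ ?_⟩
    · simp [hA]
    · simp [hB, hv]
  have hf : Module.finrank ℝ E = Module.finrank ℝ (ℝ × E') := by
    rw [hd, Module.finrank_prod, Module.finrank_self, add_comm]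
  exact ⟨(LinearMap.injective_iff_surjective_of_finrank_eq_finrank hf).2 hs, hs⟩

theorem IsFlowOf.mfderiv_comp_eq_zero (hφ : IsFlowOf I R φ) (hp : ContMDiff I J ∞ p)
    (ho : ∀ y t, p (φ t y) = p y) (y : M) : mfderiv I J p y (R y) = 0 := by
  have h₁ := (hφ.integralCurve y 0)
  have h₂ : HasMFDerivAt I J p (φ 0 y) _ := (hp.mdifferentiable (by simp) _).hasMFDerivAt
  have h₃ := h₂.comp 0 h₁
  have h₄ : p ∘ (fun t ↦ φ t y) = fun _ ↦ p y := funext fun t ↦ ho y t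
  rw [h₄] at h₃
  have h₅ := congrArg (fun A : ℝ →L[ℝ] E' ↦ A 1) (hasMFDerivAt_unique h₃ (hasMFDerivAt_const _ _))
  have h₆ : (show E →L[ℝ] E' from mfderiv I J p (φ 0 y)) ((1 : ℝ) • (show E from R (φ 0 y))) = 0 :=
    h₅
  rw [one_smul] at h₆
  have key : ∀ z, z = y → (show E →L[ℝ] E' from mfderiv I J p z) (show E from R z) = 0 →
      (show E →L[ℝ] E' from mfderiv I J p y) (show E from R y) = 0 := by
    rintro z rfl h
    exact h
  exact key _ (φ.map_zero_apply y) h₆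

/-- A smooth map with smooth local sections through every point of its domain. -/
structure HasSmoothLocalSections (I : ModelWithCorners ℝ E H) (J : ModelWithCorners ℝ E' H')
    (f : M → N) : Prop where
  smooth : ContMDiff I J ∞ f
  exists_section : ∀ y, ∃ (U : Set N) (s : N → M), IsOpen U ∧ f y ∈ U ∧ ContMDiffOn J I ∞ s U ∧
    (∀ x ∈ U, f (s x) = x) ∧ s (f y) = y

namespace IsPrincipalContactification

variable [IsManifold I ∞ M] [IsManifold J ∞ N] (h : IsPrincipalContactification I J η R φ p Ω ρ)
include h

theorem proj_flow (y : M) (t : ℝ) : p (φ t y) = p y :=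
  ((h.orbits y (φ t y)).2 ⟨t, rfl⟩).symm

theorem mfderiv_proj_reeb (y : M) : mfderiv I J p y (R y) = 0 :=
  h.flow.mfderiv_comp_eq_zero h.submersion.smooth h.proj_flow y

theorem flow_eq_iff (y : M) (s t : ℝ) : φ s y = φ t y ↔ s - t ∈ periodGroup ρ := by
  rw [← h.period (φ t y), ← φ.map_add, sub_add_cancel]

theorem prod_bijective [FiniteDimensional ℝ E] [FiniteDimensional ℝ E']
    (hd : Module.finrank ℝ E = Module.finrank ℝ E' + 1) (y : M) :
    Bijective ((η y).prod (mfderiv I J p y)) :=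
  bijective_prod_of_finrank (A := show E →L[ℝ] ℝ from η y)
    (B := show E →L[ℝ] E' from mfderiv I J p y) (r := show E from R y) (h.reeb.apply_one y) (h.mfderiv_proj_reeb y)
    (h.submersion.surjective_mfderiv y) hd

section Lift

variable [FiniteDimensional ℝ E] [FiniteDimensional ℝ E']
  (hd : Module.finrank ℝ E = Module.finrank ℝ E' + 1)
include hd

theorem eq_of_apply_eq {y : M} {v w : TangentSpace I y} (h₁ : η y v = η y w)
    (h₂ : mfderiv I J p y v = mfderiv I J p y w) : v = w :=
  (h.prod_bijective hd y).1 (Prod.ext h₁ h₂)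

theorem horizontalLift_spec (y : M) (v : TangentSpace J (p y)) :
    η y (horizontalLift η p y v) = 0 ∧ mfderiv I J p y (horizontalLift η p y v) = v := by
  have hb := h.prod_bijective hd y
  set L : E →L[ℝ] ℝ × E' := (show E →L[ℝ] ℝ from η y).prod (show E →L[ℝ] E' from mfderiv I J p y)
  have hL : Bijective L := hb
  set A : E ≃L[ℝ] ℝ × E' := (LinearEquiv.ofBijective L.toLinearMap hL).toContinuousLinearEquiv
  have hA : (A : E →L[ℝ] ℝ × E') = L := rfl
  have hv : L (L.inverse (0, v)) = (0, v) := by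
    rw [← hA, ContinuousLinearMap.inverse_equiv]
    exact A.apply_symm_apply _
  exact ⟨congrArg Prod.fst hv, congrArg Prod.snd hv⟩

theorem eq_horizontalLift {y : M} {w : TangentSpace I y} {v : TangentSpace J (p y)}
    (h₁ : η y w = 0) (h₂ : mfderiv I J p y w = v) : w = horizontalLift η p y v :=
  h.eq_of_apply_eq hd (h₁.trans (h.horizontalLift_spec hd y v).1.symm)
    (h₂.trans (h.horizontalLift_spec hd y v).2.symm)

end Lift

variable [J.Boundaryless] [FiniteDimensional ℝ E] [FiniteDimensional ℝ E']
  (hd : Module.finrank ℝ E = Module.finrank ℝ E' + 1)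

include hd in
/-- Near each point, the time needed to reach it from a local section can be chosen smoothly. -/
theorem exists_time {U : Set N} (hU : IsOpen U) {σ : N → M} (hσ : ContMDiffOn J I ∞ σ U)
    (hpσ : ∀ x ∈ U, p (σ x) = x) {y₀ : M} (hy₀ : p y₀ ∈ U) {t₀ : ℝ} (ht₀ : φ t₀ (σ (p y₀)) = y₀) :
    ∃ τ : M → ℝ, ContMDiffAt I 𝓘(ℝ, ℝ) ∞ τ y₀ ∧ τ y₀ = t₀ ∧
      ∀ᶠ y in 𝓝 y₀, φ (τ y) (σ (p y)) = y := by
  have : IsManifold I 1 M := isManifold_one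
  have : IsManifold J 1 N := isManifold_one
  set x₀ := p y₀ with hx₀
  set e₀ : E' := extChartAt J x₀ x₀ with he₀
  set c : E' → M := fun e ↦ σ ((extChartAt J x₀).symm e) with hc_def
  have hx : (extChartAt J x₀).symm e₀ = x₀ := extChartAt_to_inv x₀
  have hsymm := contMDiffAt_extChartAt_symm (I := J) x₀
  have hc : ContMDiffAt 𝓘(ℝ, E') I ∞ c e₀ := by
    refine ContMDiffAt.comp e₀ (g := σ) ?_ hsymm
    rw [hx]
    exact hσ.contMDiffAt (hU.mem_nhds hy₀)
  have hUe : ∀ᶠ e in 𝓝 e₀, (extChartAt J x₀).symm e ∈ U :=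
    hsymm.continuousAt.eventually (by rw [hx]; exact hU.mem_nhds hy₀)
  -- This is the local trivialization given by σ, in a chart of N. The smooth time will be the first
  -- component of its local inverse.
  set f : ℝ × E' → M := fun q ↦ φ q.1 (c q.2) with hf_def
  have hf : ContMDiffAt 𝓘(ℝ, ℝ × E') I ∞ f (t₀, e₀) := h.flow.contMDiffAt_comp hc t₀
  have hf₀ : f (t₀, e₀) = y₀ := by
    simp only [hf_def, hc_def]
    rw [hx, ht₀]
  set g : ℝ × E' → E := extChartAt I (f (t₀, e₀)) ∘ f with hg_def
  have hg : ContDiffAt ℝ ∞ g (t₀, e₀) := contDiffAt_extChartAt_comp hf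
  have hfd : MDifferentiableAt 𝓘(ℝ, ℝ × E') I f (t₀, e₀) := hf.mdifferentiableAt (by simp)
  -- Suppose df(a, w) = 0. Applying dp removes the flow direction and returns w, so w = 0; applying
  -- η to what is left, a • R, gives a = 0. Equality of dimensions makes the derivative invertible.
  have hinj : Injective (fderiv ℝ g (t₀, e₀)) := by
    refine (injective_iff_map_eq_zero _).2 fun q hq ↦ ?_
    obtain ⟨a, w⟩ := q
    rw [fderiv_extChartAt_comp hfd (mem_extChartAt_source _)] at hq
    have hi : Injective (mfderiv I 𝓘(ℝ, E) (extChartAt I (f (t₀, e₀))) (f (t₀, e₀))) :=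
      (isInvertible_mfderiv_extChartAt (mem_extChartAt_source _)).injective
    have hq₁ : mfderiv 𝓘(ℝ, ℝ × E') I f (t₀, e₀) (a, w) = 0 := hi (hq.trans (map_zero _).symm)
    have hpf : p ∘ f =ᶠ[𝓝 (t₀, e₀)] fun q ↦ (extChartAt J x₀).symm q.2 := by
      filter_upwards [continuousAt_snd.eventually hUe] with q hq
      exact (h.proj_flow _ _).trans (hpσ _ hq)
    have hsnd : HasMFDerivAt 𝓘(ℝ, ℝ × E') 𝓘(ℝ, E') (fun q : ℝ × E' ↦ q.2) (t₀, e₀)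
        (ContinuousLinearMap.snd ℝ ℝ E') := (hasFDerivAt_snd (p := (t₀, e₀))).hasMFDerivAt
    have hd₁ := (hsymm.mdifferentiableAt (by simp)).hasMFDerivAt.comp (t₀, e₀) hsnd
    have hd₂ := (h.submersion.smooth.mdifferentiable (by simp) (f (t₀, e₀))).hasMFDerivAt.comp
      (t₀, e₀) hfd.hasMFDerivAt
    have hd₃ := hasMFDerivAt_unique (hd₂.congr_of_eventuallyEq hpf.symm) hd₁
    have hd₄ : (show E →L[ℝ] E' from mfderiv I J p (f (t₀, e₀)))
        (mfderiv 𝓘(ℝ, ℝ × E') I f (t₀, e₀) (a, w))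
        = (show E' →L[ℝ] E' from mfderiv 𝓘(ℝ, E') J (extChartAt J x₀).symm e₀) w :=
      congrArg (fun A : (ℝ × E') →L[ℝ] E' ↦ A (a, w)) hd₃
    have hw : w = 0 := by
      have hj := mfderivWithin_range_extChartAt_symm (I := J) (x := x₀)
      rw [J.range_eq_univ, mfderivWithin_univ] at hj
      have hj' := congrArg (fun A : E' →L[ℝ] E' ↦ A w) hj
      refine hj'.symm.trans (hd₄.symm.trans ?_)
      exact (congrArg (show E →L[ℝ] E' from mfderiv I J p (f (t₀, e₀))) hq₁).trans (map_zero _)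
    subst hw
    have ha := (h.flow.mfderiv_comp_fst hfd a).symm.trans hq₁
    have ha' : (show E →L[ℝ] ℝ from η (f (t₀, e₀))) (a • (show E from R (f (t₀, e₀)))) = 0 :=
      (congrArg (show E →L[ℝ] ℝ from η (f (t₀, e₀))) ha).trans (map_zero _)
    rw [map_smul] at ha'
    have ha₁ : (show E →L[ℝ] ℝ from η (f (t₀, e₀))) (show E from R (f (t₀, e₀))) = 1 :=
      h.reeb.apply_one _
    rw [ha₁, smul_eq_mul, mul_one] at ha'
    rw [ha']
    rfl
  have hfr : Module.finrank ℝ (ℝ × E') = Module.finrank ℝ E := by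
    rw [hd, Module.finrank_prod, Module.finrank_self, add_comm]
  set A : (ℝ × E') ≃L[ℝ] E :=
    (LinearEquiv.ofBijective (fderiv ℝ g (t₀, e₀)).toLinearMap
      ⟨hinj, (LinearMap.injective_iff_surjective_of_finrank_eq_finrank hfr).1 hinj⟩
      ).toContinuousLinearEquiv with hA
  have hgA : HasFDerivAt g (A : (ℝ × E') →L[ℝ] E) (t₀, e₀) :=
    (hg.differentiableAt (by simp)).hasFDerivAt
  have hgS : HasStrictFDerivAt g (A : (ℝ × E') →L[ℝ] E) (t₀, e₀) :=
    hg.hasStrictFDerivAt' hgA (by simp)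
  set G : E → ℝ × E' := hg.localInverse hgA (by simp) with hG_def
  have hG : ContDiffAt ℝ ∞ G (g (t₀, e₀)) := hg.to_localInverse hgA (by simp)
  have hG₀ : G (g (t₀, e₀)) = (t₀, e₀) := hg.localInverse_apply_image hgA (by simp)
  have hGr : ∀ᶠ z in 𝓝 (g (t₀, e₀)), g (G z) = z := hgS.eventually_right_inverse
  have hchart : ContMDiffAt I 𝓘(ℝ, E) ∞ (extChartAt I (f (t₀, e₀))) (f (t₀, e₀)) :=
    contMDiffAt_extChartAt
  have hK : ContMDiffAt I 𝓘(ℝ, ℝ × E') ∞ (fun y ↦ G (extChartAt I (f (t₀, e₀)) y)) (f (t₀, e₀)) := by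
    have hG' : ContMDiffAt 𝓘(ℝ, E) 𝓘(ℝ, ℝ × E') ∞ G
      (extChartAt I (f (t₀, e₀)) (f (t₀, e₀))) := ContDiffAt.contMDiffAt hG
    exact hG'.comp _ hchart
  have hfst : ContMDiffAt 𝓘(ℝ, ℝ × E') 𝓘(ℝ, ℝ) ∞ (Prod.fst : ℝ × E' → ℝ)
      (G (extChartAt I (f (t₀, e₀)) (f (t₀, e₀)))) := contDiffAt_fst.contMDiffAt
  have hK₀ : G (extChartAt I (f (t₀, e₀)) (f (t₀, e₀))) = (t₀, e₀) := hG₀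
  have hev : ∀ᶠ y in 𝓝 (f (t₀, e₀)), φ (G (extChartAt I (f (t₀, e₀)) y)).1 (σ (p y)) = y := by
    have hcont : Filter.Tendsto (fun y ↦ G (extChartAt I (f (t₀, e₀)) y)) (𝓝 (f (t₀, e₀)))
        (𝓝 (t₀, e₀)) := by
      have := hK.continuousAt.tendsto
      rwa [hK₀] at this
    filter_upwards [hchart.continuousAt.eventually hGr,
      extChartAt_source_mem_nhds (I := I) (f (t₀, e₀)),
      (hf.continuousAt.tendsto.comp hcont).eventually
        (extChartAt_source_mem_nhds (I := I) (f (t₀, e₀))),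
      (continuousAt_snd.tendsto.comp hcont).eventually hUe] with y h₁ h₂ h₃ h₄
    -- The inverse function theorem gives equality only after applying the chart; both points lie in
    -- its source, where it is injective.
    have h₅ : f (G (extChartAt I (f (t₀, e₀)) y)) = y := (extChartAt I _).injOn h₃ h₂ h₁
    have h₆ : p y = (extChartAt J x₀).symm (G (extChartAt I (f (t₀, e₀)) y)).2 := by
      conv_lhs => rw [← h₅]
      exact (h.proj_flow _ _).trans (hpσ _ h₄)
    rw [h₆]
    exact h₅
  have hτ : ∃ τ : M → ℝ, ContMDiffAt I 𝓘(ℝ, ℝ) ∞ τ (f (t₀, e₀)) ∧ τ (f (t₀, e₀)) = t₀ ∧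
      ∀ᶠ y in 𝓝 (f (t₀, e₀)), φ (τ y) (σ (p y)) = y :=
    ⟨fun y ↦ (G (extChartAt I (f (t₀, e₀)) y)).1, ContMDiffAt.comp (f (t₀, e₀)) hfst hK,
      congrArg Prod.fst hK₀, hev⟩
  rwa [hf₀] at hτ

omit [J.Boundaryless] [FiniteDimensional ℝ E] [FiniteDimensional ℝ E'] in
-- Any local section can be moved by one fixed time of the flow so as to meet y.
theorem exists_section_through (y : M) : ∃ (U : Set N) (σ : N → M), IsOpen U ∧ p y ∈ U ∧
    ContMDiffOn J I ∞ σ U ∧ (∀ x ∈ U, p (σ x) = x) ∧ σ (p y) = y := by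
  obtain ⟨U, σ, hU, hy, hσ, hpσ⟩ := h.localSection (p y)
  obtain ⟨t, ht⟩ := (h.orbits (σ (p y)) y).1 (hpσ _ hy)
  exact ⟨U, fun x ↦ φ t (σ x), hU, hy, (h.flow.contMDiff t).comp_contMDiffOn hσ,
    fun x hx ↦ (h.proj_flow _ _).trans (hpσ x hx), ht⟩

end IsPrincipalContactification

namespace HasSmoothLocalSections

variable {f : M → N} (hf : HasSmoothLocalSections I J f)
include hf

/-- The derivative of a local section through y is a right inverse of the derivative of f. -/
theorem surjective_mfderiv (y : M) : Surjective (mfderiv I J f y) := by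
  obtain ⟨U, s, hU, hy, hs, hfs, hsy⟩ := hf.exists_section y
  have hs' : HasMFDerivAt J I s (f y) _ :=
    ((hs.contMDiffAt (hU.mem_nhds hy)).mdifferentiableAt (by simp)).hasMFDerivAt
  have hf' : HasMFDerivAt I J f (s (f y)) _ := (hf.smooth.mdifferentiable (by simp) _).hasMFDerivAt
  have h₁ := hf'.comp _ hs'
  have h₂ : f ∘ s =ᶠ[𝓝 (f y)] id := by
    filter_upwards [hU.mem_nhds hy] with x hx using hfs x hx
  have h₃ := hasMFDerivAt_unique (h₁.congr_of_eventuallyEq h₂.symm) (hasMFDerivAt_id (f y))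
  intro v
  refine ⟨(show E from mfderiv J I s (f y) v), ?_⟩
  have h₄ : (show E →L[ℝ] E' from mfderiv I J f (s (f y))) (show E from mfderiv J I s (f y) v) = v :=
    congrArg (fun A : E' →L[ℝ] E' ↦ A v) h₃
  have key : ∀ z, z = y → ∀ w : E, (show E →L[ℝ] E' from mfderiv I J f z) w = v →
      (show E →L[ℝ] E' from mfderiv I J f y) w = v := by
    rintro z rfl w hw
    exact hw
  exact key _ hsy _ h₄

theorem isSmoothSubmersion : IsSmoothSubmersion I J f := ⟨hf.smooth, hf.surjective_mfderiv⟩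

variable {E'' : Type*} [NormedAddCommGroup E''] [NormedSpace ℝ E'']
  {H'' : Type*} [TopologicalSpace H''] {K : ModelWithCorners ℝ E'' H''}
  {P : Type*} [TopologicalSpace P] [ChartedSpace H'' P]

/-- Smoothness at a point can be checked after composition with `f`. -/
theorem contMDiffAt_of_comp {g : N → P} {y : M} (hg : ContMDiffAt I K ∞ (g ∘ f) y) :
    ContMDiffAt J K ∞ g (f y) := by
  obtain ⟨U, s, hU, hy, hs, hfs, hsy⟩ := hf.exists_section y
  have h₁ : ContMDiffAt J K ∞ ((g ∘ f) ∘ s) (f y) := by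
    refine ContMDiffAt.comp _ ?_ (hs.contMDiffAt (hU.mem_nhds hy))
    rwa [hsy]
  refine h₁.congr_of_eventuallyEq ?_
  filter_upwards [hU.mem_nhds hy] with x hx
  exact congrArg g (hfs x hx).symm

theorem contMDiffOn_iff (hsurj : Surjective f) {g : N → P} {U : Set N} (hU : IsOpen U) :
    ContMDiffOn J K ∞ g U ↔ ContMDiffOn I K ∞ (g ∘ f) (f ⁻¹' U) := by
  refine ⟨fun h ↦ h.comp hf.smooth.contMDiffOn Subset.rfl, fun h x hx ↦ ?_⟩
  obtain ⟨y, rfl⟩ := hsurj x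
  exact (hf.contMDiffAt_of_comp (h.contMDiffAt
    ((hU.preimage hf.smooth.continuous).mem_nhds hx))).contMDiffWithinAt

theorem contMDiff_iff (hsurj : Surjective f) {g : N → P} :
    ContMDiff J K ∞ g ↔ ContMDiff I K ∞ (g ∘ f) := by
  rw [← contMDiffOn_univ, hf.contMDiffOn_iff hsurj isOpen_univ, preimage_univ, contMDiffOn_univ]

end HasSmoothLocalSections

end Contactifications


/-! ### The character exp(−2πit/ρ) -/

section Phase

variable (ρ : ENNReal)

theorem phase_zero : phase ρ 0 = 1 := by simp [phase]

theorem phase_add (s t : ℝ) : phase ρ (s + t) = phase ρ s * phase ρ t := by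
  unfold phase
  rw [← Complex.exp_add]
  congr 1
  push_cast
  ring

theorem phase_mul_conj (t : ℝ) : phase ρ t * (starRingEnd ℂ) (phase ρ t) = 1 := by
  rw [Complex.mul_conj, Complex.normSq_eq_norm_sq, phase, ← Complex.ofReal_neg,
    Complex.norm_exp_ofReal_mul_I]
  simp

theorem phase_of_mem {t : ℝ} (ht : t ∈ periodGroup ρ) : phase ρ t = 1 := by
  obtain ⟨k, rfl⟩ := AddSubgroup.mem_zmultiples_iff.1 ht
  unfold phase
  -- For ρ = ∞ the real value is 0, division by it gives 0, and the phase is constantly 1.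
  rcases eq_or_ne ρ.toReal 0 with h | h
  · simp [h]
  · rw [zsmul_eq_mul, mul_div_assoc, div_self h, mul_one, Complex.exp_eq_one_iff]
    exact ⟨-k, by push_cast; ring⟩

theorem hasDerivAt_phase (t : ℝ) :
    HasDerivAt (phase ρ) (-(2 * Real.pi / ρ.toReal : ℝ) * Complex.I * phase ρ t) t := by
  have h₁ : HasDerivAt (fun t : ℝ ↦ -((2 * Real.pi * (t / ρ.toReal) : ℝ) : ℂ) * Complex.I)
      (-((2 * Real.pi * (1 / ρ.toReal) : ℝ) : ℂ) * Complex.I) t :=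
    ((((hasDerivAt_id t).div_const ρ.toReal).const_mul (2 * Real.pi)).ofReal_comp.neg).mul_const _
  refine h₁.cexp.congr_deriv ?_
  unfold phase
  push_cast
  ring

theorem contDiff_phase : ContDiff ℝ ∞ (phase ρ) := by
  have h₁ : ContDiff ℝ ∞ fun t : ℝ ↦ -((2 * Real.pi * (t / ρ.toReal) : ℝ) : ℂ) :=
    (Complex.ofRealCLM.contDiff.comp
      (contDiff_const.mul (contDiff_id.div_const ρ.toReal))).neg
  exact (h₁.mul contDiff_const).cexp

end Phase

/-! ### The prequantum bundle as a Hermitian line bundle -/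

section Fibers

variable {E : Type*} [NormedAddCommGroup E] [NormedSpace ℝ E]
  {H : Type*} [TopologicalSpace H] {I : ModelWithCorners ℝ E H}
  {M : Type*} [TopologicalSpace M] [ChartedSpace H M]
  {E' : Type*} [NormedAddCommGroup E'] [NormedSpace ℝ E']
  {H' : Type*} [TopologicalSpace H'] {J : ModelWithCorners ℝ E' H'}
  {N : Type*} [TopologicalSpace N] [ChartedSpace H' N]
  {η : OneForm I M} {R : VField I M} {φ : Flow ℝ M} {p : M → N} {Ω : TwoForm J N} {ρ : ENNReal}

theorem ContMDiffAt.complex_mul {f g : M → ℂ} {y : M} (hf : ContMDiffAt I 𝓘(ℝ, ℂ) ∞ f y)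
    (hg : ContMDiffAt I 𝓘(ℝ, ℂ) ∞ g y) : ContMDiffAt I 𝓘(ℝ, ℂ) ∞ (fun y ↦ f y * g y) y :=
  ContMDiffAt.comp y (g := fun q : ℂ × ℂ ↦ q.1 * q.2)
    (contDiff_fst.mul contDiff_snd).contMDiff.contMDiffAt (hf.prodMk_space hg)

omit [TopologicalSpace N] in
theorem sectionFun_eq (ψ : Π x, equivariantFunctions φ p ρ x) {x : N} (y : {y : M // p y = x}) :
    sectionFun ψ y.1 = (ψ x).1 y := by
  obtain ⟨y, rfl⟩ := y
  rfl

variable [IsManifold I ∞ M] [IsManifold J ∞ N]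

namespace IsPrincipalContactification

variable (h : IsPrincipalContactification I J η R φ p Ω ρ)
include h

theorem sectionFun_flow (ψ : Π x, equivariantFunctions φ p ρ x) (t : ℝ) (y : M) :
    sectionFun ψ (φ t y) = phase ρ t * sectionFun ψ y := by
  have h₁ := (ψ (p y)).2 ⟨y, rfl⟩ ⟨φ t y, h.proj_flow y t⟩ t rfl
  exact (sectionFun_eq ψ ⟨φ t y, h.proj_flow y t⟩).trans h₁

theorem exists_time_fiber {x : N} (y y' : {y : M // p y = x}) : ∃ t, φ t y = y' :=
  (h.orbits y y').1 (y.2.trans y'.2.symm)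

/-- Two times that carry y to the same point differ by a period, and the phase is trivial on
periods. -/
theorem phase_eq {y : M} {s t : ℝ} (hst : φ s y = φ t y) : phase ρ s = phase ρ t := by
  have h₁ := phase_of_mem ρ ((h.flow_eq_iff y s t).1 hst)
  rw [← sub_add_cancel s t, phase_add, h₁, one_mul]

omit [IsManifold I ∞ M] [IsManifold J ∞ N] h in
/-- Evaluation of the elements of a fibre of the line bundle. -/
def evalFiber (φ : Flow ℝ M) (p : M → N) (ρ : ENNReal) {x : N} (y : {y : M // p y = x}) :
    equivariantFunctions φ p ρ x →ₗ[ℂ] ℂ where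
  toFun f := f.1 y
  map_add' _ _ := rfl
  map_smul' _ _ := rfl

/-- The flow is transitive on the fibre of p, so one value determines the function. Conversely a
value extends by transport along the flow, and the result does not depend on the chosen time by
`phase_eq`. -/
theorem evalFiber_bijective {x : N} (y : {y : M // p y = x}) :
    Bijective (evalFiber φ p ρ y) := by
  refine ⟨fun f g hfg ↦ Subtype.ext (funext fun y' ↦ ?_), fun c ↦ ?_⟩
  · obtain ⟨t, ht⟩ := h.exists_time_fiber y y'
    rw [f.2 y y' t ht, g.2 y y' t ht]
    exact congrArg _ hfg
  · refine ⟨⟨fun y' ↦ phase ρ (h.exists_time_fiber y y').choose * c, ?_⟩, ?_⟩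
    · intro y₁ y₂ t ht
      have h₁ := (h.exists_time_fiber y y₁).choose_spec
      have h₂ := (h.exists_time_fiber y y₂).choose_spec
      show phase ρ (h.exists_time_fiber y y₂).choose * c
        = phase ρ t * (phase ρ (h.exists_time_fiber y y₁).choose * c)
      rw [← mul_assoc, ← phase_add]
      congr 1
      refine h.phase_eq (y := y.1) ?_
      rw [h₂, φ.map_add, h₁, ht]
    · have h₁ := (h.exists_time_fiber y y).choose_spec
      show phase ρ (h.exists_time_fiber y y).choose * c = c
      rw [phase_of_mem ρ ((h.period _ _).1 h₁), one_mul]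

/-- The identification of a fibre of the line bundle with `ℂ` given by a point of the fibre
of `p`. -/
noncomputable def evalEquiv {x : N} (y : {y : M // p y = x}) :
    equivariantFunctions φ p ρ x ≃ₗ[ℂ] ℂ :=
  LinearEquiv.ofBijective (evalFiber φ p ρ y) (h.evalFiber_bijective y)

theorem evalEquiv_symm_apply {x : N} (y : {y : M // p y = x}) (c : ℂ) :
    ((h.evalEquiv y).symm c).1 y = c :=
  (h.evalEquiv y).apply_symm_apply c

theorem fiber_ext {x : N} (y : {y : M // p y = x}) {f g : equivariantFunctions φ p ρ x}
    (hfg : f.1 y = g.1 y) : f = g :=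
  (h.evalFiber_bijective y).1 hfg

open Classical in
/-- The equivariant functions with value `1` on the image of `σ`. -/
noncomputable def frame (σ : N → M) (x : N) : equivariantFunctions φ p ρ x :=
  if hx : p (σ x) = x then (h.evalEquiv ⟨σ x, hx⟩).symm 1 else 0

theorem frame_apply {σ : N → M} {x : N} (hx : p (σ x) = x) : (h.frame σ x).1 ⟨σ x, hx⟩ = 1 := by
  rw [frame, dif_pos hx]
  exact h.evalEquiv_symm_apply _ 1

/-- The metric is defined at a chosen point of the fibre; phases have modulus one, so every point
gives the same value. -/
theorem herm_eq {x : N} (y : {y : M // p y = x}) (f g : equivariantFunctions φ p ρ x) :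
    (prequantumBundle h).herm x f g = f.1 y * (starRingEnd ℂ) (g.1 y) := by
  set y₀ : {y : M // p y = x} := ⟨surjInv h.surjective x, surjInv_eq h.surjective x⟩
  obtain ⟨t, ht⟩ := h.exists_time_fiber y₀ y
  show f.1 y₀ * (starRingEnd ℂ) (g.1 y₀) = _
  rw [f.2 y₀ y t ht, g.2 y₀ y t ht, map_mul, mul_mul_mul_comm, phase_mul_conj, one_mul]

variable [J.Boundaryless] [FiniteDimensional ℝ E] [FiniteDimensional ℝ E']
  (hd : Module.finrank ℝ E = Module.finrank ℝ E' + 1)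

include hd in
/-- Smoothness of an equivariant function can be checked on a local section. -/
theorem smoothOn_iff_comp_section {U : Set N} (hU : IsOpen U) {σ : N → M}
    (hσ : ContMDiffOn J I ∞ σ U) (hpσ : ∀ x ∈ U, p (σ x) = x)
    (ψ : Π x, equivariantFunctions φ p ρ x) {V : Set N} (hV : IsOpen V) (hVU : V ⊆ U) :
    ContMDiffOn I 𝓘(ℝ, ℂ) ∞ (sectionFun ψ) (p ⁻¹' V)
      ↔ ContMDiffOn J 𝓘(ℝ, ℂ) ∞ (fun x ↦ sectionFun ψ (σ x)) V := by
  refine ⟨fun hs ↦ hs.comp (hσ.mono hVU) fun x hx ↦ ?_, fun hs y₀ hy₀ ↦ ?_⟩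
  · show p (σ x) ∈ V
    rwa [hpσ x (hVU hx)]
  · obtain ⟨t, ht⟩ := (h.orbits (σ (p y₀)) y₀).1 (hpσ _ (hVU hy₀))
    obtain ⟨τ, hτ, -, hτσ⟩ := h.exists_time hd hU hσ hpσ (hVU hy₀) ht
    -- Near y₀ the function is phase(τ y) times its value at σ (p y), with τ the smooth time from
    -- `exists_time`.
    have h₁ : ContMDiffAt I 𝓘(ℝ, ℂ) ∞ (fun y ↦ phase ρ (τ y)) y₀ :=
      (contDiff_phase ρ).contMDiff.contMDiffAt.comp y₀ hτ
    have h₂ : ContMDiffAt I 𝓘(ℝ, ℂ) ∞ (fun y ↦ sectionFun ψ (σ (p y))) y₀ :=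
      (hs.contMDiffAt (hV.mem_nhds hy₀)).comp y₀ h.submersion.smooth.contMDiffAt
    refine ((ContMDiffAt.complex_mul h₁ h₂).congr_of_eventuallyEq ?_).contMDiffWithinAt
    filter_upwards [hτσ] with y hy
    conv_lhs => rw [← hy]
    exact h.sectionFun_flow ψ _ _

include hd in
-- The function with value 1 along a local section σ of p is a local frame, and the coefficient of ψ
-- in it is ψ ∘ σ. Smoothness along σ is equivalent to smoothness upstairs by
-- `smoothOn_iff_comp_section`.
theorem isHermitianLineBundle : (prequantumBundle h).IsHermitianLineBundle where
  smoothOn_congr ψ ψ' U hU hψ hs := by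
    refine ContMDiffOn.congr (f := sectionFun ψ) hs fun y hy ↦ ?_
    exact congrArg (fun f : equivariantFunctions φ p ρ (p y) ↦ f.1 ⟨y, rfl⟩) (hψ (p y) hy).symm
  smoothOn_iff_locally ψ U hU := by
    refine ⟨fun hs x hx ↦ ⟨U, Subset.rfl, hU, hx, hs⟩, fun hs y hy ↦ ?_⟩
    obtain ⟨V, -, hV, hyV, hsV⟩ := hs (p y) hy
    have hsV' : ContMDiffOn I 𝓘(ℝ, ℂ) ∞ (sectionFun ψ) (p ⁻¹' V) := hsV
    exact (hsV'.contMDiffAt ((hV.preimage h.submersion.smooth.continuous).mem_nhds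
      hyV)).contMDiffWithinAt
  localFrame x := by
    obtain ⟨U, σ, hU, hx, hσ, hpσ⟩ := h.localSection x
    refine ⟨U, h.frame σ, hU, hx, fun x' hx' ξ ↦ ?_, fun V hVU hV f ↦ ?_⟩
    · have h₁ := h.frame_apply (hpσ x' hx')
      refine ⟨h.evalEquiv ⟨σ x', hpσ x' hx'⟩ ξ, ?_, fun c hc ↦ ?_⟩
      · refine h.fiber_ext ⟨σ x', hpσ x' hx'⟩ ?_
        exact ((congrArg (_ * ·) h₁).trans (mul_one _)).symm
      · rw [hc]
        exact ((congrArg (c * ·) h₁).trans (mul_one c)).symm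
    · refine (h.smoothOn_iff_comp_section hd hU hσ hpσ _ hV hVU).trans ?_
      refine contMDiffOn_congr fun x' hx' ↦ ?_
      refine (sectionFun_eq _ ⟨σ x', hpσ x' (hVU hx')⟩).trans ?_
      exact (congrArg (f x' * ·) (h.frame_apply (hpσ x' (hVU hx')))).trans (mul_one _)
  herm_add_left x ξ ξ' ζ := add_mul _ _ _
  herm_smul_left x c ξ ζ := mul_assoc _ _ _
  herm_symm x ξ ζ := by
    obtain ⟨y, hy⟩ := h.surjective x
    refine (h.herm_eq ⟨y, hy⟩ ζ ξ).trans
      (Eq.trans ?_ (congrArg (starRingEnd ℂ) (h.herm_eq ⟨y, hy⟩ ξ ζ)).symm)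
    rw [map_mul, Complex.conj_conj, mul_comm]
  herm_pos x ξ hξ := by
    obtain ⟨y, hy⟩ := h.surjective x
    rw [h.herm_eq ⟨y, hy⟩ ξ ξ, Complex.mul_conj, Complex.ofReal_re, Complex.normSq_pos]
    intro h₀
    exact hξ (h.fiber_ext ⟨y, hy⟩ h₀)
  herm_smooth ψ ψ' U hU hs hs' x hx := by
    obtain ⟨V, σ, hV, hxV, hσ, hpσ⟩ := h.localSection x
    have a : ContMDiffOn J 𝓘(ℝ, ℂ) ∞ (fun x ↦ sectionFun ψ (σ x)) (U ∩ V) :=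
      (h.smoothOn_iff_comp_section hd hV hσ hpσ ψ (hU.inter hV) inter_subset_right).1
        (ContMDiffOn.mono hs (preimage_mono inter_subset_left))
    have b : ContMDiffOn J 𝓘(ℝ, ℂ) ∞ (fun x ↦ sectionFun ψ' (σ x)) (U ∩ V) :=
      (h.smoothOn_iff_comp_section hd hV hσ hpσ ψ' (hU.inter hV) inter_subset_right).1
        (ContMDiffOn.mono hs' (preimage_mono inter_subset_left))
    have hUV : U ∩ V ∈ 𝓝 x := (hU.inter hV).mem_nhds ⟨hx, hxV⟩
    have hconj : ContMDiff 𝓘(ℝ, ℂ) 𝓘(ℝ, ℂ) ∞ (starRingEnd ℂ : ℂ → ℂ) :=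
      Complex.conjCLE.contDiff.contMDiff
    refine ((ContMDiffAt.complex_mul (a.contMDiffAt hUV)
      (hconj.contMDiffAt.comp x (b.contMDiffAt hUV))).congr_of_eventuallyEq
        ?_).contMDiffWithinAt
    filter_upwards [hUV] with x' hx'
    refine (h.herm_eq ⟨σ x', hpσ x' hx'.2⟩ (ψ x') (ψ' x')).trans ?_
    exact congrArg₂ (fun a b ↦ a * (starRingEnd ℂ) b)
      (sectionFun_eq ψ ⟨σ x', hpσ x' hx'.2⟩).symm (sectionFun_eq ψ' ⟨σ x', hpσ x' hx'.2⟩).symm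

end IsPrincipalContactification

end Fibers


/-! ### The prequantum connection -/

section Connections

variable {E : Type*} [NormedAddCommGroup E] [NormedSpace ℝ E]
  {H : Type*} [TopologicalSpace H] {I : ModelWithCorners ℝ E H}
  {M : Type*} [TopologicalSpace M] [ChartedSpace H M]
  {E' : Type*} [NormedAddCommGroup E'] [NormedSpace ℝ E']
  {H' : Type*} [TopologicalSpace H'] {J : ModelWithCorners ℝ E' H'}
  {N : Type*} [TopologicalSpace N] [ChartedSpace H' N]
  {η : OneForm I M} {R : VField I M} {φ : Flow ℝ M} {p : M → N} {Ω : TwoForm J N} {ρ : ENNReal}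

theorem vField_congr_point (X : VField J N) {x x' : N} (h : x = x') :
    (show E' from X x) = (show E' from X x') := by
  subst h
  rfl

/-- The coordinates of a smooth vector field in a chart are smooth. -/
theorem SmoothVFieldOn.exists_coordinates [IsManifold J ∞ N] {X : VField J N} {U : Set N}
    (hX : SmoothVFieldOn J X U) (hU : IsOpen U) {x₀ : N} (hx₀ : x₀ ∈ U) [J.Boundaryless] :
    ∃ ξ : N → E', ContMDiffAt J 𝓘(ℝ, E') ∞ ξ x₀ ∧ ∀ᶠ x in 𝓝 x₀,
      (show E' →L[ℝ] E' from mfderiv 𝓘(ℝ, E') J (extChartAt J x₀).symm (extChartAt J x₀ x)) (ξ x)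
        = (show E' from X x) := by
  have h₁ := (hX x₀ hx₀).contMDiffAt (hU.mem_nhds hx₀)
  have h₂ := (contMDiffAt_section x₀).1 h₁
  refine ⟨_, h₂, ?_⟩
  filter_upwards [(isOpen_extChartAt_source (I := J) x₀).mem_nhds (mem_extChartAt_source x₀)]
    with x hx
  have h₃ := symmL_trivializationAt_apply (I := J) hx
    (trivializationAt E' (TangentSpace J) x₀ ⟨x, X x⟩).2
  rw [J.range_eq_univ, mfderivWithin_univ] at h₃
  refine h₃.symm.trans ?_
  have hb : x ∈ (trivializationAt E' (TangentSpace J) x₀).baseSet := by simpa using hx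
  refine Eq.trans ?_ (Trivialization.symmL_continuousLinearMapAt (R := ℝ)
    (trivializationAt E' (TangentSpace J : N → Type _) x₀) hb (X x))
  refine congrArg ((trivializationAt E' (TangentSpace J : N → Type _) x₀).symmL ℝ x) ?_
  exact (Trivialization.continuousLinearMapAt_apply_of_mem ℝ _ hb _).symm

theorem mvfderiv_congr {F G : M → ℂ} {y : M} (h : F =ᶠ[𝓝 y] G) (v : TangentSpace I y) :
    mvfderiv I F y v = mvfderiv I G y v :=
  congrArg (fun A : E →L[ℝ] ℂ ↦ A v) (h.mfderiv_eq (I := I) (I' := 𝓘(ℝ, ℂ)))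

theorem mvfderiv_mul_apply {F G : M → ℂ} {y : M} (hF : MDifferentiableAt I 𝓘(ℝ, ℂ) F y)
    (hG : MDifferentiableAt I 𝓘(ℝ, ℂ) G y) (v : TangentSpace I y) :
    mvfderiv I (fun y ↦ F y * G y) y v = F y * mvfderiv I G y v + mvfderiv I F y v * G y := by
  have h₁ := (hF.hasMFDerivAt.mul hG.hasMFDerivAt).mfderiv
  refine (congrArg (fun A : E →L[ℝ] ℂ ↦ A v) h₁).trans ?_
  exact congrArg (F y * mvfderiv I G y v + ·) (mul_comm _ _)

theorem mvfderiv_complex_comp_apply {f : M → N} {g : N → ℂ} {y : M}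
    (hg : MDifferentiableAt J 𝓘(ℝ, ℂ) g (f y)) (hf : MDifferentiableAt I J f y)
    (v : TangentSpace I y) :
    mvfderiv I (fun y ↦ g (f y)) y v = mvfderiv J g (f y) (mfderiv I J f y v) :=
  congrArg (fun A : E →L[ℝ] ℂ ↦ A v) (hg.hasMFDerivAt.comp y hf.hasMFDerivAt).mfderiv

/-- Differentiating F(φ_t y) = exp(−2πit/ρ) F(y) at t = 0. For ρ = ∞ the factor is 0, in agreement
with invariance of F. -/
theorem IsFlowOf.mvfderiv_of_equivariant (hφ : IsFlowOf I R φ) {F : M → ℂ}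
    (hF : ∀ t y, F (φ t y) = phase ρ t * F y) {y : M} (hd : MDifferentiableAt I 𝓘(ℝ, ℂ) F y) :
    mvfderiv I F y (R y) = -(2 * Real.pi / ρ.toReal : ℝ) * Complex.I * F y := by
  have h₁ := hφ.integralCurve y 0
  have hd' : MDifferentiableAt I 𝓘(ℝ, ℂ) F (φ 0 y) := by rwa [φ.map_zero_apply]
  have h₂ := hd'.hasMFDerivAt.comp 0 h₁
  have h₃ : F ∘ (fun t ↦ φ t y) = fun t ↦ phase ρ t * F y := funext fun t ↦ hF t y
  rw [h₃] at h₂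
  have h₄ := ((hasDerivAt_phase ρ 0).mul_const (F y)).hasFDerivAt.hasMFDerivAt
  have h₅ := congrArg (fun A : ℝ →L[ℝ] ℂ ↦ A 1) (hasMFDerivAt_unique h₂ h₄)
  have h₆ : (show E →L[ℝ] ℂ from mfderiv I 𝓘(ℝ, ℂ) F (φ 0 y))
      ((1 : ℝ) • (show E from R (φ 0 y)))
      = (1 : ℝ) • (-(2 * Real.pi / ρ.toReal : ℝ) * Complex.I * phase ρ 0 * F y) := h₅
  rw [one_smul, one_smul, phase_zero, mul_one] at h₆
  have key : ∀ z, z = y → (show E →L[ℝ] ℂ from mvfderiv I F y) (show E from R y)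
      = (show E →L[ℝ] ℂ from mfderiv I 𝓘(ℝ, ℂ) F z) (show E from R z) := by
    rintro z rfl
    rfl
  exact (key _ (φ.map_zero_apply y)).trans h₆

variable [IsManifold I ∞ M] [IsManifold J ∞ N]

namespace IsPrincipalContactification

variable (h : IsPrincipalContactification I J η R φ p Ω ρ)
include h

variable [FiniteDimensional ℝ E] [FiniteDimensional ℝ E']
  (hd : Module.finrank ℝ E = Module.finrank ℝ E' + 1)
include hd

/-- Removing the Reeb component of any vector above w gives its horizontal lift, because η(R) = 1
and dp(R) = 0. -/
theorem horizontalLift_eq {y : M} {v : E} {w : E'}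
    (hv : (show E →L[ℝ] E' from mfderiv I J p y) v = w) :
    (show E from horizontalLift η p y (show TangentSpace J (p y) from w))
      = v - (show E →L[ℝ] ℝ from η y) v • (show E from R y) := by
  refine (h.eq_horizontalLift hd (v := w) (w := v - (show E →L[ℝ] ℝ from η y) v • (show E from R y))
    ?_ ?_).symm
  · have h₁ : (show E →L[ℝ] ℝ from η y) (show E from R y) = 1 := h.reeb.apply_one y
    refine (map_sub (show E →L[ℝ] ℝ from η y) _ _).trans ?_
    rw [map_smul, h₁]
    exact sub_eq_zero.2 (mul_one _).symm
  · have h₂ : (show E →L[ℝ] E' from mfderiv I J p y) (show E from R y) = 0 := h.mfderiv_proj_reeb y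
    refine (map_sub (show E →L[ℝ] E' from mfderiv I J p y) _ _).trans ?_
    rw [map_smul, h₂, hv, smul_zero, sub_zero]

/-- For v = dσ(X) with a local section σ this is the local formula D_X = X + (2πi/ρ)(σ^*η)(X). The
connection term comes from the derivative of F along the Reeb direction. -/
theorem horizontalDeriv_eq {F : M → ℂ} (hF : ∀ t y, F (φ t y) = phase ρ t * F y) {y : M}
    (hFd : MDifferentiableAt I 𝓘(ℝ, ℂ) F y) (X : VField J N) {v : E}
    (hv : (show E →L[ℝ] E' from mfderiv I J p y) v = (show E' from X (p y))) :
    horizontalDeriv η p X F y = (show E →L[ℝ] ℂ from mvfderiv I F y) v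
      + (show E →L[ℝ] ℝ from η y) v * ((2 * Real.pi / ρ.toReal : ℝ) * Complex.I * F y) := by
  have h₁ := h.flow.mvfderiv_of_equivariant hF hFd
  have h₂ : (show E →L[ℝ] ℂ from mvfderiv I F y) (show E from R y) = _ := h₁
  refine (congrArg (show E →L[ℝ] ℂ from mvfderiv I F y) (h.horizontalLift_eq hd hv)).trans ?_
  refine (map_sub (show E →L[ℝ] ℂ from mvfderiv I F y) _ _).trans ?_
  rw [sub_eq_add_neg]
  refine congrArg ((show E →L[ℝ] ℂ from mvfderiv I F y) v + ·) ?_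
  rw [map_smul, h₂, Complex.real_smul]
  ring

/-- The flow preserves both η and p, and these characterize horizontal lifts. -/
theorem mfderiv_flow_horizontalLift [I.Boundaryless] (t : ℝ) (y : M) (w : E') :
    (show E from mfderiv I I (φ t) y (horizontalLift η p y (show TangentSpace J (p y) from w)))
      = horizontalLift η p (φ t y) (show TangentSpace J (p (φ t y)) from w) := by
  have hs := h.horizontalLift_spec hd y (show TangentSpace J (p y) from w)
  refine h.eq_horizontalLift hd ?_ ?_
  · exact (congrArg (fun α : OneForm I M ↦ α y (horizontalLift η p y w))
      (h.flow.pullback₁_eq h.contact.smooth h.reeb t)).trans hs.1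
  · have h₁ := ((h.submersion.smooth.mdifferentiable (by simp) (φ t y)).hasMFDerivAt.comp y
      ((h.flow.contMDiff t).mdifferentiable (by simp) y).hasMFDerivAt).mfderiv
    have h₂ : p ∘ φ t = p := funext fun y ↦ h.proj_flow y t
    rw [h₂] at h₁
    exact (congrArg (fun A : E →L[ℝ] E' ↦ A (horizontalLift η p y w)) h₁).symm.trans hs.2

variable [I.Boundaryless]

/-- Horizontal lifts are carried along by the flow, so differentiating the equivariance of F shows
that the derivative has the same equivariance. This is what makes D a section of the bundle. -/
theorem horizontalDeriv_flow {F : M → ℂ} (hF : ∀ t y, F (φ t y) = phase ρ t * F y)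
    (X : VField J N) {y : M} {t : ℝ} (hFd : MDifferentiableAt I 𝓘(ℝ, ℂ) F y)
    (hFd' : MDifferentiableAt I 𝓘(ℝ, ℂ) F (φ t y)) :
    horizontalDeriv η p X F (φ t y) = phase ρ t * horizontalDeriv η p X F y := by
  have h₁ : mvfderiv I (fun y ↦ F (φ t y)) y (horizontalLift η p y (X (p y)))
      = (show E →L[ℝ] ℂ from mvfderiv I F (φ t y))
        (show E from mfderiv I I (φ t) y (horizontalLift η p y (X (p y)))) :=
    mvfderiv_complex_comp_apply hFd' ((h.flow.contMDiff t).mdifferentiable (by simp) y) _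
  have h₂ : (fun y ↦ F (φ t y)) = fun y ↦ (fun _ ↦ phase ρ t) y * F y := funext fun y ↦ hF t y
  rw [h₂] at h₁
  have h₃ := mvfderiv_mul_apply (mdifferentiableAt_const (c := phase ρ t)) hFd
    (horizontalLift η p y (X (p y)))
  have h₄ : mvfderiv I (fun _ : M ↦ phase ρ t) y (horizontalLift η p y (X (p y))) = 0 :=
    congrArg (fun A : E →L[ℝ] ℂ ↦ A (horizontalLift η p y (X (p y)))) (mvfderiv_const _)
  rw [h₄, zero_mul, add_zero] at h₃
  refine Eq.trans ?_ (h₁.symm.trans h₃)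
  refine congrArg (show E →L[ℝ] ℂ from mvfderiv I F (φ t y)) ?_
  refine Eq.trans ?_ (h.mfderiv_flow_horizontalLift hd t y (X (p y))).symm
  exact congrArg (fun w : E' ↦ (show E from horizontalLift η p (φ t y)
    (show TangentSpace J (p (φ t y)) from w))) (vField_congr_point X (h.proj_flow y t))

/-- Where the section is differentiable along the whole fibre, its horizontal derivative is
equivariant, so the default value in the definition of D is not taken. -/
theorem D_apply (X : VField J N) (ψ : Π x, equivariantFunctions φ p ρ x) {x : N}
    (hψ : ∀ y, p y = x → MDifferentiableAt I 𝓘(ℝ, ℂ) (sectionFun ψ) y) (y : {y : M // p y = x}) :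
    (show equivariantFunctions φ p ρ x from (prequantumBundle h).D X ψ x).1 y
      = horizontalDeriv η p X (sectionFun ψ) y.1 := by
  have hD : (fun y : {y : M // p y = x} ↦ horizontalDeriv η p X (sectionFun ψ) y.1)
      ∈ equivariantFunctions φ p ρ x := by
    rintro ⟨y, hy⟩ ⟨y', hy'⟩ t (rfl : φ t y = y')
    exact h.horizontalDeriv_flow hd (h.sectionFun_flow ψ) X (hψ _ hy) (hψ _ hy')
  exact congrFun (congrArg Subtype.val (dif_pos hD)) y

omit [FiniteDimensional ℝ E] [FiniteDimensional ℝ E'] [I.Boundaryless] hd in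
theorem mdifferentiableAt_sectionFun {ψ : Π x, equivariantFunctions φ p ρ x} {U : Set N}
    (hU : IsOpen U) (hψ : (prequantumBundle h).SmoothOn ψ U) {x : N} (hx : x ∈ U) :
    ∀ y, p y = x → MDifferentiableAt I 𝓘(ℝ, ℂ) (sectionFun ψ) y := by
  rintro y rfl
  have h₁ : ContMDiffOn I 𝓘(ℝ, ℂ) ∞ (sectionFun ψ) (p ⁻¹' U) := hψ
  exact (h₁.contMDiffAt ((hU.preimage h.submersion.smooth.continuous).mem_nhds hx)).mdifferentiableAt
    (by simp)

/-- The connection in terms of a local section. -/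
theorem smooth_horizontalDeriv [J.Boundaryless] {X : VField J N} {U : Set N} (hU : IsOpen U)
    (hX : SmoothVFieldOn J X U)
    {F : M → ℂ} (hF : ∀ t y, F (φ t y) = phase ρ t * F y)
    (hFs : ContMDiffOn I 𝓘(ℝ, ℂ) ∞ F (p ⁻¹' U)) {σ : N → M}
    (hσ : ContMDiffOn J I ∞ σ U) (hpσ : ∀ x ∈ U, p (σ x) = x) :
    ContMDiffOn J 𝓘(ℝ, ℂ) ∞ (fun x ↦ horizontalDeriv η p X F (σ x)) U := by
  intro x₀ hx₀
  obtain ⟨ξ, hξ, hξX⟩ := hX.exists_coordinates hU hx₀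
  set e₀ : E' := extChartAt J x₀ x₀
  set c : E' → N := fun e ↦ (extChartAt J x₀).symm e with hc_def
  have hc₀ : c e₀ = x₀ := extChartAt_to_inv x₀
  have hc : ContMDiffAt 𝓘(ℝ, E') J ∞ c e₀ := contMDiffAt_extChartAt_symm (I := J) x₀
  have hs : ContMDiffAt 𝓘(ℝ, E') I ∞ (fun e ↦ σ (c e)) e₀ := by
    refine ContMDiffAt.comp e₀ (g := σ) ?_ hc
    rw [hc₀]
    exact hσ.contMDiffAt (hU.mem_nhds hx₀)
  have hFσ : ContDiffAt ℝ ∞ (fun e ↦ F (σ (c e))) e₀ := by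
    refine contMDiffAt_iff_contDiffAt.1 (ContMDiffAt.comp e₀ (g := F) ?_ hs)
    refine hFs.contMDiffAt ((hU.preimage h.submersion.smooth.continuous).mem_nhds ?_)
    show p (σ (c e₀)) ∈ U
    rw [hc₀, hpσ _ hx₀]
    exact hx₀
  have hξc : ContDiffAt ℝ ∞ (fun e ↦ ξ (c e)) e₀ := by
    refine contMDiffAt_iff_contDiffAt.1 (ContMDiffAt.comp e₀ (g := ξ) ?_ hc)
    rwa [hc₀]
  have hη := contDiffAt_flatPullback h.contact.smooth hs
  -- The local formula for D in a chart of N: the derivative of F ∘ σ along the coordinates ξ of X,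
  -- plus the connection term. All of its ingredients are smooth.
  have hg : ContDiffAt ℝ ∞ (fun e ↦ fderiv ℝ (fun e ↦ F (σ (c e))) e (ξ (c e))
      + (flatPullback (fun e ↦ σ (c e)) η e (ξ (c e)) : ℝ) *
        ((2 * Real.pi / ρ.toReal : ℝ) * Complex.I * F (σ (c e)))) e₀ := by
    refine ((hFσ.fderiv_right (m := ∞) (by simp)).clm_apply hξc).add (ContDiffAt.mul ?_ ?_)
    · exact Complex.ofRealCLM.contDiff.contDiffAt.comp e₀ (hη.clm_apply hξc)
    · exact contDiffAt_const.mul hFσ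
  refine ((contMDiffAt_comp_extChartAt_iff.2 hg).congr_of_eventuallyEq ?_).contMDiffWithinAt
  have hsd := ContMDiffAt.eventually_mdifferentiableAt hs
  have hcd := ContMDiffAt.eventually_mdifferentiableAt hc
  have hchart : Filter.Tendsto (extChartAt J x₀) (𝓝 x₀) (𝓝 e₀) := continuousAt_extChartAt x₀
  filter_upwards [hξX, hU.mem_nhds hx₀, hchart.eventually hsd, hchart.eventually hcd,
    (isOpen_extChartAt_source (I := J) x₀).mem_nhds (mem_extChartAt_source x₀),
    hchart.eventually (hc.continuousAt.eventually (by rw [hc₀]; exact hU.mem_nhds hx₀))]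
    with x hxξ hxU hxs hxc hxc₀ hxcU
  have hcx : c (extChartAt J x₀ x) = x := (extChartAt J x₀).left_inv hxc₀
  set e := extChartAt J x₀ x
  have hFd : MDifferentiableAt I 𝓘(ℝ, ℂ) F (σ (c e)) := by
    refine (hFs.contMDiffAt ((hU.preimage h.submersion.smooth.continuous).mem_nhds
      ?_)).mdifferentiableAt (by simp)
    show p (σ (c e)) ∈ U
    rwa [hpσ _ hxcU]
  have h₁ := (h.submersion.smooth.mdifferentiable (by simp) (σ (c e))).hasMFDerivAt.comp e
    hxs.hasMFDerivAt
  have h₂ : p ∘ (fun e ↦ σ (c e)) =ᶠ[𝓝 e] c := by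
    have hV := hxc.continuousAt.preimage_mem_nhds (hU.mem_nhds hxcU)
    filter_upwards [hV] with e' he' using hpσ _ he'
  have h₃ := hasMFDerivAt_unique (h₁.congr_of_eventuallyEq h₂.symm) hxc.hasMFDerivAt
  -- The vector dσ(X), computed through the chart, lies above X because p ∘ σ is the identity on U.
  have h₄ : (show E →L[ℝ] E' from mfderiv I J p (σ (c e)))
      ((show E' →L[ℝ] E from mfderiv 𝓘(ℝ, E') I (fun e ↦ σ (c e)) e) (ξ (c e)))
      = (show E' from X (p (σ (c e)))) := by
    refine (congrArg (fun A : E' →L[ℝ] E' ↦ A (ξ (c e))) h₃).trans ?_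
    refine Eq.trans ?_ (vField_congr_point X ((congrArg _ (congrArg _ hcx)).trans (hpσ x hxU))).symm
    refine Eq.trans ?_ hxξ
    exact congrArg (fun x ↦ (show E' →L[ℝ] E' from mfderiv 𝓘(ℝ, E') J c e) (ξ x)) hcx
  have h₅ := h.horizontalDeriv_eq hd hF hFd X h₄
  have h₆ : fderiv ℝ (fun e ↦ F (σ (c e))) e (ξ (c e)) = (show E →L[ℝ] ℂ from mvfderiv I F (σ (c e)))
      ((show E' →L[ℝ] E from mfderiv 𝓘(ℝ, E') I (fun e ↦ σ (c e)) e) (ξ (c e))) := by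
    have h₇ := (hFd.hasMFDerivAt.comp e hxs.hasMFDerivAt).mfderiv
    rw [mfderiv_eq_fderiv] at h₇
    exact congrArg (fun A : E' →L[ℝ] ℂ ↦ A (ξ (c e))) h₇
  have h₈ : horizontalDeriv η p X F (σ x) = horizontalDeriv η p X F (σ (c e)) := by rw [hcx]
  refine h₈.trans (h₅.trans ?_)
  rw [h₆]
  rfl

theorem isLinearConnection [J.Boundaryless] : (prequantumBundle h).IsLinearConnection where
  local_ X X' ψ ψ' U hU hX hψ x hx := by
    classical
    -- No smoothness is available here. The two fibre functions agree, so they fall into the same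
    -- branch of the definition of D, the default one included.
    have h₁ : (fun y : {y : M // p y = x} ↦ horizontalDeriv η p X (sectionFun ψ) y.1)
        = fun y : {y : M // p y = x} ↦ horizontalDeriv η p X' (sectionFun ψ') y.1 := by
      funext ⟨y, hy⟩
      subst hy
      have h₂ : sectionFun ψ =ᶠ[𝓝 y] sectionFun ψ' := by
        filter_upwards [(hU.preimage h.submersion.smooth.continuous).mem_nhds hx] with z hz
        exact congrArg (fun f : equivariantFunctions φ p ρ (p z) ↦ f.1 ⟨z, rfl⟩) (hψ (p z) hz)
      refine (mvfderiv_congr h₂ _).trans ?_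
      exact congrArg (fun w ↦ mvfderiv I (sectionFun ψ') y (horizontalLift η p y w)) (hX _ hx)
    exact congrArg (fun f : {y : M // p y = x} → ℂ ↦
      if hD : f ∈ equivariantFunctions φ p ρ x then (⟨f, hD⟩ : equivariantFunctions φ p ρ x)
        else 0) h₁
  add_section X ψ ψ' U hU hs hs' x hx := by
    obtain ⟨y, rfl⟩ := h.surjective x
    have d := h.mdifferentiableAt_sectionFun hU hs hx
    have d' := h.mdifferentiableAt_sectionFun hU hs' hx
    refine h.fiber_ext ⟨y, rfl⟩ ?_
    refine (h.D_apply hd X (ψ + ψ') (fun z hz ↦ (d z hz).add (d' z hz)) ⟨y, rfl⟩).trans ?_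
    refine Eq.trans ?_ (congrArg₂ (· + ·) (h.D_apply hd X ψ d ⟨y, rfl⟩)
      (h.D_apply hd X ψ' d' ⟨y, rfl⟩)).symm
    exact congrArg (fun A : E →L[ℝ] ℂ ↦ A (horizontalLift η p y (X (p y))))
      (mvfderiv_add (d y rfl) (d' y rfl))
  leibniz X f ψ U hU hf hs x hx := by
    obtain ⟨y, rfl⟩ := h.surjective x
    have d := h.mdifferentiableAt_sectionFun hU hs hx
    have hf' : MDifferentiableAt J 𝓘(ℝ, ℂ) f (p y) :=
      (hf.contMDiffAt (hU.mem_nhds hx)).mdifferentiableAt (by simp)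
    have hp : ∀ z, MDifferentiableAt I J p z := h.submersion.smooth.mdifferentiable (by simp)
    have df : ∀ z, p z = p y → MDifferentiableAt I 𝓘(ℝ, ℂ) (f ∘ p) z := fun z hz ↦
      MDifferentiableAt.comp z (by rwa [hz]) (hp z)
    refine h.fiber_ext ⟨y, rfl⟩ ?_
    refine (h.D_apply hd X (fun x ↦ f x • ψ x) (fun z hz ↦
      ((df z hz).hasMFDerivAt.mul (d z hz).hasMFDerivAt).mdifferentiableAt) ⟨y, rfl⟩).trans ?_
    refine (mvfderiv_mul_apply (df y rfl) (d y rfl) _).trans ?_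
    refine congrArg₂ (· + ·) ?_ ?_
    · exact congrArg (f (p y) * ·) (h.D_apply hd X ψ d ⟨y, rfl⟩).symm
    · refine congrArg (· * sectionFun ψ y) ?_
      refine (mvfderiv_complex_comp_apply hf' (hp y) _).trans ?_
      exact congrArg (mvfderiv J f (p y)) (h.horizontalLift_spec hd y _).2
  add_vField X X' ψ U hU hs x hx := by
    obtain ⟨y, rfl⟩ := h.surjective x
    have d := h.mdifferentiableAt_sectionFun hU hs hx
    refine h.fiber_ext ⟨y, rfl⟩ ?_
    refine (h.D_apply hd (X + X') ψ d ⟨y, rfl⟩).trans ?_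
    refine Eq.trans ?_ (congrArg₂ (· + ·) (h.D_apply hd X ψ d ⟨y, rfl⟩)
      (h.D_apply hd X' ψ d ⟨y, rfl⟩)).symm
    refine Eq.trans ?_ (map_add (show E →L[ℝ] ℂ from mvfderiv I (sectionFun ψ) y) _ _)
    refine congrArg (show E →L[ℝ] ℂ from mvfderiv I (sectionFun ψ) y) ?_
    refine Eq.trans ?_ (map_add
      ((show E →L[ℝ] ℝ × E' from (η y).prod (mfderiv I J p y)).inverse) _ _)
    -- The lift is a linear map applied to (0, X), hence additive in X.
    refine congrArg ((show E →L[ℝ] ℝ × E' from (η y).prod (mfderiv I J p y)).inverse) ?_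
    exact Prod.ext (add_zero _).symm rfl
  smul_vField g X ψ U hU hs x hx := by
    obtain ⟨y, rfl⟩ := h.surjective x
    have d := h.mdifferentiableAt_sectionFun hU hs hx
    refine h.fiber_ext ⟨y, rfl⟩ ?_
    refine (h.D_apply hd (fun x ↦ g x • X x) ψ d ⟨y, rfl⟩).trans ?_
    refine Eq.trans ?_ (congrArg ((g (p y) : ℂ) * ·) (h.D_apply hd X ψ d ⟨y, rfl⟩)).symm
    refine Eq.trans ?_ (Complex.real_smul)
    refine Eq.trans ?_ (map_smul (show E →L[ℝ] ℂ from mvfderiv I (sectionFun ψ) y) _ _)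
    refine congrArg (show E →L[ℝ] ℂ from mvfderiv I (sectionFun ψ) y) ?_
    refine Eq.trans ?_ (map_smul
      ((show E →L[ℝ] ℝ × E' from (η y).prod (mfderiv I J p y)).inverse) _ _)
    refine congrArg ((show E →L[ℝ] ℝ × E' from (η y).prod (mfderiv I J p y)).inverse) ?_
    exact Prod.ext (smul_zero _).symm rfl
  smooth X ψ U hU hX hs := by
    refine ((h.isHermitianLineBundle hd).smoothOn_iff_locally _ U hU).2 fun x hx ↦ ?_
    obtain ⟨V, σ, hV, hxV, hσ, hpσ⟩ := h.localSection x
    refine ⟨U ∩ V, inter_subset_left, hU.inter hV, ⟨hx, hxV⟩, ?_⟩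
    refine (h.smoothOn_iff_comp_section hd hV hσ hpσ _ (hU.inter hV) inter_subset_right).2 ?_
    refine (h.smooth_horizontalDeriv hd (hU.inter hV) (ContMDiffOn.mono hX inter_subset_left)
      (h.sectionFun_flow ψ) (ContMDiffOn.mono hs (preimage_mono inter_subset_left))
      (hσ.mono inter_subset_right) (fun x hx ↦ hpσ x hx.2)).congr fun x hx ↦ ?_
    exact h.D_apply hd X ψ (h.mdifferentiableAt_sectionFun hU hs (by rw [hpσ x hx.2]; exact hx.1))
      ⟨σ x, rfl⟩

end IsPrincipalContactification

end Connections


/-! ### Manifold structures on quotients -/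

section SmoothQuotients

variable {E : Type*} [NormedAddCommGroup E] [NormedSpace ℝ E]
  {H : Type*} [TopologicalSpace H] {I : ModelWithCorners ℝ E H}
  {P : Type*} [TopologicalSpace P] [ChartedSpace H P]
  {Q : Type*} [TopologicalSpace Q]
  {F : Type*} [NormedAddCommGroup F] [NormedSpace ℝ F]

/-- A quotient of a manifold is a manifold if it has charts that are smooth on the total space and
whose inverses lift to smooth maps into the total space. -/
theorem exists_isManifold_quotient {f : P → Q} (hf : Continuous f)
    (h : ∀ q, ∃ (c : OpenPartialHomeomorph Q F) (s : F → P), q ∈ c.source ∧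
      ContMDiffOn 𝓘(ℝ, F) I ∞ s c.target ∧ (∀ z ∈ c.target, c.symm z = f (s z)) ∧
      ∀ y, f y ∈ c.source → ContMDiffAt I 𝓘(ℝ, F) ∞ (fun y ↦ c (f y)) y) :
    ∃ (_ : ChartedSpace F Q) (_ : IsManifold 𝓘(ℝ, F) ∞ Q), ContMDiff I 𝓘(ℝ, F) ∞ f ∧
      ∀ q, ∃ (U : Set Q) (s : Q → P), IsOpen U ∧ q ∈ U ∧ ContMDiffOn 𝓘(ℝ, F) I ∞ s U ∧
        ∀ x ∈ U, f (s x) = x := by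
  choose c s hc hs hcs hcf using h
  let _ : ChartedSpace F Q :=
    { atlas := range c
      chartAt := c
      mem_chart_source := hc
      chart_mem_atlas := fun q ↦ mem_range_self q }
  have hm : IsManifold 𝓘(ℝ, F) ∞ Q := by
    refine isManifold_of_contDiffOn _ _ _ ?_
    rintro _ _ ⟨q, rfl⟩ ⟨q', rfl⟩
    intro z hz
    have hz₁ : z ∈ (c q).target := hz.1.1
    have hz₂ : (c q).symm z ∈ (c q').source := hz.1.2
    rw [hcs q z hz₁] at hz₂
    -- A transition map factors through the total space: lift by `s q`, then apply the next chart
    -- composed with f.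
    have h₁ : ContMDiffAt 𝓘(ℝ, F) 𝓘(ℝ, F) ∞ (fun z ↦ c q' (f (s q z))) z :=
      ContMDiffAt.comp (g := fun y ↦ c q' (f y)) z (hcf q' _ hz₂)
        ((hs q).contMDiffAt ((c q).open_target.mem_nhds hz₁))
    refine ((contMDiffAt_iff_contDiffAt.1 h₁).congr_of_eventuallyEq ?_).contDiffWithinAt
    filter_upwards [(c q).open_target.mem_nhds hz₁] with z' hz'
    exact congrArg (c q') (hcs q z' hz')
  refine ⟨inferInstance, hm, fun y ↦ ?_, fun q ↦ ?_⟩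
  · have h₁ : ContMDiffAt 𝓘(ℝ, F) 𝓘(ℝ, F) ∞ (c (f y)).symm (c (f y) (f y)) :=
      (contMDiffOn_chart_symm (I := 𝓘(ℝ, F)) (x := f y)).contMDiffAt
        ((c (f y)).open_target.mem_nhds ((c (f y)).map_source (hc (f y))))
    refine (ContMDiffAt.comp (g := (c (f y)).symm) y h₁ (hcf (f y) y (hc _))).congr_of_eventuallyEq ?_
    filter_upwards [hf.continuousAt.eventually ((c (f y)).open_source.mem_nhds (hc (f y)))] with y' hy'
    exact ((c (f y)).left_inv hy').symm
  · refine ⟨(c q).source, fun x ↦ s q (c q x), (c q).open_source, hc q, ?_, fun x hx ↦ ?_⟩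
    · exact (hs q).comp (contMDiffOn_chart (I := 𝓘(ℝ, F)) (x := q))
        fun x hx ↦ (c q).map_source hx
    · rw [← hcs q _ ((c q).map_source hx)]
      exact (c q).left_inv hx

end SmoothQuotients

/-! ### Charts and separation for the reduced product -/

section ReducedProducts

/-- The saturation of an open set is the union of its translates under the flow. -/
theorem isOpenQuotientMap_orbit {M : Type*} [TopologicalSpace M] (φ : Flow ℝ M) :
    IsOpenQuotientMap (Quotient.mk (orbitSetoid φ)) := by
  refine ⟨Quotient.mk_surjective, continuous_quotient_mk', fun U hU ↦ ?_⟩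
  have h₁ : Quotient.mk (orbitSetoid φ) ⁻¹' (Quotient.mk (orbitSetoid φ) '' U) = ⋃ t, φ t ⁻¹' U := by
    ext y
    simp only [mem_preimage, mem_image, mem_iUnion]
    constructor
    · rintro ⟨y', hy', hq⟩
      obtain ⟨t, ht⟩ := Quotient.exact hq.symm
      exact ⟨t, ht ▸ hy'⟩
    · rintro ⟨t, ht⟩
      exact ⟨_, ht, (Quotient.sound ⟨t, rfl⟩ : Quotient.mk (orbitSetoid φ) y = _).symm⟩
  show IsOpen (Quotient.mk (orbitSetoid φ) ⁻¹' (Quotient.mk (orbitSetoid φ) '' U))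
  rw [h₁]
  exact isOpen_iUnion fun t ↦ hU.preimage (φ.continuous continuous_const continuous_id)

namespace ReducedProduct

section

variable {M₁ M₂ : Type*} [TopologicalSpace M₁] [TopologicalSpace M₂] (φ₁ : Flow ℝ M₁)
  (φ₂ : Flow ℝ M₂)

theorem isOpenQuotientMap_mk : IsOpenQuotientMap (mk φ₁ φ₂) :=
  isOpenQuotientMap_orbit _

theorem mk_eq_iff {y y' : M₁ × M₂} :
    mk φ₁ φ₂ y = mk φ₁ φ₂ y' ↔ ∃ t, (φ₁ t y.1, φ₂ (-t) y.2) = y' :=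
  Quotient.eq (r := orbitSetoid (differenceFlow φ₁ φ₂))

/-- In the quotient the two Reeb flows become one and the same action. -/
theorem mk_flow (t : ℝ) (y : M₁ × M₂) : mk φ₁ φ₂ (φ₁ t y.1, y.2) = mk φ₁ φ₂ (y.1, φ₂ t y.2) := by
  rw [mk_eq_iff]
  refine ⟨-t, ?_⟩
  rw [neg_neg, ← φ₁.map_add, neg_add_cancel, φ₁.map_zero_apply]

end

variable {E₁ : Type*} [NormedAddCommGroup E₁] [NormedSpace ℝ E₁]
  {H₁ : Type*} [TopologicalSpace H₁] {I₁ : ModelWithCorners ℝ E₁ H₁}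
  {M₁ : Type*} [TopologicalSpace M₁] [ChartedSpace H₁ M₁]
  {E₁' : Type*} [NormedAddCommGroup E₁'] [NormedSpace ℝ E₁']
  {H₁' : Type*} [TopologicalSpace H₁'] {J₁ : ModelWithCorners ℝ E₁' H₁'}
  {N₁ : Type*} [TopologicalSpace N₁] [ChartedSpace H₁' N₁]
  {E₂ : Type*} [NormedAddCommGroup E₂] [NormedSpace ℝ E₂]
  {H₂ : Type*} [TopologicalSpace H₂] {I₂ : ModelWithCorners ℝ E₂ H₂}
  {M₂ : Type*} [TopologicalSpace M₂] [ChartedSpace H₂ M₂]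
  {E₂' : Type*} [NormedAddCommGroup E₂'] [NormedSpace ℝ E₂']
  {H₂' : Type*} [TopologicalSpace H₂'] {J₂ : ModelWithCorners ℝ E₂' H₂'}
  {N₂ : Type*} [TopologicalSpace N₂] [ChartedSpace H₂' N₂]
  {η₁ : OneForm I₁ M₁} {R₁ : VField I₁ M₁} {φ₁ : Flow ℝ M₁} {p₁ : M₁ → N₁} {Ω₁ : TwoForm J₁ N₁}
  {η₂ : OneForm I₂ M₂} {R₂ : VField I₂ M₂} {φ₂ : Flow ℝ M₂} {p₂ : M₂ → N₂} {Ω₂ : TwoForm J₂ N₂}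
  {ρ : ENNReal}
  [IsManifold I₁ ∞ M₁] [IsManifold J₁ ∞ N₁] [IsManifold I₂ ∞ M₂] [IsManifold J₂ ∞ N₂]
  (h₁ : IsPrincipalContactification I₁ J₁ η₁ R₁ φ₁ p₁ Ω₁ ρ)
  (h₂ : IsPrincipalContactification I₂ J₂ η₂ R₂ φ₂ p₂ Ω₂ ρ)
include h₁ h₂

/-- The class of y contains (φ₁ t y₁, σ (p₂ y₂)). Its first entry depends only on the class: the
time t is unique up to periods of the second flow, and the first flow has the same periods. The
values of g away from U are irrelevant. -/
theorem exists_lift (U : Set N₂) (σ : N₂ → M₂) :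
    ∃ g : ReducedProduct φ₁ φ₂ → M₁ × N₂, ∀ (y : M₁ × M₂) (t : ℝ), p₂ y.2 ∈ U →
      φ₂ t (σ (p₂ y.2)) = y.2 → g (mk φ₁ φ₂ y) = (φ₁ t y.1, p₂ y.2) := by
  have h₃ : ∀ q : ReducedProduct φ₁ φ₂, ∃ z : M₁ × N₂, ∀ (y : M₁ × M₂) (t : ℝ), p₂ y.2 ∈ U →
      φ₂ t (σ (p₂ y.2)) = y.2 → mk φ₁ φ₂ y = q → z = (φ₁ t y.1, p₂ y.2) := by
    intro q
    by_cases hq : ∃ (y : M₁ × M₂) (t : ℝ), p₂ y.2 ∈ U ∧ φ₂ t (σ (p₂ y.2)) = y.2 ∧ mk φ₁ φ₂ y = q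
    · obtain ⟨y, t, hy, ht, rfl⟩ := hq
      refine ⟨(φ₁ t y.1, p₂ y.2), fun y' t' _ ht' hq' ↦ ?_⟩
      obtain ⟨s, rfl⟩ := (mk_eq_iff φ₁ φ₂).1 hq'.symm
      rw [h₂.proj_flow] at ht' ⊢
      -- Both times carry the section to `y.2`. Hence t − (s + t') is a period of the second flow,
      -- and therefore of the first.
      have h₄ : φ₂ t (σ (p₂ y.2)) = φ₂ (s + t') (σ (p₂ y.2)) := by
        rw [φ₂.map_add, ht', ht, ← φ₂.map_add, add_neg_cancel, φ₂.map_zero_apply]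
      have h₅ := (h₁.flow_eq_iff y.1 _ _).2 ((h₂.flow_eq_iff _ _ _).1 h₄)
      rw [h₅, add_comm, φ₁.map_add]
    · obtain ⟨y, rfl⟩ := (isOpenQuotientMap_mk φ₁ φ₂).surjective q
      exact ⟨(y.1, p₂ y.2), fun y' t' hy' ht' hq' ↦ (hq ⟨y', t', hy', ht', hq'⟩).elim⟩
  choose g hg using h₃
  exact ⟨g, fun y t hy ht ↦ hg _ y t hy ht rfl⟩

variable [J₂.Boundaryless] [FiniteDimensional ℝ E₂] [FiniteDimensional ℝ E₂']
  (hd₂ : Module.finrank ℝ E₂ = Module.finrank ℝ E₂' + 1)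
include hd₂

/-- A local section of `p₂` identifies an open subset of the quotient with an open subset of
`M₁ × N₂`. -/
theorem exists_chart_prod (y₀ : M₁ × M₂) :
    ∃ (e : OpenPartialHomeomorph (ReducedProduct φ₁ φ₂) (M₁ × N₂)) (U : Set N₂)
      (s : M₁ × N₂ → M₁ × M₂), p₂ y₀.2 ∈ U ∧ (∀ y, mk φ₁ φ₂ y ∈ e.source ↔ p₂ y.2 ∈ U) ∧
      ContMDiffOn (I₁.prod J₂) (I₁.prod I₂) ∞ s e.target ∧
      (∀ z ∈ e.target, e.symm z = mk φ₁ φ₂ (s z)) ∧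
      ∀ y, mk φ₁ φ₂ y ∈ e.source →
        ContMDiffAt (I₁.prod I₂) (I₁.prod J₂) ∞ (fun y ↦ e (mk φ₁ φ₂ y)) y := by
  obtain ⟨U, σ, hU, hy₀, hσ, hpσ⟩ := h₂.localSection (p₂ y₀.2)
  obtain ⟨g, hg⟩ := exists_lift h₁ h₂ U σ
  have hs : ContMDiffOn (I₁.prod J₂) (I₁.prod I₂) ∞ (fun z : M₁ × N₂ ↦ (z.1, σ z.2))
      (univ ×ˢ U) :=
    contMDiffOn_fst.prodMk (hσ.comp contMDiffOn_snd fun z hz ↦ hz.2)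
  -- Single-valuedness of g permits any admissible time, in particular the smooth one near y.
  have hsm : ∀ y : M₁ × M₂, p₂ y.2 ∈ U →
      ContMDiffAt (I₁.prod I₂) (I₁.prod J₂) ∞ (fun y ↦ g (mk φ₁ φ₂ y)) y := by
    intro y hy
    obtain ⟨t, ht⟩ := (h₂.orbits (σ (p₂ y.2)) y.2).1 (hpσ _ hy)
    obtain ⟨τ, hτ, -, hτσ⟩ := h₂.exists_time hd₂ hU hσ hpσ hy ht
    have a₁ : ContMDiffAt (I₁.prod I₂) I₁ ∞ (fun y : M₁ × M₂ ↦ φ₁ (τ y.2) y.1) y :=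
      h₁.flow.smooth.contMDiffAt.comp y
        ((ContMDiffAt.comp y hτ contMDiffAt_snd).prodMk contMDiffAt_fst)
    have a₂ : ContMDiffAt (I₁.prod I₂) J₂ ∞ (fun y : M₁ × M₂ ↦ p₂ y.2) y :=
      (h₂.submersion.smooth.comp contMDiff_snd).contMDiffAt
    refine (a₁.prodMk a₂).congr_of_eventuallyEq ?_
    filter_upwards [continuousAt_snd.eventually hτσ, a₂.continuousAt.eventually (hU.mem_nhds hy)]
      with y' hy' hyU
    exact hg y' _ hyU hy'
  have hex : ∀ y : M₁ × M₂, p₂ y.2 ∈ U → ∃ t, φ₂ t (σ (p₂ y.2)) = y.2 := fun y hy ↦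
    (h₂.orbits (σ (p₂ y.2)) y.2).1 (hpσ _ hy)
  have hsrc : ∀ y, mk φ₁ φ₂ y ∈ mk φ₁ φ₂ '' {y | p₂ y.2 ∈ U} ↔ p₂ y.2 ∈ U := by
    refine fun y ↦ ⟨?_, fun hy ↦ ⟨y, hy, rfl⟩⟩
    rintro ⟨y', hy', hq⟩
    obtain ⟨t, rfl⟩ := (mk_eq_iff φ₁ φ₂).1 hq
    rwa [h₂.proj_flow]
  -- The chart is g, with inverse z ↦ [(z.1, σ z.2)]; its source is the image of the open saturated
  -- set of points with p₂ y₂ in U.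
  refine ⟨{
      toFun := g
      invFun := fun z ↦ mk φ₁ φ₂ (z.1, σ z.2)
      source := mk φ₁ φ₂ '' {y | p₂ y.2 ∈ U}
      target := univ ×ˢ U
      map_source' := ?_
      map_target' := ?_
      left_inv' := ?_
      right_inv' := ?_
      open_source := ?_
      open_target := isOpen_univ.prod hU
      continuousOn_toFun := ?_
      continuousOn_invFun := ?_ }, U, fun z ↦ (z.1, σ z.2), hy₀, hsrc, hs, fun z _ ↦ rfl,
    fun y hy ↦ hsm y ((hsrc y).1 hy)⟩
  · rintro _ ⟨y, hy, rfl⟩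
    obtain ⟨t, ht⟩ := hex y hy
    rw [hg y t hy ht]
    exact ⟨mem_univ _, hy⟩
  · intro z hz
    refine ⟨_, ?_, rfl⟩
    show p₂ (σ z.2) ∈ U
    rw [hpσ _ hz.2]
    exact hz.2
  · rintro _ ⟨y, hy, rfl⟩
    obtain ⟨t, ht⟩ := hex y hy
    rw [hg y t hy ht]
    refine (mk_flow φ₁ φ₂ t (y.1, σ (p₂ y.2))).trans ?_
    rw [ht]
  · intro z hz
    have h₃ : p₂ (σ z.2) = z.2 := hpσ _ hz.2
    have h₄ := hg (z.1, σ z.2) 0 (by rw [h₃]; exact hz.2) (by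
      simp only [h₃]
      exact φ₂.map_zero_apply _)
    refine h₄.trans ?_
    rw [φ₁.map_zero_apply, h₃]
  · rintro _ ⟨y, hy, rfl⟩
    exact ((isOpenQuotientMap_mk φ₁ φ₂).continuousAt_comp_iff.1
      (hsm y hy).continuousAt).continuousWithinAt
  · exact (isOpenQuotientMap_mk φ₁ φ₂).continuous.comp_continuousOn hs.continuousOn
  · exact (isOpenQuotientMap_mk φ₁ φ₂).isOpenMap _
      (hU.preimage (h₂.submersion.smooth.continuous.comp continuous_snd))

/-- Points with the same image in N₂ lie in a common chart, whose target is Hausdorff; the others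
are separated by open sets pulled back from N₂. -/
theorem t2Space [T2Space M₁] [T2Space N₂] : T2Space (ReducedProduct φ₁ φ₂) := by
  refine ⟨fun q q' hqq' ↦ ?_⟩
  obtain ⟨y, rfl⟩ := (isOpenQuotientMap_mk φ₁ φ₂).surjective q
  obtain ⟨y', rfl⟩ := (isOpenQuotientMap_mk φ₁ φ₂).surjective q'
  by_cases hp : p₂ y.2 = p₂ y'.2
  · obtain ⟨e, U, s, hy, hU, -⟩ := exists_chart_prod h₁ h₂ hd₂ y
    have hy₁ := (hU y).2 hy
    have hy₂ := (hU y').2 (hp ▸ hy)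
    obtain ⟨V, V', hV, hV', hyV, hyV', hd⟩ := t2_separation
      (fun h ↦ hqq' (e.injOn hy₁ hy₂ h))
    refine ⟨_, _, e.isOpen_inter_preimage hV, e.isOpen_inter_preimage hV', ⟨hy₁, hyV⟩,
      ⟨hy₂, hyV'⟩, ?_⟩
    exact Disjoint.mono inter_subset_right inter_subset_right (hd.preimage e)
  · obtain ⟨V, V', hV, hV', hyV, hyV', hd⟩ := t2_separation hp
    have hc : Continuous fun y : M₁ × M₂ ↦ p₂ y.2 :=
      h₂.submersion.smooth.continuous.comp continuous_snd
    refine ⟨_, _, (isOpenQuotientMap_mk φ₁ φ₂).isOpenMap _ (hV.preimage hc),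
      (isOpenQuotientMap_mk φ₁ φ₂).isOpenMap _ (hV'.preimage hc), ⟨y, hyV, rfl⟩,
      ⟨y', hyV', rfl⟩, ?_⟩
    rw [Set.disjoint_left]
    rintro _ ⟨z, hz, rfl⟩ ⟨z', hz', hq⟩
    obtain ⟨t, rfl⟩ := (mk_eq_iff φ₁ φ₂).1 hq
    have hz₁ : p₂ (φ₂ (-t) z'.2) ∈ V := hz
    rw [h₂.proj_flow] at hz₁
    exact Set.disjoint_left.1 hd hz₁ hz'

/-- The charts with values in M₁ × N₂ are followed by charts of that product, and L replaces its
model space by the prescribed one. -/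
theorem exists_isManifold [I₁.Boundaryless] {F : Type*} [NormedAddCommGroup F] [NormedSpace ℝ F]
    (L : (E₁ × E₂') ≃L[ℝ] F) :
    ∃ (_ : ChartedSpace F (ReducedProduct φ₁ φ₂))
      (_ : IsManifold 𝓘(ℝ, F) ∞ (ReducedProduct φ₁ φ₂)),
      HasSmoothLocalSections (I₁.prod I₂) 𝓘(ℝ, F) (mk φ₁ φ₂) := by
  have hq := isOpenQuotientMap_mk φ₁ φ₂
  obtain ⟨C, hm, hsm, hsec⟩ := exists_isManifold_quotient (F := F) (I := I₁.prod I₂) hq.continuous (by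
    intro q
    obtain ⟨y₀, rfl⟩ := hq.surjective q
    obtain ⟨e, U, s, hy₀, hU, hs, hes, he⟩ := exists_chart_prod h₁ h₂ hd₂ y₀
    set z₀ := e (mk φ₁ φ₂ y₀)
    set c := chartAt (ModelProd H₁ H₂') z₀
    -- Without boundary the model with corners is a homeomorphism onto the vector space.
    set L' : H₁ × H₂' ≃ₜ F := (I₁.prod J₂).toHomeomorph.trans L.toHomeomorph
    have htgt : ∀ w ∈ ((e.trans c).trans L'.toOpenPartialHomeomorph).target,
        L.symm w ∈ (extChartAt (I₁.prod J₂) z₀).target ∧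
          (extChartAt (I₁.prod J₂) z₀).symm (L.symm w) ∈ e.target := by
      intro w hw
      have hw' : L'.symm w ∈ c.target ∧ c.symm (L'.symm w) ∈ e.target := by simpa using hw
      refine ⟨?_, hw'.2⟩
      rw [extChartAt_target, (I₁.prod J₂).range_eq_univ, inter_univ]
      exact hw'.1
    refine ⟨(e.trans c).trans L'.toOpenPartialHomeomorph,
      fun w ↦ s ((extChartAt (I₁.prod J₂) z₀).symm (L.symm w)), ?_, ?_, ?_, ?_⟩
    · have : e (mk φ₁ φ₂ y₀) ∈ c.source := mem_chart_source _ z₀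
      simpa using ⟨(hU y₀).2 hy₀, this⟩
    · intro w hw
      obtain ⟨hw₁, hw₂⟩ := htgt w hw
      have a₁ : ContMDiffAt 𝓘(ℝ, E₁ × E₂') (I₁.prod J₂) ∞ (extChartAt (I₁.prod J₂) z₀).symm
          (L.symm w) :=
        (contMDiffOn_extChartAt_symm z₀).contMDiffAt
          ((isOpen_extChartAt_target z₀).mem_nhds hw₁)
      have a₂ : ContMDiffAt 𝓘(ℝ, F) 𝓘(ℝ, E₁ × E₂') ∞ L.symm w := L.symm.contDiff.contMDiff w
      exact ((hs.contMDiffAt (e.open_target.mem_nhds hw₂)).comp w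
        (a₁.comp w a₂)).contMDiffWithinAt
    · intro w hw
      exact hes _ (htgt w hw).2
    · intro y hy
      have hy' : mk φ₁ φ₂ y ∈ e.source ∧ e (mk φ₁ φ₂ y) ∈ c.source := by simpa using hy
      have a₁ : ContMDiffAt (I₁.prod J₂) 𝓘(ℝ, E₁ × E₂') ∞ (extChartAt (I₁.prod J₂) z₀)
          (e (mk φ₁ φ₂ y)) := contMDiffAt_extChartAt' hy'.2
      have a₂ : ContMDiff 𝓘(ℝ, E₁ × E₂') 𝓘(ℝ, F) ∞ L := L.contDiff.contMDiff
      have a₃ := a₁.comp (g := extChartAt (I₁.prod J₂) z₀) y (he y hy'.1)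
      exact ContMDiffAt.comp (g := L) y a₂.contMDiffAt a₃)
  refine ⟨C, hm, hsm, fun y ↦ ?_⟩
  obtain ⟨U, s, hU, hy, hs, hfs⟩ := hsec (mk φ₁ φ₂ y)
  -- A section meets the orbit of y somewhere; moving it by a fixed time of the difference flow
  -- makes it pass through y.
  obtain ⟨t, ht⟩ := (mk_eq_iff φ₁ φ₂).1 (hfs _ hy)
  refine ⟨U, fun x ↦ differenceFlow φ₁ φ₂ t (s x), hU, hy,
    ((isFlowOf_differenceFlow h₁.flow h₂.flow).contMDiff t).comp_contMDiffOn hs, fun x hx ↦ ?_, ht⟩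
  exact ((mk_eq_iff φ₁ φ₂).2 ⟨t, rfl⟩ : mk φ₁ φ₂ (s x) = _).symm.trans (hfs x hx)

end ReducedProduct

end ReducedProducts


/-! ### Descent of one-forms and generators of flows -/

section Descent

variable {E : Type*} [NormedAddCommGroup E] [NormedSpace ℝ E]
  {H : Type*} [TopologicalSpace H] {I : ModelWithCorners ℝ E H}
  {M : Type*} [TopologicalSpace M] [ChartedSpace H M]
  {E' : Type*} [NormedAddCommGroup E'] [NormedSpace ℝ E']
  {H' : Type*} [TopologicalSpace H'] {J : ModelWithCorners ℝ E' H'}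
  {N : Type*} [TopologicalSpace N] [ChartedSpace H' N]

theorem mfderiv_mfderiv_section {f : M → N} (hf : ContMDiff I J ∞ f) {s : N → M} {U : Set N}
    (hU : IsOpen U) (hs : ContMDiffOn J I ∞ s U) (hfs : ∀ x ∈ U, f (s x) = x) {x : N} (hx : x ∈ U)
    (v : E') : (show E →L[ℝ] E' from mfderiv I J f (s x))
      ((show E' →L[ℝ] E from mfderiv J I s x) v) = v := by
  have hs' : HasMFDerivAt J I s x _ :=
    ((hs.contMDiffAt (hU.mem_nhds hx)).mdifferentiableAt (by simp)).hasMFDerivAt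
  have hf' : HasMFDerivAt I J f (s x) _ := (hf.mdifferentiable (by simp) _).hasMFDerivAt
  have h₁ := hf'.comp _ hs'
  have h₂ : f ∘ s =ᶠ[𝓝 x] id := by
    filter_upwards [hU.mem_nhds hx] with x hx using hfs x hx
  have h₃ := hasMFDerivAt_unique (h₁.congr_of_eventuallyEq h₂.symm) (hasMFDerivAt_id x)
  exact congrArg (fun A : E' →L[ℝ] E' ↦ A v) h₃

/-- A 1-form whose values depend only on the image of a tangent vector descends along a map with
smooth local sections. -/
theorem HasSmoothLocalSections.exists_pullback₁_eq [IsManifold I ∞ M] [IsManifold J ∞ N]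
    [I.Boundaryless] [J.Boundaryless] {f : M → N} (hf : HasSmoothLocalSections I J f)
    (hsurj : Surjective f) {α : OneForm I M} (hα : SmoothOneForm I α)
    (hb : ∀ (y y' : M) (v w : E), f y = f y' →
      (show E →L[ℝ] E' from mfderiv I J f y) v = (show E →L[ℝ] E' from mfderiv I J f y') w →
      (show E →L[ℝ] ℝ from α y) v = (show E →L[ℝ] ℝ from α y') w) :
    ∃ η : OneForm J N, SmoothOneForm J η ∧ pullback₁ I f η = α := by
  have hex : ∀ x : N, ∃ (U : Set N) (s : N → M), IsOpen U ∧ x ∈ U ∧ ContMDiffOn J I ∞ s U ∧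
      ∀ x ∈ U, f (s x) = x := by
    intro x
    obtain ⟨y, rfl⟩ := hsurj x
    obtain ⟨U, s, hU, hy, hs, hfs, -⟩ := hf.exists_section y
    exact ⟨U, s, hU, hy, hs, hfs⟩
  choose U s hU hx hs hfs using hex
  -- The value at x uses the section chosen at x. By `hb` every other section gives the same
  -- covector, so near a fixed point a single section serves for all values, which gives smoothness.
  refine ⟨fun x ↦ pullback₁ J (s x) α x, ?_, ?_⟩
  · refine smoothOneForm_of_eventuallyEq_pullback₁ hα fun x ↦
      ⟨s x, (hs x).contMDiffAt ((hU x).mem_nhds (hx x)), ?_⟩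
    filter_upwards [(hU x).mem_nhds (hx x)] with x' hx'
    refine ContinuousLinearMap.ext fun v ↦ ?_
    refine hb _ _ _ _ ((hfs x' x' (hx x')).trans (hfs x x' hx').symm) ?_
    exact (mfderiv_mfderiv_section hf.smooth (hU x') (hs x') (hfs x') (hx x') v).trans
      (mfderiv_mfderiv_section hf.smooth (hU x) (hs x) (hfs x) hx' v).symm
  · funext y
    refine ContinuousLinearMap.ext fun v ↦ ?_
    refine hb _ _ _ _ (hfs _ _ (hx _)) ?_
    exact mfderiv_mfderiv_section hf.smooth (hU (f y)) (hs (f y)) (hfs (f y)) (hx (f y)) _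

/-- The vector field that generates a flow. -/
noncomputable def flowGenerator (I : ModelWithCorners ℝ E H) (φ : Flow ℝ M) : VField I M := fun y ↦
  (show ℝ →L[ℝ] E from mfderiv 𝓘(ℝ, ℝ) I (fun t ↦ φ t y) 0) 1

/-- By the group law φ_s y = φ_(s−t)(φ_t y), the velocity at time t is the velocity at time 0 of the
orbit through φ_t y. -/
theorem isFlowOf_flowGenerator {φ : Flow ℝ M}
    (hφ : ContMDiff (𝓘(ℝ, ℝ).prod I) I ∞ (fun q : ℝ × M ↦ φ q.1 q.2)) :
    IsFlowOf I (flowGenerator I φ) φ := by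
  refine ⟨hφ, fun y t ↦ ?_⟩
  have hd : ∀ y, HasMFDerivAt 𝓘(ℝ, ℝ) I (fun t ↦ φ t y) 0 _ := fun y ↦
    ((hφ.comp (contMDiff_id.prodMk contMDiff_const)).mdifferentiable (by simp) 0).hasMFDerivAt
  have h₁ : HasMFDerivAt 𝓘(ℝ, ℝ) 𝓘(ℝ, ℝ) (fun s : ℝ ↦ s - t) t (ContinuousLinearMap.id ℝ ℝ) :=
    ((hasFDerivAt_id t).sub_const t).hasMFDerivAt
  have h₂ : HasMFDerivAt 𝓘(ℝ, ℝ) I (fun s ↦ φ s (φ t y)) (t - t)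
      (mfderiv 𝓘(ℝ, ℝ) I (fun s ↦ φ s (φ t y)) 0) := by
    rw [sub_self]
    exact hd (φ t y)
  have h₃ := HasMFDerivAt.comp (f := fun s : ℝ ↦ s - t) t h₂ h₁
  have h₄ : (fun s ↦ φ s (φ t y)) ∘ (fun s : ℝ ↦ s - t) = fun s ↦ φ s y := by
    funext s
    show φ (s - t) (φ t y) = φ s y
    rw [← φ.map_add, sub_add_cancel]
  rw [h₄] at h₃
  refine h₃.congr_mfderiv ?_
  refine ContinuousLinearMap.ext fun (a : ℝ) ↦ ?_
  refine Eq.trans ?_ (map_smul (show ℝ →L[ℝ] E from mfderiv 𝓘(ℝ, ℝ) I (fun s ↦ φ s (φ t y)) 0) a (1 : ℝ))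
  exact congrArg (show ℝ →L[ℝ] E from mfderiv 𝓘(ℝ, ℝ) I (fun s ↦ φ s (φ t y)) 0) (mul_one a).symm

end Descent

/-! ### The flow on the reduced product -/

section ReducedFlow

variable {M₁ M₂ : Type*} [TopologicalSpace M₁] [TopologicalSpace M₂]

/-- The flow `[(y₁, y₂)] ↦ [(φ₁ t y₁, y₂)]` on the quotient. -/
def reducedFlow (φ₁ : Flow ℝ M₁) (φ₂ : Flow ℝ M₂) : Flow ℝ (ReducedProduct φ₁ φ₂) where
  toFun t := Quotient.map (fun y ↦ (φ₁ t y.1, y.2)) (by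
    rintro y _ ⟨s, rfl⟩
    refine ⟨s, Prod.ext ?_ rfl⟩
    show φ₁ s (φ₁ t y.1) = φ₁ t (φ₁ s y.1)
    rw [← φ₁.map_add, ← φ₁.map_add, add_comm])
  cont' := by
    -- The product of a quotient map with ℝ stays a quotient map because the projection is open, so
    -- joint continuity can be tested upstairs.
    have h₁ : IsOpenQuotientMap (Prod.map (id : ℝ → ℝ) (ReducedProduct.mk φ₁ φ₂)) :=
      IsOpenQuotientMap.id.prodMap (ReducedProduct.isOpenQuotientMap_mk φ₁ φ₂)
    refine h₁.continuous_comp_iff.1 ?_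
    have h₂ : Continuous fun q : ℝ × M₁ × M₂ ↦ ReducedProduct.mk φ₁ φ₂ (φ₁ q.1 q.2.1, q.2.2) :=
      (ReducedProduct.isOpenQuotientMap_mk φ₁ φ₂).continuous.comp
        ((φ₁.continuous continuous_fst (continuous_fst.comp continuous_snd)).prodMk
          (continuous_snd.comp continuous_snd))
    exact h₂
  map_add' t s := by
    rintro ⟨y⟩
    exact congrArg (fun z ↦ ReducedProduct.mk φ₁ φ₂ (z, y.2)) (φ₁.map_add t s y.1)
  map_zero' := by
    rintro ⟨y⟩
    exact congrArg (fun z ↦ ReducedProduct.mk φ₁ φ₂ (z, y.2)) (φ₁.map_zero_apply y.1)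

theorem reducedFlow_mk (φ₁ : Flow ℝ M₁) (φ₂ : Flow ℝ M₂) (t : ℝ) (y : M₁ × M₂) :
    reducedFlow φ₁ φ₂ t (ReducedProduct.mk φ₁ φ₂ y) = ReducedProduct.mk φ₁ φ₂ (φ₁ t y.1, y.2) :=
  rfl

end ReducedFlow


theorem mfderiv_prodMap_apply {E₁ : Type*} [NormedAddCommGroup E₁] [NormedSpace ℝ E₁]
    {H₁ : Type*} [TopologicalSpace H₁] {I₁ : ModelWithCorners ℝ E₁ H₁}
    {M₁ : Type*} [TopologicalSpace M₁] [ChartedSpace H₁ M₁]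
    {E₁' : Type*} [NormedAddCommGroup E₁'] [NormedSpace ℝ E₁']
    {H₁' : Type*} [TopologicalSpace H₁'] {J₁ : ModelWithCorners ℝ E₁' H₁'}
    {N₁ : Type*} [TopologicalSpace N₁] [ChartedSpace H₁' N₁]
    {E₂ : Type*} [NormedAddCommGroup E₂] [NormedSpace ℝ E₂]
    {H₂ : Type*} [TopologicalSpace H₂] {I₂ : ModelWithCorners ℝ E₂ H₂}
    {M₂ : Type*} [TopologicalSpace M₂] [ChartedSpace H₂ M₂]
    {E₂' : Type*} [NormedAddCommGroup E₂'] [NormedSpace ℝ E₂']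
    {H₂' : Type*} [TopologicalSpace H₂'] {J₂ : ModelWithCorners ℝ E₂' H₂'}
    {N₂ : Type*} [TopologicalSpace N₂] [ChartedSpace H₂' N₂] {f : M₁ → N₁} {g : M₂ → N₂}
    {y : M₁ × M₂} (hf : MDifferentiableAt I₁ J₁ f y.1) (hg : MDifferentiableAt I₂ J₂ g y.2)
    (v : E₁ × E₂) :
    (show E₁ × E₂ →L[ℝ] E₁' × E₂' from mfderiv (I₁.prod I₂) (J₁.prod J₂)
        (fun y : M₁ × M₂ ↦ (f y.1, g y.2)) y) v
      = ((show E₁ →L[ℝ] E₁' from mfderiv I₁ J₁ f y.1) v.1,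
        (show E₂ →L[ℝ] E₂' from mfderiv I₂ J₂ g y.2) v.2) :=
  congrArg (fun A : E₁ × E₂ →L[ℝ] E₁' × E₂' ↦ A v) (mfderiv_prodMap hf hg)

/-! ### The descended form and the generator of the reduced flow -/

namespace ReducedProduct

variable {E₁ : Type*} [NormedAddCommGroup E₁] [NormedSpace ℝ E₁]
  {H₁ : Type*} [TopologicalSpace H₁] {I₁ : ModelWithCorners ℝ E₁ H₁}
  {M₁ : Type*} [TopologicalSpace M₁] [ChartedSpace H₁ M₁]
  {E₁' : Type*} [NormedAddCommGroup E₁'] [NormedSpace ℝ E₁']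
  {H₁' : Type*} [TopologicalSpace H₁'] {J₁ : ModelWithCorners ℝ E₁' H₁'}
  {N₁ : Type*} [TopologicalSpace N₁] [ChartedSpace H₁' N₁]
  {E₂ : Type*} [NormedAddCommGroup E₂] [NormedSpace ℝ E₂]
  {H₂ : Type*} [TopologicalSpace H₂] {I₂ : ModelWithCorners ℝ E₂ H₂}
  {M₂ : Type*} [TopologicalSpace M₂] [ChartedSpace H₂ M₂]
  {E₂' : Type*} [NormedAddCommGroup E₂'] [NormedSpace ℝ E₂']
  {H₂' : Type*} [TopologicalSpace H₂'] {J₂ : ModelWithCorners ℝ E₂' H₂'}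
  {N₂ : Type*} [TopologicalSpace N₂] [ChartedSpace H₂' N₂]
  {η₁ : OneForm I₁ M₁} {R₁ : VField I₁ M₁} {φ₁ : Flow ℝ M₁} {p₁ : M₁ → N₁} {Ω₁ : TwoForm J₁ N₁}
  {η₂ : OneForm I₂ M₂} {R₂ : VField I₂ M₂} {φ₂ : Flow ℝ M₂} {p₂ : M₂ → N₂} {Ω₂ : TwoForm J₂ N₂}
  {ρ : ENNReal}
  [IsManifold I₁ ∞ M₁] [IsManifold J₁ ∞ N₁] [IsManifold I₂ ∞ M₂] [IsManifold J₂ ∞ N₂]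
  (h₁ : IsPrincipalContactification I₁ J₁ η₁ R₁ φ₁ p₁ Ω₁ ρ)
  (h₂ : IsPrincipalContactification I₂ J₂ η₂ R₂ φ₂ p₂ Ω₂ ρ)
  {F : Type*} [NormedAddCommGroup F] [NormedSpace ℝ F]
  {G : Type*} [TopologicalSpace G] {K : ModelWithCorners ℝ F G}
  [ChartedSpace G (ReducedProduct φ₁ φ₂)]
include h₁ h₂

/-- The map `[(y₁, y₂)] ↦ (p₁ y₁, p₂ y₂)`. -/
theorem exists_proj : ∃ p : ReducedProduct φ₁ φ₂ → N₁ × N₂,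
    ∀ y, p (mk φ₁ φ₂ y) = (p₁ y.1, p₂ y.2) := by
  refine ⟨Quotient.lift (fun y ↦ (p₁ y.1, p₂ y.2)) ?_, fun y ↦ rfl⟩
  rintro y _ ⟨t, rfl⟩
  exact Prod.ext (h₁.proj_flow y.1 t).symm (h₂.proj_flow y.2 (-t)).symm

theorem prodOneForm_differenceFlow [I₁.Boundaryless] [I₂.Boundaryless] (t : ℝ) (y : M₁ × M₂)
    (v : E₁ × E₂) :
    (show E₁ × E₂ →L[ℝ] ℝ from prodOneForm η₁ η₂ (differenceFlow φ₁ φ₂ t y))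
      ((show E₁ × E₂ →L[ℝ] E₁ × E₂ from mfderiv (I₁.prod I₂) (I₁.prod I₂)
        (differenceFlow φ₁ φ₂ t) y) v)
      = (show E₁ × E₂ →L[ℝ] ℝ from prodOneForm η₁ η₂ y) v := by
  have b : (show E₁ × E₂ →L[ℝ] E₁ × E₂ from mfderiv (I₁.prod I₂) (I₁.prod I₂)
        (differenceFlow φ₁ φ₂ t) y) v
      = ((show E₁ →L[ℝ] E₁ from mfderiv I₁ I₁ (φ₁ t) y.1) v.1,
        (show E₂ →L[ℝ] E₂ from mfderiv I₂ I₂ (φ₂ (-t)) y.2) v.2) :=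
    mfderiv_prodMap_apply ((h₁.flow.contMDiff t).mdifferentiable (by simp) y.1)
      ((h₂.flow.contMDiff (-t)).mdifferentiable (by simp) y.2) v
  rw [b]
  refine (prodOneForm_apply η₁ η₂ (differenceFlow φ₁ φ₂ t y) _ _).trans ?_
  refine Eq.trans ?_ (prodOneForm_apply η₁ η₂ y v.1 v.2).symm
  exact congrArg₂ (· + ·)
    (congrArg (fun α : OneForm I₁ M₁ ↦ (show E₁ →L[ℝ] ℝ from α y.1) v.1)
      (h₁.flow.pullback₁_eq h₁.contact.smooth h₁.reeb t))
    (congrArg (fun α : OneForm I₂ M₂ ↦ (show E₂ →L[ℝ] ℝ from α y.2) v.2)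
      (h₂.flow.pullback₁_eq h₂.contact.smooth h₂.reeb (-t)))

variable (hs : HasSmoothLocalSections (I₁.prod I₂) K (mk φ₁ φ₂))
  (hd : Module.finrank ℝ E₁ + Module.finrank ℝ E₂ = Module.finrank ℝ F + 1)
  [FiniteDimensional ℝ E₁] [FiniteDimensional ℝ E₂]

include hs hd

/-- The 1-form `η₁ ⊕ η₂` vanishes on the kernel of the differential of the projection. -/
theorem prodOneForm_eq_zero (y : M₁ × M₂) (v : E₁ × E₂)
    (hv : (show E₁ × E₂ →L[ℝ] F from mfderiv (I₁.prod I₂) K (mk φ₁ φ₂) y) v = 0) :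
    (show E₁ × E₂ →L[ℝ] ℝ from prodOneForm η₁ η₂ y) v = 0 := by
  set A : E₁ × E₂ →L[ℝ] F := mfderiv (I₁.prod I₂) K (mk φ₁ φ₂) y with hA
  set w : E₁ × E₂ := prodVField R₁ (-R₂) y with hw
  have hAw : A w = 0 := (isFlowOf_differenceFlow h₁.flow h₂.flow).mfderiv_comp_eq_zero hs.smooth
    (fun y t ↦ ((mk_eq_iff φ₁ φ₂).2 ⟨t, rfl⟩ : mk φ₁ φ₂ y = _).symm) y
  have hone₁ : (show E₁ →L[ℝ] ℝ from η₁ y.1) (show E₁ from R₁ y.1) = 1 := h₁.reeb.apply_one y.1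
  have hone₂ : (show E₂ →L[ℝ] ℝ from η₂ y.2) (show E₂ from R₂ y.2) = 1 := h₂.reeb.apply_one y.2
  have hw0 : w ≠ 0 := by
    intro h0
    have h3 : (show E₁ from R₁ y.1) = 0 := congrArg Prod.fst h0
    rw [h3, map_zero] at hone₁
    exact zero_ne_one hone₁
  have hα : (show E₁ × E₂ →L[ℝ] ℝ from prodOneForm η₁ η₂ y) w = 0 := by
    refine (prodOneForm_apply η₁ η₂ y (R₁ y.1) (-R₂ y.2)).trans ?_
    refine (congrArg₂ (· + ·) hone₁ ((map_neg (show E₂ →L[ℝ] ℝ from η₂ y.2)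
      (show E₂ from R₂ y.2)).trans (congrArg Neg.neg hone₂))).trans (add_neg_cancel 1)
  have hsurj : Surjective A := hs.surjective_mfderiv y
  have hrank := A.toLinearMap.finrank_range_add_finrank_ker
  rw [LinearMap.range_eq_top.2 hsurj, finrank_top, Module.finrank_prod, hd, add_comm] at hrank
  -- By rank and nullity the kernel is a line, so it is spanned by the nonzero vector w = R₁ − R₂,
  -- on which the form takes the value 1 − 1 = 0.
  have hker : Module.finrank ℝ (LinearMap.ker A.toLinearMap) = 1 := by omega
  obtain ⟨c, hc⟩ := (finrank_eq_one_iff_of_nonzero' (⟨w, hAw⟩ : LinearMap.ker A.toLinearMap)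
    (fun h ↦ hw0 (congrArg Subtype.val h))).1 hker ⟨v, hv⟩
  have hcv : c • w = v := congrArg Subtype.val hc
  rw [← hcv, map_smul, hα, smul_zero]


/-- Points with the same image differ by the difference flow, which preserves η₁ ⊕ η₂. After moving
to one point, vectors with the same image differ by an element of the kernel, where the form
vanishes. -/
theorem exists_oneForm [I₁.Boundaryless] [I₂.Boundaryless] [K.Boundaryless]
    [IsManifold K ∞ (ReducedProduct φ₁ φ₂)] :
    ∃ η : OneForm K (ReducedProduct φ₁ φ₂), SmoothOneForm K η ∧
      pullback₁ (I₁.prod I₂) (mk φ₁ φ₂) η = prodOneForm η₁ η₂ := by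
  refine hs.exists_pullback₁_eq (isOpenQuotientMap_mk φ₁ φ₂).surjective
    (h₁.contact.smooth.prodOneForm h₂.contact.smooth) ?_
  intro y y' v w hy hvw
  obtain ⟨t, rfl⟩ := (mk_eq_iff φ₁ φ₂).1 hy
  have hψ := (isFlowOf_differenceFlow h₁.flow h₂.flow).contMDiff t
  have a := ((hs.smooth.mdifferentiable (by simp) (differenceFlow φ₁ φ₂ t y)).hasMFDerivAt.comp y
    (hψ.mdifferentiable (by simp) y).hasMFDerivAt).mfderiv
  have b : mk φ₁ φ₂ ∘ differenceFlow φ₁ φ₂ t = mk φ₁ φ₂ :=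
    funext fun y ↦ ((mk_eq_iff φ₁ φ₂).2 ⟨t, rfl⟩ : mk φ₁ φ₂ y = _).symm
  rw [b] at a
  have c := congrArg (fun A : E₁ × E₂ →L[ℝ] F ↦ A v) a
  have d := prodOneForm_eq_zero h₁ h₂ hs hd (differenceFlow φ₁ φ₂ t y)
    ((show E₁ × E₂ →L[ℝ] E₁ × E₂ from mfderiv (I₁.prod I₂) (I₁.prod I₂)
        (differenceFlow φ₁ φ₂ t) y) v - w) (by
    refine (map_sub (show E₁ × E₂ →L[ℝ] F from
      mfderiv (I₁.prod I₂) K (mk φ₁ φ₂) (differenceFlow φ₁ φ₂ t y)) _ _).trans ?_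
    exact sub_eq_zero.2 (c.symm.trans hvw))
  refine (prodOneForm_differenceFlow h₁ h₂ t y v).symm.trans ?_
  refine sub_eq_zero.1 (Eq.trans ?_ d)
  exact (map_sub (show E₁ × E₂ →L[ℝ] ℝ from prodOneForm η₁ η₂ (differenceFlow φ₁ φ₂ t y)) _ _).symm

omit h₂ hd [FiniteDimensional ℝ E₁] [FiniteDimensional ℝ E₂]
  [IsManifold I₂ ∞ M₂] [IsManifold J₂ ∞ N₂]

theorem contMDiff_reducedFlow : ContMDiff (𝓘(ℝ, ℝ).prod K) K ∞
    (fun q : ℝ × ReducedProduct φ₁ φ₂ ↦ reducedFlow φ₁ φ₂ q.1 q.2) := by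
  rintro ⟨t, q⟩
  obtain ⟨y, rfl⟩ := (isOpenQuotientMap_mk φ₁ φ₂).surjective q
  obtain ⟨U, s, hU, hy, hsm, hfs, -⟩ := hs.exists_section y
  have a : ContMDiffAt (𝓘(ℝ, ℝ).prod K) (I₁.prod I₂) ∞
      (fun q : ℝ × ReducedProduct φ₁ φ₂ ↦ s q.2) (t, mk φ₁ φ₂ y) :=
    (hsm.contMDiffAt (hU.mem_nhds hy)).comp (t, mk φ₁ φ₂ y) contMDiffAt_snd
  have b : ContMDiffAt (𝓘(ℝ, ℝ).prod K) I₁ ∞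
      (fun q : ℝ × ReducedProduct φ₁ φ₂ ↦ φ₁ q.1 (s q.2).1) (t, mk φ₁ φ₂ y) :=
    h₁.flow.smooth.contMDiffAt.comp (t, mk φ₁ φ₂ y)
      (contMDiffAt_fst.prodMk (contMDiffAt_fst.comp (t, mk φ₁ φ₂ y) a))
  have c : ContMDiffAt (𝓘(ℝ, ℝ).prod K) I₂ ∞
      (fun q : ℝ × ReducedProduct φ₁ φ₂ ↦ (s q.2).2) (t, mk φ₁ φ₂ y) :=
    contMDiffAt_snd.comp (t, mk φ₁ φ₂ y) a
  refine (hs.smooth.contMDiffAt.comp (t, mk φ₁ φ₂ y) (b.prodMk c)).congr_of_eventuallyEq ?_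
  filter_upwards [continuousAt_snd.eventually (hU.mem_nhds hy)] with q hq
  exact (congrArg (reducedFlow φ₁ φ₂ q.1) (hfs q.2 hq)).symm

/-- The orbit of the reduced flow lifts to the curve t ↦ (φ₁ t y₁, y₂), whose initial velocity is
(R₁, 0). -/
theorem flowGenerator_mk (y : M₁ × M₂) :
    (show F from flowGenerator K (reducedFlow φ₁ φ₂) (mk φ₁ φ₂ y))
      = (show E₁ × E₂ →L[ℝ] F from mfderiv (I₁.prod I₂) K (mk φ₁ φ₂) y)
        ((show E₁ from R₁ y.1), (0 : E₂)) := by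
  have a := (h₁.flow.integralCurve y.1 0).prodMk (hasMFDerivAt_const (I' := I₂) y.2 (0 : ℝ))
  have b : HasMFDerivAt (I₁.prod I₂) K (mk φ₁ φ₂) (φ₁ 0 y.1, y.2) _ :=
    (hs.smooth.mdifferentiable (by simp) _).hasMFDerivAt
  have c := (b.comp 0 a).mfderiv
  refine (congrArg (fun A : ℝ →L[ℝ] F ↦ A 1) c).trans ?_
  have key : ∀ z, z = y.1 → (show E₁ × E₂ →L[ℝ] F from mfderiv (I₁.prod I₂) K (mk φ₁ φ₂) (z, y.2))
        ((1 : ℝ) • (show E₁ from R₁ z), (0 : E₂))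
      = (show E₁ × E₂ →L[ℝ] F from mfderiv (I₁.prod I₂) K (mk φ₁ φ₂) y)
        ((show E₁ from R₁ y.1), (0 : E₂)) := by
    rintro z rfl
    rw [one_smul]
  exact key _ (φ₁.map_zero_apply y.1)

end ReducedProduct


/-! ### The reduced product as a principal contactification -/

namespace ReducedProduct

variable {E₁ : Type*} [NormedAddCommGroup E₁] [NormedSpace ℝ E₁]
  {H₁ : Type*} [TopologicalSpace H₁] {I₁ : ModelWithCorners ℝ E₁ H₁}
  {M₁ : Type*} [TopologicalSpace M₁] [ChartedSpace H₁ M₁]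
  {E₁' : Type*} [NormedAddCommGroup E₁'] [NormedSpace ℝ E₁']
  {H₁' : Type*} [TopologicalSpace H₁'] {J₁ : ModelWithCorners ℝ E₁' H₁'}
  {N₁ : Type*} [TopologicalSpace N₁] [ChartedSpace H₁' N₁]
  {E₂ : Type*} [NormedAddCommGroup E₂] [NormedSpace ℝ E₂]
  {H₂ : Type*} [TopologicalSpace H₂] {I₂ : ModelWithCorners ℝ E₂ H₂}
  {M₂ : Type*} [TopologicalSpace M₂] [ChartedSpace H₂ M₂]
  {E₂' : Type*} [NormedAddCommGroup E₂'] [NormedSpace ℝ E₂']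
  {H₂' : Type*} [TopologicalSpace H₂'] {J₂ : ModelWithCorners ℝ E₂' H₂'}
  {N₂ : Type*} [TopologicalSpace N₂] [ChartedSpace H₂' N₂]
  {η₁ : OneForm I₁ M₁} {R₁ : VField I₁ M₁} {φ₁ : Flow ℝ M₁} {p₁ : M₁ → N₁} {Ω₁ : TwoForm J₁ N₁}
  {η₂ : OneForm I₂ M₂} {R₂ : VField I₂ M₂} {φ₂ : Flow ℝ M₂} {p₂ : M₂ → N₂} {Ω₂ : TwoForm J₂ N₂}
  {ρ : ENNReal}
  [IsManifold I₁ ∞ M₁] [IsManifold J₁ ∞ N₁] [IsManifold I₂ ∞ M₂] [IsManifold J₂ ∞ N₂]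
  (h₁ : IsPrincipalContactification I₁ J₁ η₁ R₁ φ₁ p₁ Ω₁ ρ)
  (h₂ : IsPrincipalContactification I₂ J₂ η₂ R₂ φ₂ p₂ Ω₂ ρ)
  {F : Type*} [NormedAddCommGroup F] [NormedSpace ℝ F]
  {G : Type*} [TopologicalSpace G] {K : ModelWithCorners ℝ F G}
  [ChartedSpace G (ReducedProduct φ₁ φ₂)]
  [IsManifold K ∞ (ReducedProduct φ₁ φ₂)]
  {p : ReducedProduct φ₁ φ₂ → N₁ × N₂} {η : OneForm K (ReducedProduct φ₁ φ₂)}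
  (hs : HasSmoothLocalSections (I₁.prod I₂) K (mk φ₁ φ₂))
  (hp : ∀ y, p (mk φ₁ φ₂ y) = (p₁ y.1, p₂ y.2))
include h₁ h₂ hs hp

omit [IsManifold K ∞ (ReducedProduct φ₁ φ₂)] in
theorem contMDiff_proj : ContMDiff K (J₁.prod J₂) ∞ p := by
  rw [hs.contMDiff_iff (isOpenQuotientMap_mk φ₁ φ₂).surjective]
  have a : p ∘ mk φ₁ φ₂ = fun y ↦ (p₁ y.1, p₂ y.2) := funext hp
  rw [a]
  exact (h₁.submersion.smooth.comp contMDiff_fst).prodMk (h₂.submersion.smooth.comp contMDiff_snd)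

omit [IsManifold K ∞ (ReducedProduct φ₁ φ₂)] in
-- Pairs of local sections of p₁ and p₂, projected to the quotient. These also yield surjectivity of
-- the derivative and the local triviality.
theorem hasSmoothLocalSections_proj : HasSmoothLocalSections K (J₁.prod J₂) p := by
  refine ⟨contMDiff_proj h₁ h₂ hs hp, fun q ↦ ?_⟩
  obtain ⟨y, rfl⟩ := (isOpenQuotientMap_mk φ₁ φ₂).surjective q
  obtain ⟨U₁, σ₁, hU₁, hy₁, hσ₁, hpσ₁, hσy₁⟩ := h₁.exists_section_through y.1
  obtain ⟨U₂, σ₂, hU₂, hy₂, hσ₂, hpσ₂, hσy₂⟩ := h₂.exists_section_through y.2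
  refine ⟨U₁ ×ˢ U₂, fun x ↦ mk φ₁ φ₂ (σ₁ x.1, σ₂ x.2), hU₁.prod hU₂, ?_, ?_, fun x hx ↦ ?_, ?_⟩
  · rw [hp]
    exact ⟨hy₁, hy₂⟩
  · exact hs.smooth.comp_contMDiffOn ((hσ₁.comp contMDiffOn_fst fun x hx ↦ hx.1).prodMk
      (hσ₂.comp contMDiffOn_snd fun x hx ↦ hx.2))
  · rw [hp]
    exact Prod.ext (hpσ₁ _ hx.1) (hpσ₂ _ hx.2)
  · rw [hp]
    exact congrArg (mk φ₁ φ₂) (Prod.ext hσy₁ hσy₂)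

omit [IsManifold K ∞ (ReducedProduct φ₁ φ₂)] in
theorem mfderiv_proj_mfderiv_mk (y : M₁ × M₂) (v : E₁ × E₂) :
    (show F →L[ℝ] E₁' × E₂' from mfderiv K (J₁.prod J₂) p (mk φ₁ φ₂ y))
        ((show E₁ × E₂ →L[ℝ] F from mfderiv (I₁.prod I₂) K (mk φ₁ φ₂) y) v)
      = ((show E₁ →L[ℝ] E₁' from mfderiv I₁ J₁ p₁ y.1) v.1,
        (show E₂ →L[ℝ] E₂' from mfderiv I₂ J₂ p₂ y.2) v.2) := by
  have a := (((contMDiff_proj h₁ h₂ hs hp).mdifferentiable (by simp) (mk φ₁ φ₂ y)).hasMFDerivAt.comp y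
    (hs.smooth.mdifferentiable (by simp) y).hasMFDerivAt).mfderiv
  have b : p ∘ mk φ₁ φ₂ = fun y ↦ (p₁ y.1, p₂ y.2) := funext hp
  rw [b] at a
  refine (congrArg (fun A : E₁ × E₂ →L[ℝ] E₁' × E₂' ↦ A v) a).symm.trans ?_
  exact mfderiv_prodMap_apply (h₁.submersion.smooth.mdifferentiable (by simp) y.1)
    (h₂.submersion.smooth.mdifferentiable (by simp) y.2) v

omit hs hp [IsManifold K ∞ (ReducedProduct φ₁ φ₂)] [ChartedSpace G (ReducedProduct φ₁ φ₂)] in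
-- If the class is fixed at time t, then for some s both s + t and −s are periods, of the first and
-- of the second flow respectively; as the period groups coincide, their sum t is a period.
theorem reducedFlow_eq_iff (q : ReducedProduct φ₁ φ₂) (t : ℝ) :
    reducedFlow φ₁ φ₂ t q = q ↔ t ∈ periodGroup ρ := by
  obtain ⟨y, rfl⟩ := (isOpenQuotientMap_mk φ₁ φ₂).surjective q
  rw [reducedFlow_mk, mk_eq_iff]
  constructor
  · rintro ⟨s, hst⟩
    have a : φ₁ (s + t) y.1 = y.1 := (φ₁.map_add s t y.1).trans (congrArg Prod.fst hst)
    have b : φ₂ (-s) y.2 = y.2 := congrArg Prod.snd hst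
    have c := add_mem ((h₁.period _ _).1 a) ((h₂.period _ _).1 b)
    rwa [add_neg_cancel_comm] at c
  · intro ht
    refine ⟨0, Prod.ext ?_ ?_⟩
    · exact (φ₁.map_zero_apply _).trans ((h₁.period _ _).2 ht)
    · show φ₂ (-0) y.2 = y.2
      rw [neg_zero, φ₂.map_zero_apply]

omit hs [IsManifold K ∞ (ReducedProduct φ₁ φ₂)] [ChartedSpace G (ReducedProduct φ₁ φ₂)] in
-- If time a moves the first component and time b the second, the reduced flow moves the class in
-- time b + a, since either factor may absorb the flow.
theorem proj_eq_iff (q q' : ReducedProduct φ₁ φ₂) :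
    p q = p q' ↔ ∃ t, reducedFlow φ₁ φ₂ t q = q' := by
  obtain ⟨y, rfl⟩ := (isOpenQuotientMap_mk φ₁ φ₂).surjective q
  obtain ⟨y', rfl⟩ := (isOpenQuotientMap_mk φ₁ φ₂).surjective q'
  rw [hp, hp]
  constructor
  · intro hpy
    obtain ⟨a, ha⟩ := (h₁.orbits _ _).1 (congrArg Prod.fst hpy)
    obtain ⟨b, hb⟩ := (h₂.orbits _ _).1 (congrArg Prod.snd hpy)
    refine ⟨b + a, ?_⟩
    rw [reducedFlow_mk, φ₁.map_add, ha]
    refine (mk_flow φ₁ φ₂ b (y'.1, y.2)).trans ?_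
    rw [hb]
  · rintro ⟨t, ht⟩
    rw [← hp, ← hp, ← ht, reducedFlow_mk, hp, hp, h₁.proj_flow]

variable [I₁.Boundaryless] [I₂.Boundaryless] [K.Boundaryless]
  (hη : SmoothOneForm K η) (hα : pullback₁ (I₁.prod I₂) (mk φ₁ φ₂) η = prodOneForm η₁ η₂)
include hη hα

omit h₁ h₂ hs hp hη [IsManifold I₁ ∞ M₁] [IsManifold I₂ ∞ M₂] [IsManifold J₁ ∞ N₁]
  [IsManifold J₂ ∞ N₂] [I₁.Boundaryless] [I₂.Boundaryless] [K.Boundaryless]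
  [IsManifold K ∞ (ReducedProduct φ₁ φ₂)] in
theorem oneForm_mfderiv_mk (y : M₁ × M₂) (v : E₁ × E₂) :
    (show F →L[ℝ] ℝ from η (mk φ₁ φ₂ y))
      ((show E₁ × E₂ →L[ℝ] F from mfderiv (I₁.prod I₂) K (mk φ₁ φ₂) y) v)
      = (show E₁ →L[ℝ] ℝ from η₁ y.1) v.1 + (show E₂ →L[ℝ] ℝ from η₂ y.2) v.2 :=
  (congrArg (fun α : OneForm (I₁.prod I₂) (M₁ × M₂) ↦ (show E₁ × E₂ →L[ℝ] ℝ from α y) v) hα).trans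
    (prodOneForm_apply η₁ η₂ y v.1 v.2)

/-- The projection onto the quotient has surjective differentials, so the identity may be checked
after pullback, where it is the sum of the identities of the two factors. -/
theorem extDeriv₁_eq (q : ReducedProduct φ₁ φ₂) (u v : TangentSpace K q) :
    extDeriv₁ K η q u v = pullback₂ K p (prodTwoForm Ω₁ Ω₂) q u v := by
  obtain ⟨y, rfl⟩ := (isOpenQuotientMap_mk φ₁ φ₂).surjective q
  obtain ⟨u, rfl⟩ := hs.surjective_mfderiv y u
  obtain ⟨v, rfl⟩ := hs.surjective_mfderiv y v
  refine (extDeriv₁_pullback₁ hη hs.smooth.contMDiffAt u v).symm.trans ?_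
  rw [hα]
  refine (extDeriv₁_prodOneForm h₁.contact.smooth h₂.contact.smooth y u v).trans ?_
  refine (congrArg₂ (· + ·) (h₁.extDeriv_eq y.1 _ _) (h₂.extDeriv_eq y.2 _ _)).trans ?_
  have a := mfderiv_proj_mfderiv_mk h₁ h₂ hs hp y
  have key : ∀ (x x' : N₁ × N₂) (a b c d : E₁' × E₂'), x = x' → a = c → b = d →
      (show E₁' × E₂' →L[ℝ] E₁' × E₂' →L[ℝ] ℝ from prodTwoForm Ω₁ Ω₂ x) a b
        = (show E₁' × E₂' →L[ℝ] E₁' × E₂' →L[ℝ] ℝ from prodTwoForm Ω₁ Ω₂ x') c d := by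
    rintro x _ a b _ _ rfl rfl rfl
    rfl
  refine Eq.trans ?_ (key _ _ _ _ _ _ (hp y) (a u) (a v)).symm
  exact (prodTwoForm_apply Ω₁ Ω₂ (p₁ y.1, p₂ y.2) _ _ _ _).symm

variable [J₁.Boundaryless] [J₂.Boundaryless]
  [FiniteDimensional ℝ E₁'] [FiniteDimensional ℝ E₂'] [FiniteDimensional ℝ F]
  (hd : Module.finrank ℝ F = Module.finrank ℝ (E₁' × E₂') + 1)
include hd

/-- The generator has η = 1 and dp = 0; as dη is a pullback along p, it is the Reeb field.
Nondegeneracy is inherited from the symplectic form because dp is injective on ker η. -/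
theorem isPrincipalContactification :
    IsPrincipalContactification K (J₁.prod J₂) η (flowGenerator K (reducedFlow φ₁ φ₂))
      (reducedFlow φ₁ φ₂) p (prodTwoForm Ω₁ Ω₂) ρ := by
  have hflow : IsFlowOf K (flowGenerator K (reducedFlow φ₁ φ₂)) (reducedFlow φ₁ φ₂) :=
    isFlowOf_flowGenerator (contMDiff_reducedFlow h₁ hs)
  have hsymp := h₁.symplectic.prodTwoForm h₂.symplectic
  have hsec := hasSmoothLocalSections_proj h₁ h₂ hs hp
  have horb := proj_eq_iff h₁ h₂ hp
  have hext := extDeriv₁_eq h₁ h₂ hs hp hη hα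
  have hone : ∀ q, (show F →L[ℝ] ℝ from η q)
      (show F from flowGenerator K (reducedFlow φ₁ φ₂) q) = 1 := by
    intro q
    obtain ⟨y, rfl⟩ := (isOpenQuotientMap_mk φ₁ φ₂).surjective q
    have a := flowGenerator_mk h₁ hs y
    refine (congrArg (show F →L[ℝ] ℝ from η (mk φ₁ φ₂ y)) a).trans ?_
    refine (oneForm_mfderiv_mk hα y _).trans ?_
    exact (congrArg₂ (· + ·) (h₁.reeb.apply_one y.1) (map_zero _)).trans (add_zero 1)
  have hzero : ∀ q, (show F →L[ℝ] E₁' × E₂' from mfderiv K (J₁.prod J₂) p q)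
      (show F from flowGenerator K (reducedFlow φ₁ φ₂) q) = 0 :=
    hflow.mfderiv_comp_eq_zero hsec.smooth fun q t ↦ ((horb q _).2 ⟨t, rfl⟩).symm
  have hext₀ : ∀ q (v : TangentSpace K q),
      extDeriv₁ K η q (flowGenerator K (reducedFlow φ₁ φ₂) q) v = 0 := by
    intro q v
    refine (hext q _ v).trans ?_
    refine (congrArg (fun w : E₁' × E₂' ↦ (show E₁' × E₂' →L[ℝ] E₁' × E₂' →L[ℝ] ℝ from
      prodTwoForm Ω₁ Ω₂ (p q)) w (mfderiv K (J₁.prod J₂) p q v)) (hzero q)).trans ?_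
    exact congrArg (fun A : E₁' × E₂' →L[ℝ] ℝ ↦ A (mfderiv K (J₁.prod J₂) p q v))
      (map_zero (show E₁' × E₂' →L[ℝ] E₁' × E₂' →L[ℝ] ℝ from prodTwoForm Ω₁ Ω₂ (p q)))
  have hsurj : Surjective p := by
    rintro ⟨x₁, x₂⟩
    obtain ⟨y₁, rfl⟩ := h₁.surjective x₁
    obtain ⟨y₂, rfl⟩ := h₂.surjective x₂
    exact ⟨_, hp (y₁, y₂)⟩
  refine ⟨hsymp, ⟨hη, fun q hq ↦ ?_, fun q v hv hw ↦ ?_⟩, ⟨hone, hext₀⟩, hflow, h₁.period_pos,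
    reducedFlow_eq_iff h₁ h₂, hsurj, hsec.isSmoothSubmersion, horb, fun x ↦ ?_, hext⟩
  · have a := hone q
    rw [hq] at a
    exact zero_ne_one a
  · have hb := bijective_prod_of_finrank (hone q) (hzero q) (hsec.surjective_mfderiv q) hd
    have hv' : (show F →L[ℝ] E₁' × E₂' from mfderiv K (J₁.prod J₂) p q) v = 0 := ?_
    · exact hb.1 ((Prod.ext hv hv' : _ = ((0 : ℝ), (0 : E₁' × E₂'))).trans (map_zero _).symm)
    refine hsymp.nondegenerate (p q) _ fun w' ↦ ?_
    obtain ⟨w, rfl⟩ := hsec.surjective_mfderiv q w'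
    -- Nondegeneracy must be tested with all w, but the hypothesis concerns ker η only. Subtracting
    -- the Reeb component brings w into ker η without changing its image under dp.
    set w₀ : F := (show F from w) - (show F →L[ℝ] ℝ from η q) w •
      (show F from flowGenerator K (reducedFlow φ₁ φ₂) q) with hw₀
    have a : (show F →L[ℝ] ℝ from η q) w₀ = 0 := by
      rw [hw₀]
      refine (map_sub (show F →L[ℝ] ℝ from η q) _ _).trans ?_
      rw [map_smul, hone]
      exact sub_eq_zero.2 (mul_one _).symm
    have b : (show F →L[ℝ] E₁' × E₂' from mfderiv K (J₁.prod J₂) p q) w₀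
        = (show F →L[ℝ] E₁' × E₂' from mfderiv K (J₁.prod J₂) p q) w := by
      rw [hw₀]
      refine (map_sub (show F →L[ℝ] E₁' × E₂' from mfderiv K (J₁.prod J₂) p q) _ _).trans ?_
      rw [map_smul, hzero, smul_zero]
      exact sub_zero _
    refine Eq.trans ?_ ((hext q v w₀).symm.trans (hw w₀ a))
    exact congrArg ((show E₁' × E₂' →L[ℝ] E₁' × E₂' →L[ℝ] ℝ from
      prodTwoForm Ω₁ Ω₂ (p q)) (mfderiv K (J₁.prod J₂) p q v)) b.symm
  · obtain ⟨q, rfl⟩ := hsurj x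
    obtain ⟨U, s, hU, hq, hs, hps, -⟩ := hsec.exists_section q
    exact ⟨U, s, hU, hq, hs, hps⟩

end ReducedProduct


/-! ### The prequantum bundle of the reduced product as a tensor product -/

namespace ReducedProduct

variable {E₁ : Type*} [NormedAddCommGroup E₁] [NormedSpace ℝ E₁]
  {H₁ : Type*} [TopologicalSpace H₁] {I₁ : ModelWithCorners ℝ E₁ H₁}
  {M₁ : Type*} [TopologicalSpace M₁] [ChartedSpace H₁ M₁]
  {E₁' : Type*} [NormedAddCommGroup E₁'] [NormedSpace ℝ E₁']
  {H₁' : Type*} [TopologicalSpace H₁'] {J₁ : ModelWithCorners ℝ E₁' H₁'}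
  {N₁ : Type*} [TopologicalSpace N₁] [ChartedSpace H₁' N₁]
  {E₂ : Type*} [NormedAddCommGroup E₂] [NormedSpace ℝ E₂]
  {H₂ : Type*} [TopologicalSpace H₂] {I₂ : ModelWithCorners ℝ E₂ H₂}
  {M₂ : Type*} [TopologicalSpace M₂] [ChartedSpace H₂ M₂]
  {E₂' : Type*} [NormedAddCommGroup E₂'] [NormedSpace ℝ E₂']
  {H₂' : Type*} [TopologicalSpace H₂'] {J₂ : ModelWithCorners ℝ E₂' H₂'}
  {N₂ : Type*} [TopologicalSpace N₂] [ChartedSpace H₂' N₂]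
  {η₁ : OneForm I₁ M₁} {R₁ : VField I₁ M₁} {φ₁ : Flow ℝ M₁} {p₁ : M₁ → N₁} {Ω₁ : TwoForm J₁ N₁}
  {η₂ : OneForm I₂ M₂} {R₂ : VField I₂ M₂} {φ₂ : Flow ℝ M₂} {p₂ : M₂ → N₂} {Ω₂ : TwoForm J₂ N₂}
  {ρ : ENNReal}
  [IsManifold I₁ ∞ M₁] [IsManifold J₁ ∞ N₁] [IsManifold I₂ ∞ M₂] [IsManifold J₂ ∞ N₂]
  (h₁ : IsPrincipalContactification I₁ J₁ η₁ R₁ φ₁ p₁ Ω₁ ρ)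
  (h₂ : IsPrincipalContactification I₂ J₂ η₂ R₂ φ₂ p₂ Ω₂ ρ)
  {F : Type*} [NormedAddCommGroup F] [NormedSpace ℝ F]
  {G : Type*} [TopologicalSpace G] {K : ModelWithCorners ℝ F G}
  [ChartedSpace G (ReducedProduct φ₁ φ₂)]
  [IsManifold K ∞ (ReducedProduct φ₁ φ₂)]
  {p : ReducedProduct φ₁ φ₂ → N₁ × N₂} {η : OneForm K (ReducedProduct φ₁ φ₂)}
  {R : VField K (ReducedProduct φ₁ φ₂)} {Ω : TwoForm (J₁.prod J₂) (N₁ × N₂)}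
  (h : IsPrincipalContactification K (J₁.prod J₂) η R (reducedFlow φ₁ φ₂) p Ω ρ)
  (hp : ∀ y, p (mk φ₁ φ₂ y) = (p₁ y.1, p₂ y.2))

omit [IsManifold I₁ ∞ M₁] [IsManifold J₁ ∞ N₁] [IsManifold I₂ ∞ M₂] [IsManifold J₂ ∞ N₂]
  [ChartedSpace G (ReducedProduct φ₁ φ₂)] [IsManifold K ∞ (ReducedProduct φ₁ φ₂)] in
theorem proj_mk_eq {x : N₁ × N₂} (hp : ∀ y, p (mk φ₁ φ₂ y) = (p₁ y.1, p₂ y.2))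
    (y₁ : {y : M₁ // p₁ y = x.1}) (y₂ : {y : M₂ // p₂ y = x.2}) :
    p (mk φ₁ φ₂ (y₁.1, y₂.1)) = x :=
  (hp _).trans (Prod.ext y₁.2 y₂.2)

/-- The isomorphism of the fibres of the line bundles. -/
noncomputable def tensorEquiv (x : N₁ × N₂) :
    (equivariantFunctions φ₁ p₁ ρ x.1 ⊗[ℂ] equivariantFunctions φ₂ p₂ ρ x.2)
      ≃ₗ[ℂ] equivariantFunctions (reducedFlow φ₁ φ₂) p ρ x :=
  let y₁ : {y : M₁ // p₁ y = x.1} := ⟨surjInv h₁.surjective x.1, surjInv_eq h₁.surjective x.1⟩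
  let y₂ : {y : M₂ // p₂ y = x.2} := ⟨surjInv h₂.surjective x.2, surjInv_eq h₂.surjective x.2⟩
  (TensorProduct.congr (h₁.evalEquiv y₁) (h₂.evalEquiv y₂)).trans ((TensorProduct.lid ℂ ℂ).trans
    (h.evalEquiv ⟨mk φ₁ φ₂ (y₁.1, y₂.1), proj_mk_eq hp y₁ y₂⟩).symm)

/-- The isomorphism was normalized at chosen points. Any other pair is reached in times t₁ and t₂,
hence its class in time t₂ + t₁, and the phases multiply accordingly; so the formula holds at every
pair. -/
theorem tensorEquiv_tmul {x : N₁ × N₂} (f₁ : equivariantFunctions φ₁ p₁ ρ x.1)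
    (f₂ : equivariantFunctions φ₂ p₂ ρ x.2) (y₁ : {y : M₁ // p₁ y = x.1})
    (y₂ : {y : M₂ // p₂ y = x.2}) :
    (tensorEquiv h₁ h₂ h hp x (f₁ ⊗ₜ[ℂ] f₂)).1
      ⟨mk φ₁ φ₂ (y₁.1, y₂.1), proj_mk_eq hp y₁ y₂⟩ = f₁.1 y₁ * f₂.1 y₂ := by
  set z₁ : {y : M₁ // p₁ y = x.1} := ⟨surjInv h₁.surjective x.1, surjInv_eq h₁.surjective x.1⟩
  set z₂ : {y : M₂ // p₂ y = x.2} := ⟨surjInv h₂.surjective x.2, surjInv_eq h₂.surjective x.2⟩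
  have a : (tensorEquiv h₁ h₂ h hp x (f₁ ⊗ₜ[ℂ] f₂)).1
      ⟨mk φ₁ φ₂ (z₁.1, z₂.1), proj_mk_eq hp z₁ z₂⟩ = f₁.1 z₁ * f₂.1 z₂ :=
    h.evalEquiv_symm_apply ⟨mk φ₁ φ₂ (z₁.1, z₂.1), proj_mk_eq hp z₁ z₂⟩ _
  obtain ⟨t₁, ht₁⟩ := h₁.exists_time_fiber z₁ y₁
  obtain ⟨t₂, ht₂⟩ := h₂.exists_time_fiber z₂ y₂
  have b : reducedFlow φ₁ φ₂ (t₂ + t₁) (mk φ₁ φ₂ (z₁.1, z₂.1)) = mk φ₁ φ₂ (y₁.1, y₂.1) := by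
    rw [reducedFlow_mk, φ₁.map_add, ht₁]
    refine (mk_flow φ₁ φ₂ t₂ (y₁.1, z₂.1)).trans ?_
    rw [ht₂]
  refine ((tensorEquiv h₁ h₂ h hp x (f₁ ⊗ₜ[ℂ] f₂)).2 ⟨_, proj_mk_eq hp z₁ z₂⟩
    ⟨_, proj_mk_eq hp y₁ y₂⟩ _ b).trans ?_
  rw [a, f₁.2 z₁ y₁ t₁ ht₁, f₂.2 z₂ y₂ t₂ ht₂, phase_add]
  ring

theorem sectionFun_tensorEquiv_mk (ψ : Π x : N₁ × N₂,
      equivariantFunctions φ₁ p₁ ρ x.1 ⊗[ℂ] equivariantFunctions φ₂ p₂ ρ x.2) (y : M₁ × M₂) :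
    sectionFun (fun x ↦ tensorEquiv h₁ h₂ h hp x (ψ x)) (mk φ₁ φ₂ y)
      = (tensorEquiv h₁ h₂ h hp (p₁ y.1, p₂ y.2) (ψ (p₁ y.1, p₂ y.2))).1 ⟨mk φ₁ φ₂ y, hp y⟩ :=
  sectionFun_eq (fun x ↦ tensorEquiv h₁ h₂ h hp x (ψ x)) ⟨mk φ₁ φ₂ y, hp y⟩

theorem sectionFun_tensorEquiv_tmul (ψ₁ : Π x, equivariantFunctions φ₁ p₁ ρ x)
    (ψ₂ : Π x, equivariantFunctions φ₂ p₂ ρ x) (y : M₁ × M₂) :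
    sectionFun (fun x ↦ tensorEquiv h₁ h₂ h hp x (ψ₁ x.1 ⊗ₜ[ℂ] ψ₂ x.2)) (mk φ₁ φ₂ y)
      = sectionFun ψ₁ y.1 * sectionFun ψ₂ y.2 := by
  obtain ⟨y₁, y₂⟩ := y
  have a := sectionFun_tensorEquiv_mk h₁ h₂ h hp (fun x ↦ ψ₁ x.1 ⊗ₜ[ℂ] ψ₂ x.2) (y₁, y₂)
  rw [a]
  exact tensorEquiv_tmul h₁ h₂ h hp (x := (p₁ y₁, p₂ y₂)) (ψ₁ (p₁ y₁)) (ψ₂ (p₂ y₂)) ⟨y₁, rfl⟩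
    ⟨y₂, rfl⟩

variable (hs : HasSmoothLocalSections (I₁.prod I₂) K (mk φ₁ φ₂))
  (hα : pullback₁ (I₁.prod I₂) (mk φ₁ φ₂) η = prodOneForm η₁ η₂)
  [FiniteDimensional ℝ E₁] [FiniteDimensional ℝ E₁'] [FiniteDimensional ℝ E₂]
  [FiniteDimensional ℝ E₂'] [FiniteDimensional ℝ F]
  (hd₁ : Module.finrank ℝ E₁ = Module.finrank ℝ E₁' + 1)
  (hd₂ : Module.finrank ℝ E₂ = Module.finrank ℝ E₂' + 1)
  (hd : Module.finrank ℝ F = Module.finrank ℝ (E₁' × E₂') + 1)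

include h₁ h₂ h hp hs hα hd₁ hd₂ hd in
-- The image of the pair of horizontal lifts is killed by η and lies above X₁ ⊕ X₂, so it is the
-- horizontal lift on the quotient. What remains is the Leibniz rule for f₁ f₂.
theorem horizontalDeriv_mk (X₁ : VField J₁ N₁) (X₂ : VField J₂ N₂) {f : ReducedProduct φ₁ φ₂ → ℂ}
    {f₁ : M₁ → ℂ} {f₂ : M₂ → ℂ} (hf : ∀ y, f (mk φ₁ φ₂ y) = f₁ y.1 * f₂ y.2) {y : M₁ × M₂}
    (hfd : MDifferentiableAt K 𝓘(ℝ, ℂ) f (mk φ₁ φ₂ y))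
    (hfd₁ : MDifferentiableAt I₁ 𝓘(ℝ, ℂ) f₁ y.1) (hfd₂ : MDifferentiableAt I₂ 𝓘(ℝ, ℂ) f₂ y.2) :
    horizontalDeriv η p (prodVField X₁ X₂) f (mk φ₁ φ₂ y)
      = horizontalDeriv η₁ p₁ X₁ f₁ y.1 * f₂ y.2 + f₁ y.1 * horizontalDeriv η₂ p₂ X₂ f₂ y.2 := by
  obtain ⟨a₁, b₁⟩ := h₁.horizontalLift_spec hd₁ y.1 (X₁ (p₁ y.1))
  obtain ⟨a₂, b₂⟩ := h₂.horizontalLift_spec hd₂ y.2 (X₂ (p₂ y.2))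
  set v₁ : E₁ := horizontalLift η₁ p₁ y.1 (X₁ (p₁ y.1))
  set v₂ : E₂ := horizontalLift η₂ p₂ y.2 (X₂ (p₂ y.2))
  have c : (show E₁ × E₂ →L[ℝ] F from mfderiv (I₁.prod I₂) K (mk φ₁ φ₂) y) (v₁, v₂)
      = (show F from horizontalLift η p (mk φ₁ φ₂ y) (prodVField X₁ X₂ (p (mk φ₁ φ₂ y)))) := by
    refine h.eq_horizontalLift hd ?_ ?_
    · exact (oneForm_mfderiv_mk hα y (v₁, v₂)).trans ((congrArg₂ (· + ·) a₁ a₂).trans (add_zero 0))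
    · refine (mfderiv_proj_mfderiv_mk h₁ h₂ hs hp y (v₁, v₂)).trans ?_
      refine Eq.trans (Prod.ext b₁ b₂) (vField_congr_point (prodVField X₁ X₂) (hp y)).symm
  refine (congrArg (show F →L[ℝ] ℂ from mvfderiv K f (mk φ₁ φ₂ y)) c).symm.trans ?_
  refine (mvfderiv_complex_comp_apply hfd (hs.smooth.mdifferentiable (by simp) y) _).symm.trans ?_
  have e : (fun y ↦ f (mk φ₁ φ₂ y)) = fun y : M₁ × M₂ ↦ f₁ y.1 * f₂ y.2 := funext hf
  rw [e]
  have d₁ : MDifferentiableAt (I₁.prod I₂) I₁ (Prod.fst : M₁ × M₂ → M₁) y := mdifferentiableAt_fst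
  have d₂ : MDifferentiableAt (I₁.prod I₂) I₂ (Prod.snd : M₁ × M₂ → M₂) y := mdifferentiableAt_snd
  refine (mvfderiv_mul_apply (hfd₁.comp y d₁) (hfd₂.comp y d₂) _).trans ?_
  rw [add_comm]
  refine congrArg₂ (· + ·) (congrArg (· * f₂ y.2) ?_) (congrArg (f₁ y.1 * ·) ?_)
  · refine (mvfderiv_complex_comp_apply hfd₁ d₁ _).trans ?_
    rw [mfderiv_fst]
    rfl
  · refine (mvfderiv_complex_comp_apply hfd₂ d₂ _).trans ?_
    rw [mfderiv_snd]
    rfl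

include hs in
theorem smoothOn_iff_mk (ψ : Π x, equivariantFunctions (reducedFlow φ₁ φ₂) p ρ x)
    {W : Set (N₁ × N₂)} (hW : IsOpen W) :
    (prequantumBundle h).SmoothOn ψ W ↔ ContMDiffOn (I₁.prod I₂) 𝓘(ℝ, ℂ) ∞
      (fun y ↦ sectionFun ψ (mk φ₁ φ₂ y)) ((fun y ↦ p (mk φ₁ φ₂ y)) ⁻¹' W) :=
  hs.contMDiffOn_iff (isOpenQuotientMap_mk φ₁ φ₂).surjective
    (hW.preimage h.submersion.smooth.continuous)

include hs hp in
theorem smoothOn_tmul {ψ₁ : Π x, equivariantFunctions φ₁ p₁ ρ x}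
    {ψ₂ : Π x, equivariantFunctions φ₂ p₂ ρ x} {U₁ : Set N₁} {U₂ : Set N₂} (hU₁ : IsOpen U₁)
    (hU₂ : IsOpen U₂) (hψ₁ : (prequantumBundle h₁).SmoothOn ψ₁ U₁)
    (hψ₂ : (prequantumBundle h₂).SmoothOn ψ₂ U₂) :
    ContMDiffOn (I₁.prod I₂) 𝓘(ℝ, ℂ) ∞ (fun y : M₁ × M₂ ↦ sectionFun ψ₁ y.1 * sectionFun ψ₂ y.2)
      ((fun y ↦ p (mk φ₁ φ₂ y)) ⁻¹' (U₁ ×ˢ U₂)) := by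
  rintro y hy
  have hy' : p (mk φ₁ φ₂ y) ∈ U₁ ×ˢ U₂ := hy
  rw [hp] at hy'
  have a₁ : ContMDiffOn I₁ 𝓘(ℝ, ℂ) ∞ (sectionFun ψ₁) (p₁ ⁻¹' U₁) := hψ₁
  have a₂ : ContMDiffOn I₂ 𝓘(ℝ, ℂ) ∞ (sectionFun ψ₂) (p₂ ⁻¹' U₂) := hψ₂
  have b₁ := a₁.contMDiffAt ((hU₁.preimage h₁.submersion.smooth.continuous).mem_nhds hy'.1)
  have b₂ := a₂.contMDiffAt ((hU₂.preimage h₂.submersion.smooth.continuous).mem_nhds hy'.2)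
  exact (ContMDiffAt.complex_mul (b₁.comp y contMDiffAt_fst)
    (b₂.comp y contMDiffAt_snd)).contMDiffWithinAt

variable [I₁.Boundaryless] [J₁.Boundaryless] [I₂.Boundaryless] [J₂.Boundaryless] [K.Boundaryless]

include hs hd₁ hd₂ in
-- Near a point the tensor product of the two frames given by local sections is a frame, and the
-- coefficient is the value of the equivariant function at [(σ₁, σ₂)]; so a sum with a single term
-- is enough.
theorem tensorSmoothOn_of_smoothOn (ψ : Π x : N₁ × N₂,
      equivariantFunctions φ₁ p₁ ρ x.1 ⊗[ℂ] equivariantFunctions φ₂ p₂ ρ x.2) {W : Set (N₁ × N₂)}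
    (hW : IsOpen W)
    (hψ : (prequantumBundle h).SmoothOn (fun x ↦ tensorEquiv h₁ h₂ h hp x (ψ x)) W) :
    tensorSmoothOn (prequantumBundle h₁) (prequantumBundle h₂) ψ W := by
  intro x hx
  obtain ⟨V₁, σ₁, hV₁, hx₁, hσ₁, hpσ₁⟩ := h₁.localSection x.1
  obtain ⟨V₂, σ₂, hV₂, hx₂, hσ₂, hpσ₂⟩ := h₂.localSection x.2
  obtain ⟨U₁, U₂, hU₁, hU₂, hxU₁, hxU₂, hU⟩ := isOpen_prod_iff.1
    (hW.inter (hV₁.prod hV₂)) x.1 x.2 ⟨hx, hx₁, hx₂⟩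
  have hUV₁ : U₁ ⊆ V₁ := fun z hz ↦ (hU (⟨hz, hxU₂⟩ : (z, x.2) ∈ U₁ ×ˢ U₂)).2.1
  have hUV₂ : U₂ ⊆ V₂ := fun z hz ↦ (hU (⟨hxU₁, hz⟩ : (x.1, z) ∈ U₁ ×ˢ U₂)).2.2
  have hone₁ : ∀ z ∈ U₁, sectionFun (h₁.frame σ₁) (σ₁ z) = 1 := fun z hz ↦
    (sectionFun_eq (h₁.frame σ₁) ⟨σ₁ z, hpσ₁ z (hUV₁ hz)⟩).trans
      (h₁.frame_apply (hpσ₁ z (hUV₁ hz)))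
  have hone₂ : ∀ z ∈ U₂, sectionFun (h₂.frame σ₂) (σ₂ z) = 1 := fun z hz ↦
    (sectionFun_eq (h₂.frame σ₂) ⟨σ₂ z, hpσ₂ z (hUV₂ hz)⟩).trans
      (h₂.frame_apply (hpσ₂ z (hUV₂ hz)))
  refine ⟨U₁, U₂, hU₁, hU₂, ⟨hxU₁, hxU₂⟩, hU.trans inter_subset_left, 1,
    fun _ z ↦ sectionFun (fun x ↦ tensorEquiv h₁ h₂ h hp x (ψ x)) (mk φ₁ φ₂ (σ₁ z.1, σ₂ z.2)),
    fun _ ↦ h₁.frame σ₁, fun _ ↦ h₂.frame σ₂, fun _ ↦ ?_, fun _ ↦ ?_, fun _ ↦ ?_, fun z hz ↦ ?_⟩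
  · have a : ContMDiffOn (J₁.prod J₂) (I₁.prod I₂) ∞ (fun z : N₁ × N₂ ↦ (σ₁ z.1, σ₂ z.2))
        (U₁ ×ˢ U₂) :=
      (hσ₁.comp contMDiffOn_fst fun z hz ↦ hUV₁ hz.1).prodMk
        (hσ₂.comp contMDiffOn_snd fun z hz ↦ hUV₂ hz.2)
    refine ((smoothOn_iff_mk h hs _ hW).1 hψ).comp a fun z hz ↦ ?_
    show p (mk φ₁ φ₂ (σ₁ z.1, σ₂ z.2)) ∈ W
    rw [hp, hpσ₁ _ (hUV₁ hz.1), hpσ₂ _ (hUV₂ hz.2)]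
    exact (hU hz).1
  · exact (h₁.smoothOn_iff_comp_section hd₁ hV₁ hσ₁ hpσ₁ _ hU₁ hUV₁).2
      (contMDiffOn_const.congr hone₁)
  · exact (h₂.smoothOn_iff_comp_section hd₂ hV₂ hσ₂ hpσ₂ _ hU₂ hUV₂).2
      (contMDiffOn_const.congr hone₂)
  · rw [Fin.sum_univ_one]
    set y₁ : {y : M₁ // p₁ y = z.1} := ⟨σ₁ z.1, hpσ₁ _ (hUV₁ hz.1)⟩
    set y₂ : {y : M₂ // p₂ y = z.2} := ⟨σ₂ z.2, hpσ₂ _ (hUV₂ hz.2)⟩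
    refine (tensorEquiv h₁ h₂ h hp z).injective (h.fiber_ext
      ⟨mk φ₁ φ₂ (y₁.1, y₂.1), proj_mk_eq hp y₁ y₂⟩ ?_)
    refine Eq.trans ?_ (congrArg (fun f : equivariantFunctions (reducedFlow φ₁ φ₂) p ρ z ↦
      f.1 ⟨mk φ₁ φ₂ (y₁.1, y₂.1), proj_mk_eq hp y₁ y₂⟩)
        (map_smul (tensorEquiv h₁ h₂ h hp z) _ _).symm)
    have a := tensorEquiv_tmul h₁ h₂ h hp (h₁.frame σ₁ z.1) (h₂.frame σ₂ z.2) y₁ y₂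
    rw [show (h₁.frame σ₁ z.1).1 y₁ = 1 from h₁.frame_apply _,
      show (h₂.frame σ₂ z.2).1 y₂ = 1 from h₂.frame_apply _, one_mul] at a
    refine Eq.trans ?_ ((congrArg (_ * ·) a).trans (mul_one _)).symm
    exact (sectionFun_eq (fun x ↦ tensorEquiv h₁ h₂ h hp x (ψ x))
      ⟨mk φ₁ φ₂ (y₁.1, y₂.1), proj_mk_eq hp y₁ y₂⟩).symm

include hs in
theorem smoothOn_of_tensorSmoothOn (hL : (prequantumBundle h).IsHermitianLineBundle)
    (ψ : Π x : N₁ × N₂,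
      equivariantFunctions φ₁ p₁ ρ x.1 ⊗[ℂ] equivariantFunctions φ₂ p₂ ρ x.2) {W : Set (N₁ × N₂)}
    (hW : IsOpen W) (hψ : tensorSmoothOn (prequantumBundle h₁) (prequantumBundle h₂) ψ W) :
    (prequantumBundle h).SmoothOn (fun x ↦ tensorEquiv h₁ h₂ h hp x (ψ x)) W := by
  refine (hL.smoothOn_iff_locally _ W hW).2 fun x hx ↦ ?_
  obtain ⟨U₁, U₂, hU₁, hU₂, hxU, hUW, k, f, s₁, s₂, hf, hs₁, hs₂, hsum⟩ := hψ x hx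
  refine ⟨U₁ ×ˢ U₂, hUW, hU₁.prod hU₂, hxU, (smoothOn_iff_mk h hs _ (hU₁.prod hU₂)).2 ?_⟩
  have a : ContMDiffOn (I₁.prod I₂) 𝓘(ℝ, ℂ) ∞ (fun y : M₁ × M₂ ↦ ∑ i, f i (p (mk φ₁ φ₂ y)) *
      (sectionFun (s₁ i) y.1 * sectionFun (s₂ i) y.2))
      ((fun y ↦ p (mk φ₁ φ₂ y)) ⁻¹' (U₁ ×ˢ U₂)) := by
    have hopen : IsOpen ((fun y ↦ p (mk φ₁ φ₂ y)) ⁻¹' (U₁ ×ˢ U₂)) :=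
      (hU₁.prod hU₂).preimage (h.submersion.smooth.comp hs.smooth).continuous
    intro y hy
    refine ContMDiffWithinAt.sum fun i _ ↦ ?_
    have b₁ : ContMDiffAt (I₁.prod I₂) 𝓘(ℝ, ℂ) ∞ (fun y ↦ f i (p (mk φ₁ φ₂ y))) y :=
      ((hf i).contMDiffAt ((hU₁.prod hU₂).mem_nhds hy)).comp y
        (h.submersion.smooth.comp hs.smooth).contMDiffAt
    have b₂ := (smoothOn_tmul h₁ h₂ hp hs hU₁ hU₂ (hs₁ i) (hs₂ i)).contMDiffAt (hopen.mem_nhds hy)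
    exact (ContMDiffAt.complex_mul b₁ b₂).contMDiffWithinAt
  refine a.congr fun y hy ↦ ?_
  have hy' : (p₁ y.1, p₂ y.2) ∈ U₁ ×ˢ U₂ := by
    rw [← hp]
    exact hy
  rw [sectionFun_tensorEquiv_mk, hp]
  have b := hsum _ hy'
  -- Evaluating the image at the class of y is linear on the tensor product, so the local sum can be
  -- treated term by term.
  set L : (equivariantFunctions φ₁ p₁ ρ (p₁ y.1) ⊗[ℂ] equivariantFunctions φ₂ p₂ ρ (p₂ y.2))
      →ₗ[ℂ] ℂ := (h.evalEquiv ⟨mk φ₁ φ₂ y, hp y⟩).toLinearMap ∘ₗ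
    (tensorEquiv h₁ h₂ h hp (p₁ y.1, p₂ y.2)).toLinearMap
  refine (congrArg L b).trans ((map_sum L _ _).trans (Finset.sum_congr rfl fun i _ ↦ ?_))
  refine (map_smul L (f i (p₁ y.1, p₂ y.2)) _).trans (congrArg (f i (p₁ y.1, p₂ y.2) * ·) ?_)
  exact tensorEquiv_tmul h₁ h₂ h hp (x := (p₁ y.1, p₂ y.2)) (s₁ i (p₁ y.1)) (s₂ i (p₂ y.2))
    ⟨y.1, rfl⟩ ⟨y.2, rfl⟩

theorem herm_tensorEquiv (x : N₁ × N₂) (f₁ g₁ : equivariantFunctions φ₁ p₁ ρ x.1)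
    (f₂ g₂ : equivariantFunctions φ₂ p₂ ρ x.2) :
    (prequantumBundle h).herm x (tensorEquiv h₁ h₂ h hp x (f₁ ⊗ₜ[ℂ] f₂))
        (tensorEquiv h₁ h₂ h hp x (g₁ ⊗ₜ[ℂ] g₂))
      = (prequantumBundle h₁).herm x.1 f₁ g₁ * (prequantumBundle h₂).herm x.2 f₂ g₂ := by
  obtain ⟨y₁, hy₁⟩ := h₁.surjective x.1
  obtain ⟨y₂, hy₂⟩ := h₂.surjective x.2
  refine (h.herm_eq ⟨mk φ₁ φ₂ (y₁, y₂), proj_mk_eq hp ⟨y₁, hy₁⟩ ⟨y₂, hy₂⟩⟩ _ _).trans ?_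
  refine Eq.trans ?_ (congrArg₂ (· * ·) (h₁.herm_eq ⟨y₁, hy₁⟩ f₁ g₁)
    (h₂.herm_eq ⟨y₂, hy₂⟩ f₂ g₂)).symm
  rw [tensorEquiv_tmul h₁ h₂ h hp f₁ f₂ ⟨y₁, hy₁⟩ ⟨y₂, hy₂⟩,
    tensorEquiv_tmul h₁ h₂ h hp g₁ g₂ ⟨y₁, hy₁⟩ ⟨y₂, hy₂⟩, map_mul]
  ring

include hs hα hd₁ hd₂ hd in
theorem D_tensorEquiv (X₁ : VField J₁ N₁) (X₂ : VField J₂ N₂)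
    (ψ₁ : Π x, equivariantFunctions φ₁ p₁ ρ x) (ψ₂ : Π x, equivariantFunctions φ₂ p₂ ρ x)
    {U₁ : Set N₁} {U₂ : Set N₂} (hU₁ : IsOpen U₁)
    (hU₂ : IsOpen U₂) (hψ₁ : (prequantumBundle h₁).SmoothOn ψ₁ U₁)
    (hψ₂ : (prequantumBundle h₂).SmoothOn ψ₂ U₂) {x : N₁ × N₂} (hx : x ∈ U₁ ×ˢ U₂) :
    (prequantumBundle h).D (prodVField X₁ X₂)
        (fun x ↦ tensorEquiv h₁ h₂ h hp x (ψ₁ x.1 ⊗ₜ[ℂ] ψ₂ x.2)) x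
      = tensorEquiv h₁ h₂ h hp x
        ((show equivariantFunctions φ₁ p₁ ρ x.1 from (prequantumBundle h₁).D X₁ ψ₁ x.1) ⊗ₜ[ℂ] ψ₂ x.2
        + ψ₁ x.1 ⊗ₜ[ℂ]
          (show equivariantFunctions φ₂ p₂ ρ x.2 from (prequantumBundle h₂).D X₂ ψ₂ x.2)) := by
  obtain ⟨y₁, hy₁⟩ := h₁.surjective x.1
  obtain ⟨y₂, hy₂⟩ := h₂.surjective x.2
  have d₁ := h₁.mdifferentiableAt_sectionFun hU₁ hψ₁ hx.1
  have d₂ := h₂.mdifferentiableAt_sectionFun hU₂ hψ₂ hx.2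
  -- Smoothness of the product section makes D the actual horizontal derivative on the quotient.
  have hsm : (prequantumBundle h).SmoothOn
      (fun x ↦ tensorEquiv h₁ h₂ h hp x (ψ₁ x.1 ⊗ₜ[ℂ] ψ₂ x.2)) (U₁ ×ˢ U₂) := by
    refine (smoothOn_iff_mk h hs _ (hU₁.prod hU₂)).2 ?_
    exact (smoothOn_tmul h₁ h₂ hp hs hU₁ hU₂ hψ₁ hψ₂).congr
      fun y _ ↦ sectionFun_tensorEquiv_tmul h₁ h₂ h hp ψ₁ ψ₂ y
  have d := h.mdifferentiableAt_sectionFun (hU₁.prod hU₂) hsm hx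
  have hy := proj_mk_eq hp ⟨y₁, hy₁⟩ ⟨y₂, hy₂⟩
  refine h.fiber_ext ⟨mk φ₁ φ₂ (y₁, y₂), hy⟩ ?_
  refine (h.D_apply hd _ _ d ⟨mk φ₁ φ₂ (y₁, y₂), hy⟩).trans ?_
  refine (horizontalDeriv_mk h₁ h₂ h hp hs hα hd₁ hd₂ hd X₁ X₂
    (sectionFun_tensorEquiv_tmul h₁ h₂ h hp ψ₁ ψ₂) (d _ hy) (d₁ _ hy₁) (d₂ _ hy₂)).trans ?_
  rw [map_add]
  refine congrArg₂ (· + ·) ?_ ?_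
  · refine Eq.trans ?_ (tensorEquiv_tmul h₁ h₂ h hp _ _ ⟨y₁, hy₁⟩ ⟨y₂, hy₂⟩).symm
    exact congrArg₂ (· * ·) (h₁.D_apply hd₁ X₁ ψ₁ d₁ ⟨y₁, hy₁⟩).symm
      (sectionFun_eq ψ₂ ⟨y₂, hy₂⟩)
  · refine Eq.trans ?_ (tensorEquiv_tmul h₁ h₂ h hp _ _ ⟨y₁, hy₁⟩ ⟨y₂, hy₂⟩).symm
    exact congrArg₂ (· * ·) (sectionFun_eq ψ₁ ⟨y₁, hy₁⟩)
      (h₂.D_apply hd₂ X₂ ψ₂ d₂ ⟨y₂, hy₂⟩).symm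

include hs hα hd₁ hd₂ hd in
theorem isTensorProductIso :
    IsTensorProductIso (prequantumBundle h₁) (prequantumBundle h₂) (prequantumBundle h)
      (fun x ↦ tensorEquiv h₁ h₂ h hp x) where
  smoothOn_iff ψ W hW := ⟨tensorSmoothOn_of_smoothOn h₁ h₂ h hp hs hd₁ hd₂ ψ hW,
    smoothOn_of_tensorSmoothOn h₁ h₂ h hp hs (h.isHermitianLineBundle hd) ψ hW⟩
  herm_tmul x f₁ g₁ f₂ g₂ := herm_tensorEquiv h₁ h₂ h hp x f₁ g₁ f₂ g₂
  D_tmul X₁ X₂ ψ₁ ψ₂ U₁ U₂ hU₁ hU₂ hψ₁ hψ₂ x hx :=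
    D_tensorEquiv h₁ h₂ h hp hs hα hd₁ hd₂ hd X₁ X₂ ψ₁ ψ₂ hU₁ hU₂ hψ₁ hψ₂ hx

end ReducedProduct

end Prequantization

/-! ### The theorem for manifolds modelled on Euclidean spaces -/

theorem mainTheorem4 {n₁ n₂ : ℕ}
    {M₁ : Type*} [TopologicalSpace M₁] [T2Space M₁] [SecondCountableTopology M₁] [ConnectedSpace M₁]
    [ChartedSpace (EuclideanSpace ℝ (Fin (2 * n₁ + 1))) M₁] [IsManifold (𝓡 (2 * n₁ + 1)) ∞ M₁]
    {N₁ : Type*} [TopologicalSpace N₁] [T2Space N₁] [SecondCountableTopology N₁]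
    [ChartedSpace (EuclideanSpace ℝ (Fin (2 * n₁))) N₁] [IsManifold (𝓡 (2 * n₁)) ∞ N₁]
    {M₂ : Type*} [TopologicalSpace M₂] [T2Space M₂] [SecondCountableTopology M₂] [ConnectedSpace M₂]
    [ChartedSpace (EuclideanSpace ℝ (Fin (2 * n₂ + 1))) M₂] [IsManifold (𝓡 (2 * n₂ + 1)) ∞ M₂]
    {N₂ : Type*} [TopologicalSpace N₂] [T2Space N₂] [SecondCountableTopology N₂]
    [ChartedSpace (EuclideanSpace ℝ (Fin (2 * n₂))) N₂] [IsManifold (𝓡 (2 * n₂)) ∞ N₂]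
    {η₁ : OneForm (𝓡 (2 * n₁ + 1)) M₁} {R₁ : VField (𝓡 (2 * n₁ + 1)) M₁} {φ₁ : Flow ℝ M₁}
    {p₁ : M₁ → N₁} {Ω₁ : TwoForm (𝓡 (2 * n₁)) N₁}
    {η₂ : OneForm (𝓡 (2 * n₂ + 1)) M₂} {R₂ : VField (𝓡 (2 * n₂ + 1)) M₂} {φ₂ : Flow ℝ M₂}
    {p₂ : M₂ → N₂} {Ω₂ : TwoForm (𝓡 (2 * n₂)) N₂} {ρ : ENNReal}
    (h₁ : IsPrincipalContactification (𝓡 (2 * n₁ + 1)) (𝓡 (2 * n₁)) η₁ R₁ φ₁ p₁ Ω₁ ρ)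
    (h₂ : IsPrincipalContactification (𝓡 (2 * n₂ + 1)) (𝓡 (2 * n₂)) η₂ R₂ φ₂ p₂ Ω₂ ρ) :
    -- the quotient `(M₁ × M₂) / (R₁ - R₂)` is a connected smooth manifold of dimension
    -- `dim M₁ + dim M₂ - 1`, and the canonical projection onto it is a smooth submersion
    T2Space (ReducedProduct φ₁ φ₂) ∧ SecondCountableTopology (ReducedProduct φ₁ φ₂) ∧
    ConnectedSpace (ReducedProduct φ₁ φ₂) ∧
    ∃ (_ : ChartedSpace (EuclideanSpace ℝ (Fin (2 * (n₁ + n₂) + 1))) (ReducedProduct φ₁ φ₂))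
      (_ : IsManifold (𝓡 (2 * (n₁ + n₂) + 1)) ∞ (ReducedProduct φ₁ φ₂)),
      IsSmoothSubmersion ((𝓡 (2 * n₁ + 1)).prod (𝓡 (2 * n₂ + 1))) (𝓡 (2 * (n₁ + n₂) + 1))
        (ReducedProduct.mk φ₁ φ₂) ∧
    -- `η` is the reduction of `η₁ ⊕ η₂`, `p` is induced by `p₁ × p₂`
    ∃ (η : OneForm (𝓡 (2 * (n₁ + n₂) + 1)) (ReducedProduct φ₁ φ₂))
      (R : VField (𝓡 (2 * (n₁ + n₂) + 1)) (ReducedProduct φ₁ φ₂))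
      (φ : Flow ℝ (ReducedProduct φ₁ φ₂)) (p : ReducedProduct φ₁ φ₂ → N₁ × N₂),
      pullback₁ ((𝓡 (2 * n₁ + 1)).prod (𝓡 (2 * n₂ + 1))) (ReducedProduct.mk φ₁ φ₂) η
        = prodOneForm η₁ η₂ ∧
      (∀ y, p (ReducedProduct.mk φ₁ φ₂ y) = (p₁ y.1, p₂ y.2)) ∧
    -- these make the quotient a principal contactification of the product, with period `ρ`
    ∃ h : IsPrincipalContactification (𝓡 (2 * (n₁ + n₂) + 1)) ((𝓡 (2 * n₁)).prod (𝓡 (2 * n₂)))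
        η R φ p (prodTwoForm Ω₁ Ω₂) ρ,
    -- its prequantum bundle is the tensor product of the two prequantum bundles
      (prequantumBundle h).IsHermitianLineBundle ∧ (prequantumBundle h).IsLinearConnection ∧
      ∃ Φ : ∀ x : N₁ × N₂,
          ((prequantumBundle h₁).Fiber x.1 ⊗[ℂ] (prequantumBundle h₂).Fiber x.2)
            ≃ₗ[ℂ] (prequantumBundle h).Fiber x,
        IsTensorProductIso (prequantumBundle h₁) (prequantumBundle h₂) (prequantumBundle h) Φ ∧
        -- `Φ` is induced by the product of equivariant functions
        ∀ (ψ₁ : Π x, (prequantumBundle h₁).Fiber x) (ψ₂ : Π x, (prequantumBundle h₂).Fiber x)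
          (y : M₁ × M₂),
          sectionFun (φ := φ) (p := p) (ρ := ρ) (fun x ↦ Φ x (ψ₁ x.1 ⊗ₜ[ℂ] ψ₂ x.2))
              (ReducedProduct.mk φ₁ φ₂ y)
            = sectionFun (φ := φ₁) (p := p₁) (ρ := ρ) ψ₁ y.1
              * sectionFun (φ := φ₂) (p := p₂) (ρ := ρ) ψ₂ y.2 := by
  have hd₁ : Module.finrank ℝ (EuclideanSpace ℝ (Fin (2 * n₁ + 1)))
      = Module.finrank ℝ (EuclideanSpace ℝ (Fin (2 * n₁))) + 1 := by simp
  have hd₂ : Module.finrank ℝ (EuclideanSpace ℝ (Fin (2 * n₂ + 1)))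
      = Module.finrank ℝ (EuclideanSpace ℝ (Fin (2 * n₂))) + 1 := by simp
  have hd : Module.finrank ℝ (EuclideanSpace ℝ (Fin (2 * (n₁ + n₂) + 1)))
      = Module.finrank ℝ (EuclideanSpace ℝ (Fin (2 * n₁)) × EuclideanSpace ℝ (Fin (2 * n₂))) + 1 := by
    rw [Module.finrank_prod]
    simp
    ring
  have hd' : Module.finrank ℝ (EuclideanSpace ℝ (Fin (2 * n₁ + 1)))
      + Module.finrank ℝ (EuclideanSpace ℝ (Fin (2 * n₂ + 1)))
      = Module.finrank ℝ (EuclideanSpace ℝ (Fin (2 * (n₁ + n₂) + 1))) + 1 := by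
    simp
    ring
  -- The quotient is locally M₁ × N₂, of dimension (2n₁ + 1) + 2n₂.
  have hL : Module.finrank ℝ (EuclideanSpace ℝ (Fin (2 * n₁ + 1)) × EuclideanSpace ℝ (Fin (2 * n₂)))
      = Module.finrank ℝ (EuclideanSpace ℝ (Fin (2 * (n₁ + n₂) + 1))) := by
    rw [Module.finrank_prod]
    simp
    ring
  have hq := ReducedProduct.isOpenQuotientMap_mk φ₁ φ₂
  refine ⟨ReducedProduct.t2Space h₁ h₂ hd₂, hq.isQuotientMap.secondCountableTopology hq.isOpenMap,
    inferInstance, ?_⟩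
  obtain ⟨C, hC, hs⟩ := ReducedProduct.exists_isManifold h₁ h₂ hd₂
    (ContinuousLinearEquiv.ofFinrankEq hL)
  obtain ⟨p, hp⟩ := ReducedProduct.exists_proj h₁ h₂
  obtain ⟨η, hη, hα⟩ := ReducedProduct.exists_oneForm h₁ h₂ hs hd'
  have h := ReducedProduct.isPrincipalContactification h₁ h₂ hs hp hη hα hd
  exact ⟨C, hC, hs.isSmoothSubmersion, η, _, reducedFlow φ₁ φ₂, p, hα, hp, h,
    h.isHermitianLineBundle hd, h.isLinearConnection hd,
    fun x ↦ ReducedProduct.tensorEquiv h₁ h₂ h hp x,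
    ReducedProduct.isTensorProductIso h₁ h₂ h hp hs hα hd₁ hd₂ hd,
    ReducedProduct.sectionFun_tensorEquiv_tmul h₁ h₂ h hp⟩
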